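/- Let $d=2$ and $1<\gamma<\infty$, or $d=3$ and $1<\gamma<3$; put $p(r)=\frac{\gamma-1}{\gamma}r^\gamma$ and $f(r)=r\int_0^r p(s)s^{-2}\,ds=\frac1\gamma r^\gamma$. Let $0<T\le\infty$. A pair $(\rho,J)$ is a finite energy weak solution on $[0,T)\times\mathbb R^d$ of the quantum hydrodynamic (QHD) system $$\partial_t\rho+\operatorname{div}J=0,\qquad \partial_tJ+\operatorname{div}\Big(\frac{J\otimes J}{\rho}\Big)+\nabla p(\rho)=\tfrac12\rho\nabla\Big(\frac{\Delta\sqrt\rho}{\sqrt\rho}\Big)$$ with initial data $\rho_0,J_0\in L^1_{loc}(\mathbb R^d)$ if there are $\sqrt\rho\ge0$ in $L^2_{loc}([0,T);H^1_{loc}(\mathbb R^d))$ and $\Lambda\in L^2_{loc}([0,T);L^2_{loc}(\mathbb R^d;\mathbb R^d))$ such that $\rho=(\sqrt\rho)^2$, $J=\sqrt\rho\,\Lambda$, $p(\rho)\in L^1_{loc}([0,T)\times\mathbb R^d)$, and: * for all $\eta\in C_c^\infty([0,T)\times\mathbb R^d)$: $\int_0^T\!\int\rho\,\partial_t\eta+J\cdot\nabla\eta\,dx\,dt+\int\rho_0\,\eta(0,\cdot)\,dx=0$;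 * for all $\zeta\in C_c^\infty([0,T)\times\mathbb R^d;\mathbb R^d)$: $\int_0^T\!\int J\cdot\partial_t\zeta+\big(\Lambda\otimes\Lambda+\nabla\sqrt\rho\otimes\nabla\sqrt\rho\big):\nabla\zeta+p(\rho)\operatorname{div}\zeta-\tfrac14\rho\,\Delta\operatorname{div}\zeta\,dx\,dt+\int J_0\cdot\zeta(0,\cdot)\,dx=0$; * the energy $E(t)=\int_{\mathbb R^d}\frac12|\nabla\sqrt\rho|^2+\frac12|\Lambda|^2+f(\rho)\,dx$ is finite for a.e. $t\in(0,T)$; * for a.e. $t\in(0,T)$, $\nabla\wedge J=2\nabla\sqrt\rho\wedge\Lambda$ in the sense of distributions on $\mathbb R^d$. Let $(\rho,J)$ be such a solution, and let $M_1\ge 0$ be such that $\|\sqrt\rho\|_{L^\infty(0,T;H^1(\mathbb R^d))}+\|\Lambda\|_{L^\infty(0,T;L^2(\mathbb R^d))}\le M_1$. (i) For a.e. $t$ the functions $\rho(t)$ and $\sqrt{\rho p(\rho)}(t)$ are in $L^1(\mathbb R^d)$, and $$\big\||\nabla|^{\frac{3-d}2}\rho\big\|^2_{L^2((0,T)\times\mathbb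 R^d)}+\big\||\nabla|^{\frac{1-d}2}\sqrt{\rho p(\rho)}\big\|^2_{L^2((0,T)\times\mathbb R^d)}\le C\,M_1^4,$$ where $|\nabla|^s$ is the Fourier multiplier with symbol $|\xi|^s$ and $C$ depends only on $d$ and $\gamma$ (in particular not on $T$, so that for global solutions the norms are over all times). (ii) Assume in addition that the energy is conserved or, more generally, non-increasing ($E(t)\le E(s)$ for a.e. $s<t$), and that $\int_{\mathbb R^d}|x|^2\rho_0(x)\,dx\le K<\infty$. Then for every $t_0>0$ there is a constant $C$, depending only on $d,\gamma,M_1,K,t_0$, such that for a.e. $t\in(0,T)$ with $t\ge t_0$ $$\|\nabla\sqrt\rho(t)\|_{L^2}+\big\|\Lambda(t)-\tfrac xt\sqrt\rho(t)\big\|_{L^2}+\|\rho^{\gamma/2}(t)\|_{L^2}\le C\,t^{-\sigma},\qquad \sigma=\min\{1,\tfrac d2(\gamma-1)\}.$$ -/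

import Mathlib

open MeasureTheory
open scoped NNReal ENNReal ContDiff FourierTransform

noncomputable section

namespace QHD

/-- Physical space `ℝ^d` with its Euclidean structure. -/
abbrev E (d : ℕ) : Type := EuclideanSpace ℝ (Fin d)

/-- The pressure exponents under consideration: `1 < γ < ∞` if `d = 2`, `1 < γ < 3` if `d = 3`. -/
def Admissible (d : ℕ) (γ : ℝ) : Prop :=
  (d = 2 ∧ 1 < γ) ∨ (d = 3 ∧ 1 < γ ∧ γ < 3)

/-- The pressure law `p(r) = (γ - 1)/γ * r ^ γ`. -/
def pressure (γ r : ℝ) : ℝ := (γ - 1) / γ * r ^ γ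

/-- The internal energy `f(r) = r * ∫_0^r p(s)/s² ds`. -/
def internalEnergy (γ r : ℝ) : ℝ := r * ∫ s in (0 : ℝ)..r, pressure γ s / s ^ 2

/-- For the power law the internal energy is `r ^ γ / γ`. -/
lemma internalEnergy_eq {γ r : ℝ} (hγ : 1 < γ) (hr : 0 ≤ r) :
    internalEnergy γ r = r ^ γ / γ := by
  have h1 : ∫ s in (0 : ℝ)..r, pressure γ s / s ^ 2
      = ∫ s in (0 : ℝ)..r, (γ - 1) / γ * s ^ (γ - 2) := by
    apply intervalIntegral.integral_congr_ae
    refine Filter.Eventually.of_forall fun s hs => ?_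
    rw [Set.uIoc_of_le hr] at hs
    have h2 : s ^ (γ - 2) = s ^ γ / s ^ 2 := by
      rw [Real.rpow_sub hs.1]; norm_num
    simp only [pressure, h2]
    ring
  have hγ0 : γ ≠ 0 := by linarith
  have hγ1 : γ - 1 ≠ 0 := by linarith
  rw [internalEnergy, h1, intervalIntegral.integral_const_mul,
    integral_rpow (Or.inl (by linarith)), show γ - 2 + 1 = γ - 1 by ring,
    Real.zero_rpow hγ1, sub_zero]
  have h3 : r * r ^ (γ - 1) = r ^ γ := by
    rcases hr.eq_or_lt with h | h
    · rw [← h, Real.zero_rpow hγ0, zero_mul]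
    · rw [Real.rpow_sub_one h.ne']; field_simp
  rw [← h3]
  field_simp

/-- The time interval `(0, T)`, where `0 < T ≤ ∞`. -/
def timeInterval (T : EReal) : Set ℝ := {t | 0 < t ∧ (t : EReal) < T}

/-- The open space-time slab `(0, T) × ℝ^d`. -/
def slab (d : ℕ) (T : EReal) : Set (ℝ × E d) := {z | z.1 ∈ timeInterval T}

/-- The `i`-th standard basis vector of `ℝ^d`. -/
def e {d : ℕ} (i : Fin d) : E d := EuclideanSpace.single i 1

/-- Time derivative of a function on space-time. -/
def dt {d : ℕ} (η : ℝ × E d → ℝ) (z : ℝ × E d) : ℝ := fderiv ℝ η z (1, 0)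

/-- The `i`-th space derivative of a function on space-time. -/
def dx {d : ℕ} (i : Fin d) (η : ℝ × E d → ℝ) (z : ℝ × E d) : ℝ := fderiv ℝ η z (0, e i)

/-- Test functions in `C_c^∞([0, T) × ℝ^d; F)`, as restrictions to `t ≥ 0` of smooth compactly
supported functions on `(-∞, T) × ℝ^d`; they need not vanish at `t = 0`. -/
def IsTest {d : ℕ} {F : Type} [NormedAddCommGroup F] [NormedSpace ℝ F] (T : EReal)
    (η : ℝ × E d → F) : Prop :=
  ContDiff ℝ ∞ η ∧ HasCompactSupport η ∧ tsupport η ⊆ {z | (z.1 : EReal) < T}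

/-- `g` is the weak gradient on `ℝ^d` of the locally integrable function `u`. -/
def HasWeakGradient {d : ℕ} (u : E d → ℝ) (g : E d → E d) : Prop :=
  LocallyIntegrable u ∧ LocallyIntegrable g ∧
    ∀ φ : E d → ℝ, ContDiff ℝ ∞ φ → HasCompactSupport φ → ∀ i : Fin d,
      ∫ x, u x * fderiv ℝ φ x (e i) = -∫ x, g x i * φ x

/-- `L²_loc([0, T) × ℝ^d; F)`. -/
def MemL2Loc {d : ℕ} {F : Type} [NormedAddCommGroup F] (T : EReal) (u : ℝ → E d → F) : Prop :=
  ∀ K : Set (ℝ × E d), IsCompact K → K ⊆ {z | 0 ≤ z.1 ∧ (z.1 : EReal) < T} →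
    MemLp (fun z : ℝ × E d => u z.1 z.2) 2 (volume.restrict K)

/-- The mass density `ρ = (√ρ)²`; the argument `R` stands for `√ρ`. -/
def rho {d : ℕ} (R : ℝ → E d → ℝ) (t : ℝ) (x : E d) : ℝ := R t x ^ 2

/-- The momentum density `J = √ρ Λ`; the argument `R` stands for `√ρ`. -/
def mom {d : ℕ} (R : ℝ → E d → ℝ) (Λ : ℝ → E d → E d) (t : ℝ) (x : E d) : E d :=
  R t x • Λ t x

/-- The total energy `E(t) = ∫ ½|∇√ρ|² + ½|Λ|² + f(ρ) dx ∈ [0, ∞]`, with `R = √ρ`, `G = ∇√ρ`. -/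
def energy {d : ℕ} (γ : ℝ) (R : ℝ → E d → ℝ) (G Λ : ℝ → E d → E d) (t : ℝ) : ℝ≥0∞ :=
  ∫⁻ x, ENNReal.ofReal
    (1 / 2 * ‖G t x‖ ^ 2 + 1 / 2 * ‖Λ t x‖ ^ 2 + internalEnergy γ (rho R t x))

/-- Finite energy weak solutions of the QHD system
`∂ₜρ + div J = 0`, `∂ₜJ + div(Λ ⊗ Λ + ∇√ρ ⊗ ∇√ρ) + ∇p(ρ) = ¼ ∇Δρ` on `[0, T) × ℝ^d` with initial
data `ρ₀`, `J₀`. Here `R = √ρ`, `G = ∇√ρ` is its weak space gradient, `ρ = R²` and `J = R Λ`. -/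
structure IsFiniteEnergyWeakSolution {d : ℕ} (γ : ℝ) (T : EReal)
    (ρ₀ : E d → ℝ) (J₀ : E d → E d) (R : ℝ → E d → ℝ) (G Λ : ℝ → E d → E d) : Prop where
  locInt_rho0 : LocallyIntegrable ρ₀
  locInt_J0 : LocallyIntegrable J₀
  memL2Loc_R : MemL2Loc T R
  memL2Loc_G : MemL2Loc T G
  memL2Loc_Λ : MemL2Loc T Λ
  nonneg : ∀ᵐ z ∂(volume.restrict (slab d T)), 0 ≤ R z.1 z.2
  weakGradient : ∀ᵐ t ∂(volume.restrict (timeInterval T)), HasWeakGradient (R t) (G t)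
  /-- local integrability of `p(ρ)`, needed for the weak formulation to be meaningful -/
  locInt_pressure : ∀ K : Set (ℝ × E d), IsCompact K →
    K ⊆ {z | 0 ≤ z.1 ∧ (z.1 : EReal) < T} →
      IntegrableOn (fun z : ℝ × E d => pressure γ (rho R z.1 z.2)) K
  /-- the continuity equation with its initial datum -/
  continuity : ∀ η : ℝ × E d → ℝ, IsTest T η →
    (∫ z in slab d T,
        (rho R z.1 z.2 * dt η z + ∑ i, mom R Λ z.1 z.2 i * dx i η z))
      + ∫ x, ρ₀ x * η (0, x) = 0
  /-- the momentum equation with its initial datum -/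
  momentum : ∀ ζ : ℝ × E d → E d, IsTest T ζ →
    (∫ z in slab d T,
        ((∑ i, mom R Λ z.1 z.2 i * dt (fun w => ζ w i) z)
          + (∑ i, ∑ j, Λ z.1 z.2 i * Λ z.1 z.2 j * dx j (fun w => ζ w i) z)
          + pressure γ (rho R z.1 z.2) * (∑ i, dx i (fun w => ζ w i) z)
          + (∑ i, ∑ j, G z.1 z.2 i * G z.1 z.2 j * dx j (fun w => ζ w i) z)
          - 1 / 4 * rho R z.1 z.2 * (∑ j, dx j (dx j (fun y => ∑ i, dx i (fun w => ζ w i) y)) z)))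
      + ∫ x, (∑ i, J₀ x i * ζ (0, x) i) = 0
  finiteEnergy : ∀ᵐ t ∂(volume.restrict (timeInterval T)), energy γ R G Λ t < ⊤
  /-- generalized irrotationality `∇ ∧ J = 2 ∇√ρ ∧ Λ` in the sense of distributions -/
  irrotational : ∀ᵐ t ∂(volume.restrict (timeInterval T)), ∀ i j : Fin d,
    ∀ φ : E d → ℝ, ContDiff ℝ ∞ φ → HasCompactSupport φ →
      -∫ x, (mom R Λ t x j * fderiv ℝ φ x (e i) - mom R Λ t x i * fderiv ℝ φ x (e j))
        = ∫ x, 2 * (G t x i * Λ t x j - G t x j * Λ t x i) * φ x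

/-- `‖√ρ‖_{L^∞(0,T;H¹)} + ‖Λ‖_{L^∞(0,T;L²)}`, with `‖u‖_{H¹} = ‖u‖_{L²} + ‖∇u‖_{L²}`. -/
def energyNorm {d : ℕ} (T : EReal) (R : ℝ → E d → ℝ) (G Λ : ℝ → E d → E d) : ℝ≥0∞ :=
  essSup (fun t => eLpNorm (R t) 2 volume + eLpNorm (G t) 2 volume)
      (volume.restrict (timeInterval T))
    + essSup (fun t => eLpNorm (Λ t) 2 volume) (volume.restrict (timeInterval T))

/-- `‖|∇|^s u‖²_{L²(ℝ^d)}` for `u ∈ L¹(ℝ^d)`: the symbol of `|∇|^s` is `(2π|ξ|)^s` for the Fourier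
transform `𝓕 u ξ = ∫ exp(-2πi x·ξ) u(x) dx`, which is an isometry of `L²`. -/
def homSobolevSq {d : ℕ} (s : ℝ) (u : E d → ℝ) : ℝ≥0∞ :=
  ∫⁻ ξ : E d, ENNReal.ofReal ((2 * Real.pi * ‖ξ‖) ^ (2 * s))
    * ‖𝓕 (fun x : E d => (u x : ℂ)) ξ‖ₑ ^ 2

/-- `‖|∇|^s u‖²_{L²((0,T) × ℝ^d)}`. -/
def spaceTimeSq {d : ℕ} (T : EReal) (s : ℝ) (u : ℝ → E d → ℝ) : ℝ≥0∞ :=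
  ∫⁻ t in timeInterval T, homSobolevSq s (u t)

/-- The function `√(ρ p(ρ))`. -/
def sqrtRhoP {d : ℕ} (γ : ℝ) (R : ℝ → E d → ℝ) (t : ℝ) (x : E d) : ℝ :=
  Real.sqrt (rho R t x * pressure γ (rho R t x))

/-- The energy does not increase in time (in particular, it may be conserved). -/
def EnergyNonincreasing {d : ℕ} (γ : ℝ) (T : EReal) (R : ℝ → E d → ℝ)
    (G Λ : ℝ → E d → E d) : Prop :=
  ∀ᵐ s ∂(volume.restrict (timeInterval T)), ∀ᵐ t ∂(volume.restrict (timeInterval T)),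
    s ≤ t → energy γ R G Λ t ≤ energy γ R G Λ s

/-- The decay rate `σ = min {1, d/2 * (γ - 1)}`. -/
def decayRate (d : ℕ) (γ : ℝ) : ℝ := min 1 ((d : ℝ) / 2 * (γ - 1))

end QHD

end

/-! Both estimates come from choosing test functions in the two weak equations. All moments of a
solution are therefore treated as functions of time known up to null sets. `IsPrimitive` records an
identity `A = c + ∫ B` almost everywhere, and `IsPrimitive.mul` is the product rule that replaces
pointwise differentiation. `exists_regularFields` supplies jointly measurable representatives
bounded at every time, with the Sobolev embedding (`sobolev_weak`) bounding the integral of `ρ ^ γ`.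

For (i), the interaction Morawetz argument is carried out one direction at a time. Fix a unit vector
`θ`, an approximate identity `g` on the line, and a primitive `S` of `2g` with `|S| ≤ 1`. Write
`a_k(s)` for the integral of `a(x) k(s - θ·x)`, that is `planar`. Testing with the plane step `S(s -
θ·x)` gives `∂ₜ ρ_S = -2 j_g` and `∂ₜ(-2 j_g) = 2 q_{g'} - ½ ρ_{g'''}`. Here `j` is the momentum
along `θ` and `q = (θ·Λ)² + (θ·∇√ρ)² + p(ρ)`. The functional `W = ∫ ρ_S (-2 j_g) ds` satisfies `|W|
≤ 2M⁴`, whatever `g` is. Integration by parts in `s` gives `W' = ∫ (4 j_g² - 4 ρ_g q_g - ρ_{g'}²)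
ds`. Cauchy–Schwarz bounds `j_g² + (√(ρp))_g²` by `ρ_g q_g`, so `-W'` dominates `∫ ρ_{g'}² + 4 ∫
(√(ρp))_g²` (`RegularFields.morawetz_le`). Hence the time integral of this sum is at most `4M⁴`,
uniformly in `T`, `θ` and `g` (`WeakEquations.lintegral_morawetz_le`).

By the Fourier slice theorem and Plancherel on the line, the sum equals the integral over `κ` of
`|ĝ(κ)|² (|2πκ|² |ρ̂(κθ)|² + 4 |(√(ρp))^(κθ)|²)`. Letting `g` tend to the Dirac mass and using Fatou
removes `ĝ`. Integrating over `θ` in the sphere and passing to polar coordinates produces the weight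
`|ξ|^(1-d)`, which is exactly what turns these two terms into the norms of order `(3-d)/2` and
`(1-d)/2` (`WeakEquations.spaceTimeSq_le`).

For (ii), use the weight `½|x|²`. With `V` the weighted mass, `F` its flux and `X` the corresponding
stress, `(V - tF)' = -tX`, and completing the square turns `V - tF + ½t²‖Λ‖²` into `½‖tΛ - x√ρ‖²`.
Since `X = 2E - (2 - d(γ-1)) P` with `P` the internal energy, and `t²E(t) ≤ 2∫ sE(s) ds` for a
nonincreasing energy, the pseudo-conformal energy is at most `K/2 + (2 - d(γ-1)) ∫ sP(s) ds`
(`WeakEquations.conformal_le`). It also dominates `t²P(t)`, so it is bounded when `d(γ-1) ≥ 2` and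
grows at most like `t^(2-d(γ-1))` otherwise, by Gronwall from `t₀` on. Division by `t²` gives the
rate. The quadratic weight is reached through compactly supported truncations satisfying `|∇φ|² ≤
2φ`, the one inequality that keeps the square complete (`exists_isVirialWeight`). -/

noncomputable section

namespace QHD

/-! ### Functions of time with an integrable derivative -/

/-- `A` agrees almost everywhere on `(0, T)` with the primitive of `B` that starts at `c`. -/
def IsPrimitive (T : EReal) (A B : ℝ → ℝ) (c : ℝ) : Prop :=
  ∀ᵐ t ∂(volume.restrict (timeInterval T)), A t = c + ∫ s in (0 : ℝ)..t, B s

/-- Smooth compactly supported functions on `(-∞, T)`. -/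
structure IsTimeTest (T : EReal) (χ : ℝ → ℝ) : Prop where
  smooth : ContDiff ℝ ∞ χ
  compact : HasCompactSupport χ
  support : tsupport χ ⊆ {t | (t : EReal) < T}

lemma isOpen_timeInterval (T : EReal) : IsOpen (timeInterval T) := by
  have h1 : IsOpen {t : ℝ | (t : EReal) < T} :=
    isOpen_lt continuous_coe_real_ereal continuous_const
  have h0 : IsOpen {t : ℝ | (0 : ℝ) < t} := isOpen_lt continuous_const continuous_id
  exact h0.inter h1

lemma measurableSet_timeInterval (T : EReal) : MeasurableSet (timeInterval T) :=
  (isOpen_timeInterval T).measurableSet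

lemma Ioc_subset_timeInterval {T : EReal} {t : ℝ} (ht : t ∈ timeInterval T) :
    Set.Ioc 0 t ⊆ timeInterval T := fun _ hs =>
  ⟨hs.1, lt_of_le_of_lt (EReal.coe_le_coe_iff.2 hs.2) ht.2⟩

lemma ordConnected_timeInterval (T : EReal) : (timeInterval T).OrdConnected :=
  ⟨fun _ ha _ hb _ hs =>
    ⟨lt_of_lt_of_le ha.1 hs.1, lt_of_le_of_lt (EReal.coe_le_coe_iff.2 hs.2) hb.2⟩⟩

lemma exists_mem_timeInterval {T : EReal} (hT : 0 < T) : ∃ a, a ∈ timeInterval T := by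
  obtain ⟨a, h0, h1⟩ := EReal.lt_iff_exists_real_btwn.1 hT
  exact ⟨a, by exact_mod_cast h0, h1⟩

lemma LocallyIntegrable.intervalIntegrable' {B : ℝ → ℝ} (hB : LocallyIntegrable B) (a b : ℝ) :
    IntervalIntegrable B volume a b := by
  rw [intervalIntegrable_iff]
  exact (hB.integrableOn_isCompact isCompact_uIcc).mono_set Set.uIoc_subset_uIcc

lemma absolutelyContinuous_primitive {B : ℝ → ℝ} (hB : LocallyIntegrable B) (c b : ℝ) :
    AbsolutelyContinuousOnInterval (fun t => c + ∫ s in (0 : ℝ)..t, B s) 0 b := by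
  have h1 := (LocallyIntegrable.intervalIntegrable' hB 0
    b).absolutelyContinuousOnInterval_intervalIntegral (c := 0) (by simp)
  have h2 : AbsolutelyContinuousOnInterval (fun _ : ℝ => c) 0 b :=
    (LipschitzWith.const c).lipschitzOnWith.absolutelyContinuousOnInterval
  exact h2.add h1

/-- Primitives of locally integrable functions are absolutely continuous, with derivatives `B` and
`B'` at almost every point by Lebesgue differentiation; this is integration by parts for such
functions. -/
lemma primitive_mul {B B' : ℝ → ℝ} (hB : LocallyIntegrable B) (hB' : LocallyIntegrable B')
    (c c' t : ℝ) :
    (c + ∫ s in (0 : ℝ)..t, B s) * (c' + ∫ s in (0 : ℝ)..t, B' s) =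
      c * c' + ∫ r in (0 : ℝ)..t, (B r * (c' + ∫ s in (0 : ℝ)..r, B' s)
        + (c + ∫ s in (0 : ℝ)..r, B s) * B' r) := by
  have h := (absolutelyContinuous_primitive hB c t).integral_deriv_mul_eq_sub
    (absolutelyContinuous_primitive hB' c' t)
  have h2 : ∫ r in (0 : ℝ)..t, (B r * (c' + ∫ s in (0 : ℝ)..r, B' s)
        + (c + ∫ s in (0 : ℝ)..r, B s) * B' r)
      = ∫ x in (0 : ℝ)..t, deriv (fun t => c + ∫ s in (0 : ℝ)..t, B s) x *
          (c' + ∫ s in (0 : ℝ)..x, B' s) +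
          (c + ∫ s in (0 : ℝ)..x, B s) * deriv (fun t => c' + ∫ s in (0 : ℝ)..t, B' s) x := by
    apply intervalIntegral.integral_congr_ae
    filter_upwards [LocallyIntegrable.ae_hasDerivAt_integral hB,
      LocallyIntegrable.ae_hasDerivAt_integral hB'] with x hx hx' _
    rw [((hx 0).const_add c).deriv, ((hx' 0).const_add c').deriv]
  rw [h2, h]
  simp

/-- Used for mass times flux in the interaction functional, and for time times flux in the virial
identity. -/
lemma IsPrimitive.mul {T : EReal} {A B A' B' : ℝ → ℝ} {c c' : ℝ} (h : IsPrimitive T A B c)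
    (h' : IsPrimitive T A' B' c') (hB : LocallyIntegrable B) (hB' : LocallyIntegrable B') :
    IsPrimitive T (fun t => A t * A' t) (fun t => B t * A' t + A t * B' t) (c * c') := by
  have hI := ae_restrict_mem (μ := volume) (measurableSet_timeInterval T)
  have k := (ae_restrict_iff' (measurableSet_timeInterval T)).1 h
  have k' := (ae_restrict_iff' (measurableSet_timeInterval T)).1 h'
  unfold IsPrimitive at *
  filter_upwards [h, h', hI] with t ht ht' htI
  rw [ht, ht', primitive_mul hB hB']
  congr 1
  apply intervalIntegral.integral_congr_ae
  filter_upwards [k, k'] with s hs hs' hst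
  rw [Set.uIoc_of_le htI.1.le] at hst
  have := Ioc_subset_timeInterval htI hst
  rw [hs this, hs' this]

/-- The class of time tests is preserved by passing to a bound for the support. -/
lemma IsTimeTest.exists_bound {T : EReal} {χ : ℝ → ℝ} (hχ : IsTimeTest T χ) (hT : 0 < T) :
    ∃ b ∈ timeInterval T, ∀ t, b ≤ t → χ t = 0 ∧ deriv χ t = 0 := by
  obtain ⟨a, ha⟩ := exists_mem_timeInterval hT
  have hc : IsCompact (insert a (tsupport χ)) := hχ.compact.isCompact.insert a
  obtain ⟨m, hm, hmax⟩ := hc.exists_isMaxOn ⟨a, Set.mem_insert _ _⟩ continuousOn_id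
  have hmT : (m : EReal) < T := by
    rcases hm with rfl | hm
    · exact ha.2
    · exact hχ.support hm
  obtain ⟨b, hb1, hb2⟩ := EReal.lt_iff_exists_real_btwn.1 hmT
  have hmb : m < b := by exact_mod_cast hb1
  have ham : a ≤ m := hmax (Set.mem_insert _ _)
  refine ⟨b, ⟨lt_of_lt_of_le ha.1 (ham.trans hmb.le), hb2⟩, fun t ht => ?_⟩
  have hnot : t ∉ tsupport χ := fun h => by
    have : t ≤ m := hmax (Set.mem_insert_of_mem _ h)
    linarith
  refine ⟨image_eq_zero_of_notMem_tsupport hnot, ?_⟩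
  have : t ∉ Function.support (deriv χ) := fun h => hnot (support_deriv_subset h)
  simpa using this

lemma setIntegral_timeInterval_eq {T : EReal} {f : ℝ → ℝ} {b : ℝ} (hb : b ∈ timeInterval T)
    (hf : ∀ t, b ≤ t → f t = 0) :
    ∫ t in timeInterval T, f t = ∫ t in (0 : ℝ)..b, f t := by
  rw [intervalIntegral.integral_of_le hb.1.le]
  refine setIntegral_eq_of_subset_of_forall_sdiff_eq_zero (measurableSet_timeInterval T)
    (Ioc_subset_timeInterval hb) fun t ht => hf t ?_
  by_contra h
  exact ht.2 ⟨ht.1.1, (not_le.1 h).le⟩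

/-- The converse passage, from a primitive back to the weak form: integrate by parts against `χ`,
which vanishes from some time `b < T` on, so only the boundary term at `0` survives. -/
lemma IsPrimitive.weak {T : EReal} {A B : ℝ → ℝ} {c : ℝ} (h : IsPrimitive T A B c) (hT : 0 < T)
    (hB : LocallyIntegrable B) {χ : ℝ → ℝ} (hχ : IsTimeTest T χ) :
    ∫ t in timeInterval T, (A t * deriv χ t + B t * χ t) = -(c * χ 0) := by
  obtain ⟨b, hb, hz⟩ := hχ.exists_bound hT
  rw [setIntegral_timeInterval_eq hb fun t ht => by simp [hz t ht]]
  have hd : LocallyIntegrable (deriv χ) :=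
    (hχ.smooth.continuous_deriv (by simp)).locallyIntegrable
  have hp : ∀ t, χ 0 + ∫ s in (0 : ℝ)..t, deriv χ s = χ t := fun t => by
    rw [intervalIntegral.integral_deriv_eq_sub
      (fun x _ => (hχ.smooth.differentiable (by simp)) x)
      (LocallyIntegrable.intervalIntegrable' hd 0 t)]
    ring
  have k := primitive_mul hB hd c (χ 0) b
  simp only [hp] at k
  rw [(hz b le_rfl).1, mul_zero] at k
  have k2 : ∫ t in (0 : ℝ)..b, (A t * deriv χ t + B t * χ t) =
      ∫ r in (0 : ℝ)..b, (B r * χ r + (c + ∫ s in (0 : ℝ)..r, B s) * deriv χ r) := by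
    apply intervalIntegral.integral_congr_ae
    filter_upwards [(ae_restrict_iff' (measurableSet_timeInterval T)).1 h] with s hs hst
    rw [Set.uIoc_of_le hb.1.le] at hst
    rw [hs (Ioc_subset_timeInterval hb hst)]
    ring
  rw [k2]
  linarith

/-- The antiderivative from `a` returns to zero after `b` exactly because `θ` has mean zero. -/
lemma exists_timeTest_antideriv {T : EReal} {θ : ℝ → ℝ} (hθ : ContDiff ℝ ∞ θ) {a b : ℝ}
    (ha : a ∈ timeInterval T) (hb : b ∈ timeInterval T)
    (hsupp : ∀ t, t ∉ Set.Icc a b → θ t = 0) (hint : ∫ t, θ t = 0) :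
    ∃ χ : ℝ → ℝ, IsTimeTest T χ ∧ tsupport χ ⊆ timeInterval T ∧ deriv χ = θ := by
  have hii : ∀ x y, IntervalIntegrable θ volume x y := fun x y =>
    hθ.continuous.intervalIntegrable x y
  set χ : ℝ → ℝ := fun t => ∫ s in a..t, θ s with hχ
  have hder : ∀ t, HasDerivAt χ (θ t) t := fun t =>
    intervalIntegral.integral_hasDerivAt_right (hii a t)
      hθ.continuous.stronglyMeasurable.stronglyMeasurableAtFilter hθ.continuous.continuousAt
  have hderiv : deriv χ = θ := funext fun t => (hder t).deriv
  have hsm : ContDiff ℝ ∞ χ := by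
    rw [contDiff_infty_iff_deriv]
    exact ⟨fun t => (hder t).differentiableAt, by rw [hderiv]; exact hθ⟩
  have hzero : ∀ t, t ∉ Set.Icc a b → χ t = 0 := by
    intro t ht
    rcases lt_or_ge t a with h | h
    · simp only [hχ]
      rw [intervalIntegral.integral_symm, neg_eq_zero]
      apply intervalIntegral.integral_zero_ae
      filter_upwards [show ∀ᵐ x : ℝ, x ≠ a by simp [ae_iff, measure_singleton]] with s hsa hs
      rw [Set.uIoc_of_le h.le] at hs
      exact hsupp s fun hs' => hsa (le_antisymm hs.2 hs'.1)
    · have htb : b < t := by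
        by_contra hc
        exact ht ⟨h, not_lt.1 hc⟩
      simp only [hχ]
      rw [← hint, intervalIntegral.integral_of_le h]
      refine setIntegral_eq_integral_of_ae_compl_eq_zero ?_
      filter_upwards [show ∀ᵐ x : ℝ, x ≠ a by simp [ae_iff, measure_singleton]] with s hsa hs
      refine hsupp s fun hs' => hs ⟨lt_of_le_of_ne hs'.1 (Ne.symm hsa), hs'.2.trans htb.le⟩
  have hts : tsupport χ ⊆ Set.Icc a b := by
    refine closure_minimal (fun t ht => ?_) isClosed_Icc
    by_contra h
    exact ht (hzero t h)
  have hIcc : Set.Icc a b ⊆ timeInterval T := (ordConnected_timeInterval T).out ha hb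
  exact ⟨χ, ⟨hsm, HasCompactSupport.intro isCompact_Icc hzero,
    (hts.trans hIcc).trans fun t ht => ht.2⟩, hts.trans hIcc, hderiv⟩

lemma exists_Icc_of_compact {T : EReal} {K : Set ℝ} (hK : IsCompact K) (hKT : K ⊆ timeInterval T)
    (hne : K.Nonempty) : ∃ a ∈ timeInterval T, ∃ b ∈ timeInterval T, K ⊆ Set.Icc a b := by
  obtain ⟨m, hm, hmin⟩ := hK.exists_isMinOn hne continuousOn_id
  obtain ⟨M, hM, hmax⟩ := hK.exists_isMaxOn hne continuousOn_id
  exact ⟨m, hKT hm, M, hKT hM, fun x hx => ⟨hmin hx, hmax hx⟩⟩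

/-- A function on `(0, T)` whose distributional derivative vanishes is constant. -/
lemma ae_const_of_weak {T : EReal} (hT : 0 < T) {D : ℝ → ℝ} (hD : LocallyIntegrable D)
    (h : ∀ χ, IsTimeTest T χ → tsupport χ ⊆ timeInterval T →
      ∫ t in timeInterval T, D t * deriv χ t = 0) :
    ∃ c : ℝ, ∀ᵐ t ∂(volume.restrict (timeInterval T)), D t = c := by
  obtain ⟨a₀, ha₀⟩ := exists_mem_timeInterval hT
  obtain ⟨ε, hε, hball⟩ := Metric.isOpen_iff.1 (isOpen_timeInterval T) a₀ ha₀
  let f : ContDiffBump a₀ := ⟨ε / 4, ε / 2, by linarith, by linarith⟩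
  set χ₀ : ℝ → ℝ := f.normed volume with hχ₀
  have hχ₀s : ContDiff ℝ ∞ χ₀ := f.contDiff_normed
  have hχ₀c : HasCompactSupport χ₀ := f.hasCompactSupport_normed
  have hχ₀t : tsupport χ₀ ⊆ timeInterval T := by
    rw [hχ₀, f.tsupport_normed_eq]
    exact (Metric.closedBall_subset_ball (by change ε / 2 < ε; linarith)).trans hball
  have hχ₀i : ∫ t, χ₀ t = 1 := f.integral_normed
  have hint : ∀ ψ : ℝ → ℝ, Continuous ψ → HasCompactSupport ψ →
      Integrable (fun t => D t * ψ t) := fun ψ hψ hc => by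
    simpa [smul_eq_mul, mul_comm] using hD.integrable_smul_left_of_hasCompactSupport hψ hc
  refine ⟨∫ t, D t * χ₀ t, ?_⟩
  set c := ∫ t, D t * χ₀ t with hc
  have key := (isOpen_timeInterval T).ae_eq_zero_of_integral_contDiff_smul_eq_zero
    (f := fun t => D t - c) (μ := volume)
    ((hD.sub (continuous_const.locallyIntegrable)).locallyIntegrableOn _) ?_
  · rw [ae_restrict_iff' (measurableSet_timeInterval T)]
    filter_upwards [key] with t ht htI
    linarith [ht htI]
  intro ψ hψ hψc hψt
  -- Du Bois-Reymond: subtracting a multiple of the unit-mass bump makes the mean zero, so `θ` is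
  -- the derivative of an admissible test and `∫ Dψ = (∫ ψ)(∫ Dχ₀)`.
  set θ : ℝ → ℝ := fun t => ψ t - (∫ s, ψ s) * χ₀ t with hθ
  have hK : IsCompact (insert a₀ (tsupport ψ ∪ tsupport χ₀)) :=
    (hψc.isCompact.union hχ₀c.isCompact).insert a₀
  obtain ⟨a, ha, b, hb, hab⟩ := exists_Icc_of_compact hK
    (Set.insert_subset ha₀ (Set.union_subset hψt hχ₀t)) ⟨a₀, Set.mem_insert _ _⟩
  have hψi : Integrable ψ := hψ.continuous.integrable_of_hasCompactSupport hψc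
  have hχ₀int : Integrable χ₀ := hχ₀s.continuous.integrable_of_hasCompactSupport hχ₀c
  obtain ⟨χ, hχ, hχt, hχd⟩ := exists_timeTest_antideriv (T := T) (θ := θ)
    (hψ.sub (contDiff_const.mul hχ₀s)) ha hb (fun t ht => by
      have h1 : t ∉ tsupport ψ := fun h' => ht (hab (Set.mem_insert_of_mem _ (Or.inl h')))
      have h2 : t ∉ tsupport χ₀ := fun h' => ht (hab (Set.mem_insert_of_mem _ (Or.inr h')))
      simp [hθ, image_eq_zero_of_notMem_tsupport h1, image_eq_zero_of_notMem_tsupport h2])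
    (by rw [hθ, integral_sub hψi (hχ₀int.const_mul _), integral_const_mul, hχ₀i]; ring)
  have h0 := h χ hχ hχt
  rw [hχd, setIntegral_eq_integral_of_forall_compl_eq_zero (fun t ht => by
    have h1 : t ∉ tsupport ψ := fun h' => ht (hψt h')
    have h2 : t ∉ tsupport χ₀ := fun h' => ht (hχ₀t h')
    simp [hθ, image_eq_zero_of_notMem_tsupport h1, image_eq_zero_of_notMem_tsupport h2])] at h0
  have e1 : ∀ t, D t * θ t = D t * ψ t - (∫ s, ψ s) * (D t * χ₀ t) := fun t => by
    simp only [hθ]; ring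
  simp only [e1] at h0
  rw [integral_sub (hint ψ hψ.continuous hψc)
    ((hint χ₀ hχ₀s.continuous hχ₀c).const_mul _), integral_const_mul] at h0
  have e2 : ∀ t, ψ t • (D t - c) = D t * ψ t - c * ψ t := fun t => by
    rw [smul_eq_mul]; ring
  simp only [e2]
  rw [integral_sub (hint ψ hψ.continuous hψc) (hψi.const_mul _), integral_const_mul]
  rw [← hc] at h0
  linarith

lemma locallyIntegrable_primitive {B : ℝ → ℝ} (hB : LocallyIntegrable B) :
    Continuous fun t => ∫ s in (0 : ℝ)..t, B s :=
  intervalIntegral.continuous_primitive (LocallyIntegrable.intervalIntegrable' hB) 0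

/-- A distributional derivative on `(0, T)` is a derivative in the sense of primitives. -/
lemma exists_isPrimitive_of_weak {T : EReal} (hT : 0 < T) {A B : ℝ → ℝ}
    (hA : LocallyIntegrable A) (hB : LocallyIntegrable B)
    (h : ∀ χ, IsTimeTest T χ → tsupport χ ⊆ timeInterval T →
      ∫ t in timeInterval T, (A t * deriv χ t + B t * χ t) = 0) :
    ∃ c : ℝ, IsPrimitive T A B c := by
  have hP := locallyIntegrable_primitive hB
  obtain ⟨c, hc⟩ := ae_const_of_weak hT (D := fun t => A t - ∫ s in (0 : ℝ)..t, B s)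
    (hA.sub hP.locallyIntegrable) (fun χ hχ hχt => by
      have h1 := h χ hχ hχt
      have h2 : IsPrimitive T (fun t => ∫ s in (0 : ℝ)..t, B s) B 0 :=
        Filter.Eventually.of_forall fun t => by simp
      have h3 := h2.weak hT hB hχ
      have hd : Continuous (deriv χ) := hχ.smooth.continuous_deriv (by simp)
      have i1 : Integrable (fun t => A t * deriv χ t) := by
        simpa [smul_eq_mul, mul_comm] using
          hA.integrable_smul_left_of_hasCompactSupport hd hχ.compact.deriv
      have i2 : Integrable (fun t => B t * χ t) := by
        simpa [smul_eq_mul, mul_comm] using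
          hB.integrable_smul_left_of_hasCompactSupport hχ.smooth.continuous hχ.compact
      have i3 : Integrable (fun t => (∫ s in (0 : ℝ)..t, B s) * deriv χ t) :=
        (hP.mul hd).integrable_of_hasCompactSupport hχ.compact.deriv.mul_left
      rw [integral_add i1.integrableOn i2.integrableOn] at h1
      rw [integral_add i3.integrableOn i2.integrableOn] at h3
      simp only [sub_mul]
      rw [integral_sub i1.integrableOn i3.integrableOn]
      linarith)
  refine ⟨c, ?_⟩
  unfold IsPrimitive
  filter_upwards [hc] with t ht
  linarith

/-- The distributional derivative on `[0, T)` with its initial value. -/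
lemma isPrimitive_of_weak {T : EReal} (hT : 0 < T) {A B : ℝ → ℝ} {a₀ : ℝ}
    (hA : LocallyIntegrable A) (hB : LocallyIntegrable B)
    (h : ∀ χ, IsTimeTest T χ →
      (∫ t in timeInterval T, (A t * deriv χ t + B t * χ t)) + a₀ * χ 0 = 0) :
    IsPrimitive T A B a₀ := by
  obtain ⟨c, hc⟩ := exists_isPrimitive_of_weak hT hA hB (fun χ hχ hχt => by
    have h1 := h χ hχ
    have h0 : χ 0 = 0 := image_eq_zero_of_notMem_tsupport fun h => lt_irrefl _ (hχt h).1
    simpa [h0] using h1)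
  obtain ⟨a, ha⟩ := exists_mem_timeInterval hT
  -- Interior tests leave the constant undetermined; one test equal to `1` at time `0` identifies it
  -- with `a₀`.
  let f : ContDiffBump (0 : ℝ) := ⟨a / 4, a / 2, by linarith [ha.1], by linarith [ha.1]⟩
  have hf : IsTimeTest T f := ⟨f.contDiff, f.hasCompactSupport, by
    rw [f.tsupport_eq]
    intro t ht
    have h1 : t ≤ a / 2 := by
      have := mem_closedBall_zero_iff.1 ht
      exact (le_abs_self t).trans this
    have h2 : t ≤ a := by linarith [ha.1]
    exact lt_of_le_of_lt (EReal.coe_le_coe_iff.2 h2) ha.2⟩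
  have h1 := h f hf
  rw [hc.weak hT hB hf] at h1
  have h2 : f 0 = 1 := f.one_of_mem_closedBall (Metric.mem_closedBall_self f.rIn_pos.le)
  rw [h2] at h1
  have : c = a₀ := by linarith
  rwa [this] at hc

/-! ### Smoothing along a direction -/

/-- The marginal of the density `a` along the direction `θ`, smoothed by the kernel `k`. -/
def planar {d : ℕ} (θ : E d) (a : E d → ℝ) (k : ℝ → ℝ) (s : ℝ) : ℝ :=
  ∫ x, a x * k (s - inner ℝ θ x)

section Planar

variable {d : ℕ} {θ : E d} {a b : E d → ℝ} {k k' : ℝ → ℝ} {C C' : ℝ}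

lemma integrable_planar_integrand (ha : Integrable a) (hk : Continuous k)
    (hC : ∀ r, |k r| ≤ C) (s : ℝ) : Integrable fun x => a x * k (s - inner ℝ θ x) := by
  refine ha.mul_bdd (c := C) ?_ (Filter.Eventually.of_forall fun x => hC _)
  exact (hk.comp (by fun_prop)).aestronglyMeasurable

lemma abs_planar_le (ha : Integrable a) (hC : ∀ r, |k r| ≤ C) (s : ℝ) :
    |planar θ a k s| ≤ C * ∫ x, |a x| := by
  unfold planar
  rw [← integral_const_mul]
  refine (abs_integral_le_integral_abs).trans ?_
  refine integral_mono_of_nonneg (Filter.Eventually.of_forall fun x => abs_nonneg _)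
    (ha.abs.const_mul C) (Filter.Eventually.of_forall fun x => ?_)
  simp only [abs_mul]
  rw [mul_comm]
  exact mul_le_mul_of_nonneg_right (hC _) (abs_nonneg _)

/-- Integrating in `s` first, translation invariance leaves `|a x|` times the `L¹` norm of `k`. -/
lemma integrable_planar_prod (ha : Integrable a) (hk : Continuous k) (hki : Integrable k) :
    Integrable (fun z : ℝ × E d => a z.2 * k (z.1 - inner ℝ θ z.2)) (volume.prod volume) := by
  have hm : AEStronglyMeasurable (fun z : ℝ × E d => a z.2 * k (z.1 - inner ℝ θ z.2))
      (volume.prod volume) := by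
    refine AEStronglyMeasurable.mul ha.aestronglyMeasurable.comp_snd ?_
    exact (hk.comp (by fun_prop)).aestronglyMeasurable
  rw [integrable_prod_iff' hm]
  refine ⟨Filter.Eventually.of_forall fun x =>
    (hki.comp_sub_right (inner ℝ θ x)).const_mul (a x), ?_⟩
  have : (fun x => ∫ s, ‖a x * k (s - inner ℝ θ x)‖) = fun x => |a x| * ∫ s, |k s| := by
    funext x
    simp only [norm_mul, Real.norm_eq_abs]
    rw [integral_const_mul, integral_sub_right_eq_self (fun s => |k s|)]
  simp only [this]
  exact ha.abs.mul_const _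

lemma integrable_planar (ha : Integrable a) (hk : Continuous k) (hki : Integrable k) :
    Integrable (planar θ a k) :=
  (integrable_planar_prod ha hk hki).integral_prod_left

lemma integral_abs_planar_le (ha : Integrable a) (hk : Continuous k) (hki : Integrable k) :
    ∫ s, |planar θ a k s| ≤ (∫ x, |a x|) * ∫ s, |k s| := by
  have hp := integrable_planar_prod (θ := θ) ha hk hki
  calc ∫ s, |planar θ a k s|
      ≤ ∫ s, ∫ x, ‖a x * k (s - inner ℝ θ x)‖ :=
        integral_mono (integrable_planar ha hk hki).abs hp.norm.integral_prod_left
          fun s => norm_integral_le_integral_norm (fun x => a x * k (s - inner ℝ θ x))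
    _ = ∫ x, ∫ s, ‖a x * k (s - inner ℝ θ x)‖ :=
        integral_integral_swap (f := fun s x => ‖a x * k (s - inner ℝ θ x)‖) hp.norm
    _ = (∫ x, |a x|) * ∫ s, |k s| := by
        rw [← integral_mul_const]
        congr 1
        funext x
        simp only [norm_mul, Real.norm_eq_abs]
        rw [integral_const_mul, integral_sub_right_eq_self (fun s => |k s|)]

/-- All derivatives in `s` fall on the kernel, so the density `a` needs no regularity beyond
integrability. -/
lemma hasDerivAt_planar (ha : Integrable a) (hk : ∀ r, HasDerivAt k (k' r) r)
    (hC : ∀ r, |k r| ≤ C) (hk' : Continuous k') (hC' : ∀ r, |k' r| ≤ C') (s : ℝ) :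
    HasDerivAt (planar θ a k) (planar θ a k' s) s := by
  have hkc : Continuous k := continuous_iff_continuousAt.2 fun r => (hk r).continuousAt
  refine (hasDerivAt_integral_of_dominated_loc_of_deriv_le (s := Set.univ)
    (bound := fun x => |a x| * C')
    (F := fun s x => a x * k (s - inner ℝ θ x))
    (F' := fun s x => a x * k' (s - inner ℝ θ x)) Filter.univ_mem
    (Filter.Eventually.of_forall fun r =>
      (integrable_planar_integrand ha hkc hC r).aestronglyMeasurable)
    (integrable_planar_integrand ha hkc hC s)
    (integrable_planar_integrand ha hk' hC' s).aestronglyMeasurable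
    (Filter.Eventually.of_forall fun x r _ => ?_) (ha.abs.mul_const _)
    (Filter.Eventually.of_forall fun x r _ => ?_)).2
  · rw [norm_mul]
    exact mul_le_mul_of_nonneg_left (hC' _) (abs_nonneg _)
  · have h1 : HasDerivAt (fun r => k (r - inner ℝ θ x)) (k' (r - inner ℝ θ x)) r := by
      simpa using (hk (r - inner ℝ θ x)).comp_sub_const r (inner ℝ θ x)
    exact h1.const_mul _

lemma continuous_planar (ha : Integrable a) (hk : Continuous k) (hC : ∀ r, |k r| ≤ C) :
    Continuous (planar θ a k) := by
  refine continuous_of_dominated (F := fun s x => a x * k (s - inner ℝ θ x))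
    (bound := fun x => |a x| * C)
    (fun s => (integrable_planar_integrand ha hk hC s).aestronglyMeasurable)
    (fun s => Filter.Eventually.of_forall fun x => ?_) (ha.abs.mul_const _)
    (Filter.Eventually.of_forall fun x => ?_)
  · rw [norm_mul]
    exact mul_le_mul_of_nonneg_left (hC _) (abs_nonneg _)
  · exact continuous_const.mul (hk.comp (by fun_prop))

end Planar

/-- The Cauchy–Schwarz inequality with a weight. -/
lemma sq_integral_mul_le {α : Type*} [MeasurableSpace α] {μ : Measure α} {u v w : α → ℝ}
    (hw : ∀ x, 0 ≤ w x) (huu : Integrable (fun x => u x ^ 2 * w x) μ)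
    (hvv : Integrable (fun x => v x ^ 2 * w x) μ)
    (huv : Integrable (fun x => u x * v x * w x) μ) :
    (∫ x, u x * v x * w x ∂μ) ^ 2 ≤ (∫ x, u x ^ 2 * w x ∂μ) * ∫ x, v x ^ 2 * w x ∂μ := by
  -- The quadratic polynomial `l ↦ ∫ (u + l v)² w` is nonnegative, so its discriminant is
  -- nonpositive.
  have h : ∀ l : ℝ, 0 ≤ (∫ x, v x ^ 2 * w x ∂μ) * (l * l) + (2 * ∫ x, u x * v x * w x ∂μ) * l
      + ∫ x, u x ^ 2 * w x ∂μ := fun l => by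
    have : (∫ x, v x ^ 2 * w x ∂μ) * (l * l) + (2 * ∫ x, u x * v x * w x ∂μ) * l
        + ∫ x, u x ^ 2 * w x ∂μ = ∫ x, (u x + l * v x) ^ 2 * w x ∂μ := by
      have e : ∀ x, (u x + l * v x) ^ 2 * w x =
          (v x ^ 2 * w x) * (l * l) + (u x * v x * w x) * (2 * l) + u x ^ 2 * w x := fun x => by
        ring
      simp only [e]
      have h1 := hvv.mul_const (l * l)
      have h2 := huv.mul_const (2 * l)
      have h3 : Integrable (fun x => v x ^ 2 * w x * (l * l) + u x * v x * w x * (2 * l)) μ :=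
        h1.add h2
      rw [integral_add h3 huu, integral_add h1 h2, integral_mul_const, integral_mul_const]
      ring
    rw [this]
    exact integral_nonneg fun x => mul_nonneg (sq_nonneg _) (hw x)
  have := discrim_le_zero h
  rw [discrim] at this
  nlinarith

/-! ### Cauchy–Schwarz and integration by parts for smoothed marginals. -/

section PlanarIneq

variable {d : ℕ} {θ : E d} {a b : E d → ℝ} {k k' : ℝ → ℝ} {C C' : ℝ}

lemma sq_planar_mul_le {u v : E d → ℝ} (hu : Integrable fun x => u x ^ 2)
    (hv : Integrable fun x => v x ^ 2) (huv : Integrable fun x => u x * v x)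
    (hk : Continuous k) (hk0 : ∀ r, 0 ≤ k r) (hC : ∀ r, |k r| ≤ C) (s : ℝ) :
    planar θ (fun x => u x * v x) k s ^ 2 ≤
      planar θ (fun x => u x ^ 2) k s * planar θ (fun x => v x ^ 2) k s :=
  sq_integral_mul_le (fun _ => hk0 _) (integrable_planar_integrand hu hk hC s)
    (integrable_planar_integrand hv hk hC s) (integrable_planar_integrand huv hk hC s)

/-- Integration by parts for products of smoothed marginals. -/
lemma integral_planar_mul_planar {S g h h' : ℝ → ℝ} {C₁ C₂ C₃ C₄ : ℝ} (ha : Integrable a)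
    (hb : Integrable b)
    (hS : ∀ r, HasDerivAt S (g r) r) (hSC : ∀ r, |S r| ≤ C₁) (hg : Continuous g)
    (hgC : ∀ r, |g r| ≤ C₂) (hh : ∀ r, HasDerivAt h (h' r) r) (hhC : ∀ r, |h r| ≤ C₃)
    (hhi : Integrable h) (hh' : Continuous h') (hhC' : ∀ r, |h' r| ≤ C₄) (hhi' : Integrable h') :
    ∫ s, planar θ a S s * planar θ b h' s = -∫ s, planar θ a g s * planar θ b h s := by
  have hSc : Continuous S := continuous_iff_continuousAt.2 fun r => (hS r).continuousAt
  have hhc : Continuous h := continuous_iff_continuousAt.2 fun r => (hh r).continuousAt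
  refine integral_mul_deriv_eq_deriv_mul_of_integrable
    (fun s _ => hasDerivAt_planar ha hS hSC hg hgC s)
    (fun s _ => hasDerivAt_planar hb hh hhC hh' hhC' s) ?_ ?_ ?_
  · exact (integrable_planar hb hh' hhi').bdd_mul
      (continuous_planar ha hSc hSC).aestronglyMeasurable
      (Filter.Eventually.of_forall fun s => abs_planar_le ha hSC s)
  · exact (integrable_planar hb hhc hhi).bdd_mul
      (continuous_planar ha hg hgC).aestronglyMeasurable
      (Filter.Eventually.of_forall fun s => abs_planar_le ha hgC s)
  · exact (integrable_planar hb hhc hhi).bdd_mul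
      (continuous_planar ha hSc hSC).aestronglyMeasurable
      (Filter.Eventually.of_forall fun s => abs_planar_le ha hSC s)

end PlanarIneq

/-! ### The Fourier slice theorem and Plancherel's identity on the line. -/

section FourierPlanar

/-- Plancherel's identity for continuous integrable functions with integrable transform. -/
lemma integral_norm_sq_fourier {u : ℝ → ℂ} (hu : Continuous u) (hi : Integrable u)
    (hF : Integrable (𝓕 u)) : ∫ κ, ‖𝓕 u κ‖ ^ 2 = ∫ s, ‖u s‖ ^ 2 := by
  have h := VectorFourier.integral_sesq_fourierIntegral_eq_neg_flip (μ := volume) (ν := volume)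
    (L := innerₗ ℝ) (f := u) (g := 𝓕 u) (innerSL ℂ) Real.continuous_fourierChar
    continuous_inner hi hF
  have e1 : ∀ κ : ℝ, VectorFourier.fourierIntegral Real.fourierChar volume (innerₗ ℝ) u κ
      = 𝓕 u κ := fun κ => rfl
  -- The adjoint of the transform is the inverse transform, so pairing `𝓕 u` with itself returns `u`
  -- paired with itself by Fourier inversion.
  have e2 : ∀ s : ℝ, VectorFourier.fourierIntegral Real.fourierChar volume
      (-(innerₗ ℝ).flip) (𝓕 u) s = u s := fun s => by
    have h1 : VectorFourier.fourierIntegral Real.fourierChar volume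
      (-(innerₗ ℝ).flip) (𝓕 u) s = 𝓕⁻ (𝓕 u) s := by
      rw [Real.fourierInv_eq]
      simp [VectorFourier.fourierIntegral]
    rw [h1, hu.fourierInv_fourier_eq hi hF]
  simp only [e1, e2, innerSL_apply_apply, inner_self_eq_norm_sq_to_K] at h
  have h3 : ((∫ κ, ‖𝓕 u κ‖ ^ 2 : ℝ) : ℂ) = ((∫ s, ‖u s‖ ^ 2 : ℝ) : ℂ) := by
    rw [← integral_complex_ofReal, ← integral_complex_ofReal]
    simpa using h
  exact_mod_cast h3

variable {d : ℕ} {θ : E d} {a : E d → ℝ} {k : ℝ → ℝ} {C : ℝ}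

/-- The Fourier slice theorem: the smoothed marginal is the convolution of `k` with the projection
of `a` onto the line spanned by `θ`, and projecting amounts to restricting the transform of `a` to
that line. -/
lemma fourier_planar (ha : Integrable a) (hk : Continuous k) (hki : Integrable k) (κ : ℝ) :
    𝓕 (fun s => (planar θ a k s : ℂ)) κ =
      𝓕 (fun s => (k s : ℂ)) κ * 𝓕 (fun x => (a x : ℂ)) (κ • θ) := by
  have hp := integrable_planar_prod (θ := θ) ha hk hki
  simp only [Real.fourier_eq]
  have e1 : ∀ s : ℝ, Real.fourierChar (-(inner ℝ s κ)) • (planar θ a k s : ℂ) =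
      ∫ x, Real.fourierChar (-(inner ℝ s κ)) • ((a x * k (s - inner ℝ θ x) : ℝ) : ℂ) :=
    fun s => by
      simp only [Circle.smul_def]
      rw [integral_smul, integral_complex_ofReal]
      rfl
  simp only [e1]
  have hp' : Integrable (fun z : ℝ × E d => Real.fourierChar (-(inner ℝ z.1 κ)) •
      ((a z.2 * k (z.1 - inner ℝ θ z.2) : ℝ) : ℂ)) (volume.prod volume) := by
    have h1 := hp.ofReal (𝕜 := ℂ)
    refine h1.mono ?_ (Filter.Eventually.of_forall fun z => by rw [Circle.norm_smul]; rfl)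
    simp only [Circle.smul_def]
    exact (continuous_subtype_val.comp (Real.continuous_fourierChar.comp
      (by fun_prop))).aestronglyMeasurable.smul h1.aestronglyMeasurable
  rw [integral_integral_swap (f := fun (s : ℝ) (x : E d) => Real.fourierChar (-(inner ℝ s κ)) •
      ((a x * k (s - inner ℝ θ x) : ℝ) : ℂ)) hp', ← integral_const_mul]
  congr 1
  funext x
  have e2 : ∀ s : ℝ, Real.fourierChar (-(inner ℝ s κ)) • ((a x * k (s - inner ℝ θ x) : ℝ) : ℂ)
      = (fun s => (Real.fourierChar (-(inner ℝ s κ)) • (k s : ℂ)) *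
        (Real.fourierChar (-(inner ℝ x (κ • θ))) • (a x : ℂ))) (s - inner ℝ θ x) := fun s => by
    have e3 : -(inner ℝ s κ) = -(inner ℝ (s - inner ℝ θ x) κ) + -(inner ℝ x (κ • θ)) := by
      simp only [RCLike.inner_apply, inner_smul_right, real_inner_comm x θ, conj_trivial]
      ring
    simp only
    rw [e3, AddChar.map_add_eq_mul]
    simp only [Circle.smul_def, Circle.coe_mul, smul_eq_mul, Complex.ofReal_mul]
    ring
  simp only [e2]
  rw [integral_sub_right_eq_self (fun s => (Real.fourierChar (-(inner ℝ s κ)) • (k s : ℂ)) *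
        (Real.fourierChar (-(inner ℝ x (κ • θ))) • (a x : ℂ))), integral_mul_const]

lemma norm_fourier_le (a : E d → ℝ) (ξ : E d) :
    ‖𝓕 (fun x => (a x : ℂ)) ξ‖ ≤ ∫ x, |a x| := by
  rw [Real.fourier_eq]
  refine (norm_integral_le_integral_norm _).trans (le_of_eq ?_)
  simp [Circle.norm_smul]

lemma continuous_fourier (ha : Integrable a) : Continuous (𝓕 (fun x => (a x : ℂ))) :=
  VectorFourier.fourierIntegral_continuous Real.continuous_fourierChar continuous_inner ha.ofReal

/-- Plancherel in `s` combined with the slice theorem. The transform of the marginal is integrable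
because that of `k` is and that of `a` is bounded. -/
lemma lintegral_planar_sq (ha : Integrable a) (hk : Continuous k) (hki : Integrable k)
    (hC : ∀ r, |k r| ≤ C) (hkF : Integrable (𝓕 (fun s => (k s : ℂ)))) :
    ∫⁻ κ, ‖𝓕 (fun s => (k s : ℂ)) κ‖ₑ ^ 2 * ‖𝓕 (fun x => (a x : ℂ)) (κ • θ)‖ₑ ^ 2 =
      ENNReal.ofReal (∫ s, planar θ a k s ^ 2) := by
  have hpi := integrable_planar (θ := θ) ha hk hki
  have hpc := continuous_planar (θ := θ) ha hk hC
  have hFe : 𝓕 (fun s => (planar θ a k s : ℂ)) =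
      fun κ => 𝓕 (fun s => (k s : ℂ)) κ * 𝓕 (fun x => (a x : ℂ)) (κ • θ) :=
    funext (fourier_planar ha hk hki)
  have hFi : Integrable (𝓕 (fun s => (planar θ a k s : ℂ))) := by
    rw [hFe]
    refine hkF.mul_bdd (c := ∫ x, |a x|) ?_ (Filter.Eventually.of_forall fun κ =>
      norm_fourier_le a _)
    exact ((continuous_fourier ha).comp (by fun_prop)).aestronglyMeasurable
  have h := integral_norm_sq_fourier (u := fun s => (planar θ a k s : ℂ))
    (Complex.continuous_ofReal.comp hpc) hpi.ofReal hFi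
  have h1 : ∫ s, planar θ a k s ^ 2 = ∫ κ, ‖𝓕 (fun s => (planar θ a k s : ℂ)) κ‖ ^ 2 := by
    rw [h]; simp
  have hbd : Integrable fun κ => ‖𝓕 (fun s => (planar θ a k s : ℂ)) κ‖ ^ 2 := by
    have hc : Continuous (𝓕 (fun s => (planar θ a k s : ℂ))) :=
      VectorFourier.fourierIntegral_continuous Real.continuous_fourierChar continuous_inner
        hpi.ofReal
    simp only [sq]
    refine hFi.norm.mul_bdd (c := ∫ s, |planar θ a k s|) hc.norm.aestronglyMeasurable
      (Filter.Eventually.of_forall fun κ => ?_)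
    rw [norm_norm, Real.fourier_eq]
    refine (norm_integral_le_integral_norm _).trans (le_of_eq ?_)
    simp [Circle.norm_smul]
  rw [h1, ofReal_integral_eq_lintegral_ofReal hbd
    (Filter.Eventually.of_forall fun κ => sq_nonneg _)]
  refine lintegral_congr fun κ => ?_
  rw [ENNReal.ofReal_pow (norm_nonneg _), ofReal_norm, hFe, ← mul_pow, ← enorm_mul]

end FourierPlanar

/-! ### The Sobolev inequality for functions with a weak gradient -/

/-- A smooth function which is one on the unit ball and vanishes outside the ball of radius two. -/
def bump (d : ℕ) : ContDiffBump (0 : E d) := ⟨1, 2, one_pos, one_lt_two⟩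

/-- Smooth cutoffs which tend to one. -/
def cutoff (d n : ℕ) (x : E d) : ℝ := bump d (((n : ℝ) + 1)⁻¹ • x)

lemma cutoff_smooth (d n : ℕ) : ContDiff ℝ ∞ (cutoff d n) :=
  (bump d).contDiff.comp (contDiff_const_smul _)

lemma hasCompactSupport_comp_smul {d : ℕ} {F : Type*} [Zero F] {f : E d → F}
    (hf : HasCompactSupport f) {c : ℝ} (hc : c ≠ 0) : HasCompactSupport fun x => f (c • x) :=
  hf.comp_homeomorph (Homeomorph.smulOfNeZero c hc)

lemma cutoff_compact (d n : ℕ) : HasCompactSupport (cutoff d n) :=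
  hasCompactSupport_comp_smul (bump d).hasCompactSupport (by positivity)

lemma cutoff_nonneg (d n : ℕ) (x : E d) : 0 ≤ cutoff d n x := (bump d).nonneg

lemma cutoff_le_one (d n : ℕ) (x : E d) : cutoff d n x ≤ 1 := (bump d).le_one

lemma norm_inv_smul_lt_one {d : ℕ} {x : E d} {n : ℕ} (h : ‖x‖ < (n : ℝ) + 1) :
    ‖((n : ℝ) + 1)⁻¹ • x‖ < 1 := by
  rw [norm_smul, norm_inv, Real.norm_of_nonneg (by positivity), inv_mul_lt_iff₀ (by positivity)]
  simpa using h

lemma cutoff_eq_one {d n : ℕ} {x : E d} (h : ‖x‖ < (n : ℝ) + 1) : cutoff d n x = 1 := by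
  refine (bump d).one_of_mem_closedBall ?_
  rw [mem_closedBall_zero_iff]
  exact (norm_inv_smul_lt_one h).le

lemma eventually_norm_lt {d : ℕ} (x : E d) : ∀ᶠ n : ℕ in Filter.atTop, ‖x‖ < (n : ℝ) + 1 := by
  obtain ⟨N, hN⟩ := exists_nat_gt ‖x‖
  filter_upwards [Filter.eventually_ge_atTop N] with n hn
  have : (N : ℝ) ≤ n := by exact_mod_cast hn
  linarith

lemma exists_bound_fderiv_cutoff (d : ℕ) : ∃ C : ℝ≥0, ∀ n x, ‖fderiv ℝ (cutoff d n) x‖ ≤ C := by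
  have hs : ContDiff ℝ 1 (bump d) := (bump d).contDiff
  obtain ⟨C, hC⟩ := (hs.continuous_fderiv one_ne_zero).bounded_above_of_compact_support
    ((bump d).hasCompactSupport.fderiv (𝕜 := ℝ))
  refine ⟨C.toNNReal, fun n x => ?_⟩
  have h1 : fderiv ℝ (cutoff d n) x
      = ((n : ℝ) + 1)⁻¹ • fderiv ℝ (bump d) (((n : ℝ) + 1)⁻¹ • x) := by
    exact fderiv_comp_smul (𝕜 := ℝ) (f := bump d) (x := x) (((n : ℝ) + 1)⁻¹)
  rw [h1, norm_smul, norm_inv, Real.norm_of_nonneg (by positivity)]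
  have h2 : ((n : ℝ) + 1)⁻¹ ≤ 1 := inv_le_one_of_one_le₀ (by linarith [n.cast_nonneg (α := ℝ)])
  calc ((n : ℝ) + 1)⁻¹ * ‖fderiv ℝ (bump d) (((n : ℝ) + 1)⁻¹ • x)‖
      ≤ 1 * C := mul_le_mul h2 (hC _) (norm_nonneg _) zero_le_one
    _ ≤ C.toNNReal := by rw [one_mul]; exact Real.le_coe_toNNReal C

lemma lintegral_enorm_sq {α F : Type*} [MeasurableSpace α] [NormedAddCommGroup F] (μ : Measure α)
    (f : α → F) : ∫⁻ x, ‖f x‖ₑ ^ 2 ∂μ = eLpNorm f 2 μ ^ 2 := by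
  have := eLpNorm_nnreal_pow_eq_lintegral (f := f) (p := 2) (μ := μ) two_ne_zero
  norm_num at this
  exact this.symm

/-! ### Sobolev bounds for smooth compactly supported functions. -/

section Smooth

/-- In the plane `‖w‖₂ ≤ C ‖∇w‖₁`. Taking `w` to be the next power of `v`, its gradient is a
multiple of the previous power times `∇v`, so Hölder closes the induction on the power. -/
lemma sobolev_smooth_two (m : ℕ) (M : ℝ≥0) : ∃ S : ℝ≥0, ∀ v : E 2 → ℝ, ContDiff ℝ 1 v →
    HasCompactSupport v → eLpNorm v 2 volume ≤ M → eLpNorm (fderiv ℝ v) 2 volume ≤ M →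
      eLpNorm (fun x => v x ^ (m + 1)) 2 volume ≤ S := by
  induction m with
  | zero => exact ⟨M, fun v _ _ h _ => by simpa using h⟩
  | succ m ih =>
    obtain ⟨S, hS⟩ := ih
    set C := eLpNormLESNormFDerivOneConst (volume : Measure (E 2)) ((2 : ℝ≥0) : ℝ) with hC
    refine ⟨C * ((m + 2 : ℕ) * (S * M)), fun v hv hc h0 h1 => ?_⟩
    have hconj : NNReal.HolderConjugate (Module.finrank ℝ (E 2) : ℝ≥0) 2 := by
      rw [finrank_euclideanSpace_fin]
      exact ⟨by norm_num, by norm_num, by norm_num⟩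
    have hcs : HasCompactSupport fun x => v x ^ (m + 1 + 1) := by
      have : (fun x => v x ^ (m + 1 + 1)) = fun x => v x ^ (m + 1) * v x := by
        funext x; rw [pow_succ]
      rw [this]
      exact hc.mul_left
    have key := eLpNorm_le_eLpNorm_fderiv_one (volume : Measure (E 2)) (hv.pow (m + 1 + 1)) hcs
      hconj
    refine key.trans ?_
    rw [← hC]
    push_cast
    gcongr
    have hfd : fderiv ℝ (fun x => v x ^ (m + 1 + 1)) =
        (((m + 2 : ℕ) : ℝ) • fun x => v x ^ (m + 1)) • fderiv ℝ v := by
      funext x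
      rw [fderiv_fun_pow (m + 1 + 1) (hv.differentiable one_ne_zero x)]
      simp only [Pi.smul_apply, Pi.smul_apply', nsmul_eq_mul, smul_eq_mul]
      rfl
    rw [hfd]
    refine (eLpNorm_smul_le_mul_eLpNorm (p := 2) (q := 2) (r := 1)
      (hv.continuous_fderiv one_ne_zero).aestronglyMeasurable
      ((hv.continuous.pow _).aestronglyMeasurable.const_smul _)).trans ?_
    have h2 : ‖((m + 2 : ℕ) : ℝ)‖ₑ = ((m : ℝ≥0∞) + 2) := by
      rw [Real.enorm_natCast]; push_cast; rfl
    rw [eLpNorm_const_smul, h2, mul_assoc]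
    gcongr
    exact hS v hv hc h0 h1

/-- This is the embedding into `L⁶`, the endpoint in dimension three, written as an `L²` bound for
the cube. -/
lemma sobolev_smooth_three (M : ℝ≥0) : ∃ S : ℝ≥0, ∀ v : E 3 → ℝ, ContDiff ℝ 1 v →
    HasCompactSupport v → eLpNorm (fderiv ℝ v) 2 volume ≤ M →
      eLpNorm (fun x => v x ^ 3) 2 volume ≤ S := by
  set C := SNormLESNormFDerivOfEqConst ℝ (volume : Measure (E 3)) ((2 : ℝ≥0) : ℝ) with hC
  refine ⟨(C * M) ^ 3, fun v hv hc h => ?_⟩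
  have key := eLpNorm_le_eLpNorm_fderiv_of_eq (F := ℝ) (volume : Measure (E 3)) hv hc
    (p := 2) (p' := 6) (by norm_num) (by simp) (by rw [finrank_euclideanSpace_fin]; norm_num)
  have h1 := eLpNorm_norm_rpow v (p := 2) (μ := volume) (q := 3) (by norm_num)
  have h2 : eLpNorm (fun x => v x ^ 3) 2 volume = eLpNorm (fun x => ‖v x‖ ^ (3 : ℝ)) 2 volume := by
    refine eLpNorm_congr_norm_ae (Filter.Eventually.of_forall fun x => ?_)
    rw [show (3 : ℝ) = ((3 : ℕ) : ℝ) by norm_num, Real.rpow_natCast]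
    simp
  have h3 : (2 : ℝ≥0∞) * ENNReal.ofReal 3 = ((6 : ℝ≥0) : ℝ≥0∞) := by
    rw [show ENNReal.ofReal 3 = 3 by norm_num]; norm_num
  rw [h2, h1, h3]
  rw [show (3 : ℝ) = ((3 : ℕ) : ℝ) by norm_num, ENNReal.rpow_natCast]
  push_cast
  gcongr
  refine key.trans ?_
  rw [← hC]
  gcongr
  exact h

/-- The place where admissibility of the exponent is decisive: some integer power `m ≥ γ` of `v` is
controlled in `L²`, any `m` in dimension two and `m = 3` in dimension three. -/
lemma sobolev_smooth {d : ℕ} {γ : ℝ} (h : Admissible d γ) (M : ℝ≥0) : ∃ m : ℕ, 1 ≤ m ∧ γ ≤ m ∧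
    ∃ S : ℝ≥0, ∀ v : E d → ℝ, ContDiff ℝ 1 v →
    HasCompactSupport v → eLpNorm v 2 volume ≤ M → eLpNorm (fderiv ℝ v) 2 volume ≤ M →
      eLpNorm (fun x => v x ^ m) 2 volume ≤ S := by
  rcases h with ⟨rfl, h1⟩ | ⟨rfl, h1, h2⟩
  · obtain ⟨N, hN⟩ := exists_nat_gt γ
    obtain ⟨S, hS⟩ := sobolev_smooth_two N M
    exact ⟨N + 1, by omega, by push_cast; linarith, S, hS⟩
  · obtain ⟨S, hS⟩ := sobolev_smooth_three M
    exact ⟨3, by omega, by push_cast; linarith, S, fun v hv hc _ h => hS v hv hc h⟩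

end Smooth

/-! ### Mollification and the passage to weak gradients. -/

section Mollify

open Convolution ContinuousLinearMap

variable {d : ℕ} {φ : E d → ℝ}

/-- Averaging translates does not increase the `L²` norm. -/
lemma eLpNorm_average_le {F : Type*} [NormedAddCommGroup F] [NormedSpace ℝ F] [CompleteSpace F]
    (hφ : Continuous φ) (h0 : ∀ x, 0 ≤ φ x) (h1 : ∫ x, φ x = 1) {h : E d → F}
    (hh : AEStronglyMeasurable h volume) :
    eLpNorm (fun x => ∫ t, φ t • h (x - t)) 2 volume ≤ eLpNorm h 2 volume := by
  have hφi : Integrable φ := by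
    by_contra hc
    rw [integral_undef hc] at h1
    exact zero_ne_one h1
  -- Against the probability measure with density `φ`, the average is estimated by the monotonicity
  -- of `L^p` norms (Jensen), and Tonelli with translation invariance finishes.
  set μ : Measure (E d) := volume.withDensity fun t => ENNReal.ofReal (φ t) with hμ
  have hmeas : Measurable fun t => ENNReal.ofReal (φ t) := hφ.measurable.ennreal_ofReal
  have hprob : IsProbabilityMeasure μ := ⟨by
    rw [hμ, withDensity_apply _ MeasurableSet.univ, Measure.restrict_univ,
      ← ofReal_integral_eq_lintegral_ofReal hφi (Filter.Eventually.of_forall h0), h1]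
    simp⟩
  set h' := hh.mk h with hh'
  have hm : StronglyMeasurable h' := hh.stronglyMeasurable_mk
  have hae : ∀ x, (fun t => h (x - t)) =ᵐ[volume] fun t => h' (x - t) := fun x =>
    (Measure.measurePreserving_sub_left volume x).quasiMeasurePreserving.ae_eq hh.ae_eq_mk
  have e1 : (fun x => ∫ t, φ t • h (x - t)) = fun x => ∫ t, h' (x - t) ∂μ := by
    funext x
    rw [hμ, integral_withDensity_eq_integral_toReal_smul hmeas
      (Filter.Eventually.of_forall fun t => ENNReal.ofReal_lt_top)]
    refine integral_congr_ae ?_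
    filter_upwards [hae x] with t ht
    rw [ht, ENNReal.toReal_ofReal (h0 t)]
  rw [e1, eLpNorm_congr_ae hh.ae_eq_mk, ← hh']
  rw [eLpNorm_eq_lintegral_rpow_enorm_toReal two_ne_zero ENNReal.ofNat_ne_top,
    eLpNorm_eq_lintegral_rpow_enorm_toReal two_ne_zero ENNReal.ofNat_ne_top]
  simp only [ENNReal.toReal_ofNat]
  refine ENNReal.rpow_le_rpow ?_ (by norm_num)
  have hm2 : ∀ x, StronglyMeasurable fun t => h' (x - t) := fun x =>
    hm.comp_measurable (measurable_const.sub measurable_id)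
  calc ∫⁻ x, ‖∫ t, h' (x - t) ∂μ‖ₑ ^ (2 : ℝ)
      ≤ ∫⁻ x, ∫⁻ t, ‖h' (x - t)‖ₑ ^ (2 : ℝ) ∂μ := by
        refine lintegral_mono fun x => ?_
        have k1 : ‖∫ t, h' (x - t) ∂μ‖ₑ ≤ eLpNorm (fun t => h' (x - t)) 1 μ := by
          rw [eLpNorm_one_eq_lintegral_enorm]
          exact enorm_integral_le_lintegral_enorm _
        have k2 := k1.trans (eLpNorm_le_eLpNorm_of_exponent_le (p := 1) (q := 2) (by norm_num)
          (hm2 x).aestronglyMeasurable)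
        rw [eLpNorm_eq_lintegral_rpow_enorm_toReal two_ne_zero ENNReal.ofNat_ne_top] at k2
        simp only [ENNReal.toReal_ofNat] at k2
        have k3 := ENNReal.rpow_le_rpow k2 (show (0 : ℝ) ≤ 2 by norm_num)
        rwa [← ENNReal.rpow_mul, show (1 / 2 : ℝ) * 2 = 1 by norm_num, ENNReal.rpow_one] at k3
    _ = ∫⁻ t, ∫⁻ x, ‖h' (x - t)‖ₑ ^ (2 : ℝ) ∂volume ∂μ := by
        refine lintegral_lintegral_swap ?_
        refine Measurable.aemeasurable ?_
        exact ((hm.comp_measurable (measurable_fst.sub measurable_snd)).enorm).pow_const _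
    _ = ∫⁻ x, ‖h' x‖ₑ ^ (2 : ℝ) := by
        have : ∀ t, ∫⁻ x, ‖h' (x - t)‖ₑ ^ (2 : ℝ) = ∫⁻ x, ‖h' x‖ₑ ^ (2 : ℝ) := fun t =>
          lintegral_sub_right_eq_self (fun x => ‖h' x‖ₑ ^ (2 : ℝ)) t
        simp only [this, lintegral_const, measure_univ, mul_one]

/-- The derivative falls on the mollifier; the weak gradient identity tested with `y ↦ φ (x - y)`
transfers it to `u`, the reflection supplying the sign. -/
lemma fderiv_mollify {u : E d → ℝ} {g : E d → E d} (h : HasWeakGradient u g)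
    (hφ : ContDiff ℝ ∞ φ) (hc : HasCompactSupport φ) (x : E d) :
    fderiv ℝ (φ ⋆[lsmul ℝ ℝ, volume] u) x = innerSL ℝ (∫ t, φ t • g (x - t)) := by
  have hφ1 : ContDiff ℝ 1 φ := hφ.of_le (by exact_mod_cast le_top)
  have h1 := (hc.hasFDerivAt_convolution_left (lsmul ℝ ℝ) hφ1 h.1 x).fderiv
  rw [h1]
  have hcd : HasCompactSupport (fderiv ℝ φ) := hc.fderiv (𝕜 := ℝ)
  have hcont : Continuous (fderiv ℝ φ) := hφ1.continuous_fderiv one_ne_zero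
  have hex : ConvolutionExistsAt (fderiv ℝ φ) u x ((lsmul ℝ ℝ).precompL (E d)) volume :=
    hcd.convolutionExists_left _ hcont h.1 x
  have hgi : Integrable (fun t => φ t • g (x - t)) := by
    have := hc.convolutionExists_left (lsmul ℝ ℝ) hφ.continuous h.2.1 x
    exact this
  refine ContinuousLinearMap.coe_injective
    ((EuclideanSpace.basisFun (Fin d) ℝ).toBasis.ext fun i => ?_)
  have hb : (EuclideanSpace.basisFun (Fin d) ℝ).toBasis i = e i := by
    simp [e]
  rw [hb]
  simp only [ContinuousLinearMap.coe_coe, innerSL_apply_apply]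
  have hr : inner ℝ (∫ t, φ t • g (x - t)) (e i) = ∫ t, g (x - t) i * φ t := by
    rw [real_inner_comm, ← integral_inner hgi]
    refine integral_congr_ae (Filter.Eventually.of_forall fun t => ?_)
    simp [e, inner_smul_right, EuclideanSpace.inner_single_left, mul_comm]
  have hl : (fderiv ℝ φ ⋆[(lsmul ℝ ℝ).precompL (E d), volume] u) x (e i)
      = ∫ t, u (x - t) * fderiv ℝ φ t (e i) := by
    rw [convolution_def, ContinuousLinearMap.integral_apply hex]
    refine integral_congr_ae (Filter.Eventually.of_forall fun t => ?_)
    simp [mul_comm]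
  rw [hr, hl]
  set ψ : E d → ℝ := fun y => φ (x - y) with hψ
  have hψs : ContDiff ℝ ∞ ψ := hφ.comp (contDiff_const.sub contDiff_id)
  have hψc : HasCompactSupport ψ := hc.comp_homeomorph (Homeomorph.subLeft x)
  have hψd : ∀ y, fderiv ℝ ψ y (e i) = -fderiv ℝ φ (x - y) (e i) := fun y => by
    have h3 : HasFDerivAt ψ ((fderiv ℝ φ (x - y)).comp (-ContinuousLinearMap.id ℝ (E d))) y :=
      ((hφ1.differentiable one_ne_zero (x - y)).hasFDerivAt).comp y
        ((hasFDerivAt_id y).const_sub x)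
    rw [h3.fderiv]
    simp
  have key := h.2.2 ψ hψs hψc i
  have e1 : ∫ t, u (x - t) * fderiv ℝ φ t (e i) = ∫ y, u y * fderiv ℝ φ (x - y) (e i) := by
    rw [← integral_sub_left_eq_self (fun t => u (x - t) * fderiv ℝ φ t (e i)) volume x]
    simp
  have e2 : ∫ t, g (x - t) i * φ t = ∫ y, g y i * φ (x - y) := by
    rw [← integral_sub_left_eq_self (fun t => g (x - t) i * φ t) volume x]
    simp
  rw [e1, e2]
  simp only [hψd, mul_neg, integral_neg, neg_inj] at key
  exact key

/-- Functions with square integrable weak gradient satisfy the bounds of smooth functions. -/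
lemma sobolev_weak {d : ℕ} {γ : ℝ} (h : Admissible d γ) (M : ℝ≥0) : ∃ S : ℝ≥0,
    ∀ (u : E d → ℝ) (g : E d → E d), HasWeakGradient u g → eLpNorm u 2 volume ≤ M →
      eLpNorm g 2 volume ≤ M → ∫⁻ x, ENNReal.ofReal ((u x ^ 2) ^ γ) ≤ S := by
  obtain ⟨C, hC⟩ := exists_bound_fderiv_cutoff d
  have hγ : 1 < γ := by rcases h with h | h <;> simp [h.2]
  -- The gradient of cutoff times mollification contributes `M` from the mollified gradient and `C *
  -- M` from the derivative of the cutoff.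
  obtain ⟨m, hm1, hm, S, hS⟩ := sobolev_smooth h (M + C * M)
  refine ⟨M ^ 2 + S ^ 2, fun u g hug hu hg => ?_⟩
  let φ : ℕ → ContDiffBump (0 : E d) := fun n =>
    ⟨((n : ℝ) + 1)⁻¹, 2 * ((n : ℝ) + 1)⁻¹, by positivity, by
      have : (0 : ℝ) < ((n : ℝ) + 1)⁻¹ := by positivity
      linarith⟩
  have hφ0 : Filter.Tendsto (fun n => (φ n).rOut) Filter.atTop (nhds 0) := by
    have := (tendsto_one_div_add_atTop_nhds_zero_nat (𝕜 := ℝ)).const_mul 2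
    simpa [φ] using this
  have hconv := ContDiffBump.ae_convolution_tendsto_right_of_locallyIntegrable (K := 2) hφ0
    (Filter.Eventually.of_forall fun n => le_rfl) hug.1
  set w : ℕ → E d → ℝ := fun n => ((φ n).normed volume) ⋆[lsmul ℝ ℝ, volume] u with hw
  have hws : ∀ n, ContDiff ℝ 1 (w n) := fun n =>
    ((φ n).hasCompactSupport_normed).contDiff_convolution_left (n := 1) _
      (φ n).contDiff_normed hug.1
  have hw2 : ∀ n, eLpNorm (w n) 2 volume ≤ M := fun n => by
    refine le_trans ?_ hu
    exact eLpNorm_average_le (φ := (φ n).normed volume) (φ n).continuous_normed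
      (fun x => (φ n).nonneg_normed x) (φ n).integral_normed hug.1.aestronglyMeasurable
  have hwd : ∀ n, eLpNorm (fderiv ℝ (w n)) 2 volume ≤ M := fun n => by
    refine le_trans ?_ hg
    refine le_trans (le_of_eq ?_) (eLpNorm_average_le (φ := (φ n).normed volume)
      (φ n).continuous_normed (fun x => (φ n).nonneg_normed x) (φ n).integral_normed
      hug.2.1.aestronglyMeasurable)
    refine eLpNorm_congr_norm_ae (Filter.Eventually.of_forall fun x => ?_)
    rw [hw]
    simp only
    rw [fderiv_mollify hug (φ n).contDiff_normed (φ n).hasCompactSupport_normed x,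
      innerSL_apply_norm]
  set v : ℕ → E d → ℝ := fun n x => cutoff d n x * w n x with hv
  have hχ1 : ∀ n, ContDiff ℝ 1 (cutoff d n) := fun n =>
    (cutoff_smooth d n).of_le (by exact_mod_cast le_top)
  have hv1 : ∀ n, ContDiff ℝ 1 (v n) := fun n => (hχ1 n).mul (hws n)
  have hvc : ∀ n, HasCompactSupport (v n) := fun n => (cutoff_compact d n).mul_right
  have hv2 : ∀ n, eLpNorm (v n) 2 volume ≤ (M + C * M : ℝ≥0) := fun n => by
    refine le_trans (eLpNorm_mono fun x => ?_) ((hw2 n).trans ?_)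
    · simp only [hv, norm_mul, Real.norm_of_nonneg (cutoff_nonneg d n x)]
      exact mul_le_of_le_one_left (norm_nonneg _) (cutoff_le_one d n x)
    · exact_mod_cast le_self_add
  have hvd : ∀ n, eLpNorm (fderiv ℝ (v n)) 2 volume ≤ (M + C * M : ℝ≥0) := fun n => by
    have e1 : fderiv ℝ (v n) = (cutoff d n • fderiv ℝ (w n)) +
        (w n • fderiv ℝ (cutoff d n)) := by
      funext x
      exact fderiv_fun_mul ((hχ1 n).differentiable one_ne_zero x)
        ((hws n).differentiable one_ne_zero x)
    have m1 : AEStronglyMeasurable (cutoff d n • fderiv ℝ (w n)) volume :=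
      ((hχ1 n).continuous.smul ((hws n).continuous_fderiv one_ne_zero)).aestronglyMeasurable
    have m2 : AEStronglyMeasurable (w n • fderiv ℝ (cutoff d n)) volume :=
      ((hws n).continuous.smul ((hχ1 n).continuous_fderiv one_ne_zero)).aestronglyMeasurable
    rw [e1]
    refine (eLpNorm_add_le m1 m2 one_le_two).trans ?_
    push_cast
    refine add_le_add (le_trans (eLpNorm_mono fun x => ?_) (hwd n)) ?_
    · rw [Pi.smul_apply', norm_smul, Real.norm_of_nonneg (cutoff_nonneg d n x)]
      exact mul_le_of_le_one_left (norm_nonneg _) (cutoff_le_one d n x)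
    · refine (eLpNorm_le_nnreal_smul_eLpNorm_of_ae_le_mul (g := w n) (c := C)
        (Filter.Eventually.of_forall fun x => ?_) 2).trans ?_
      · rw [Pi.smul_apply', ← NNReal.coe_le_coe]
        push_cast
        rw [norm_smul, mul_comm]
        exact mul_le_mul_of_nonneg_right (hC n x) (norm_nonneg _)
      · rw [ENNReal.smul_def, smul_eq_mul]
        gcongr
        exact hw2 n
  have hlim : ∀ᵐ x, Filter.Tendsto (fun n => v n x) Filter.atTop (nhds (u x)) := by
    filter_upwards [hconv] with x hx
    refine hx.congr' ?_
    filter_upwards [eventually_norm_lt x] with n hn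
    simp [hv, hw, cutoff_eq_one hn]
  -- The approximations converge almost everywhere, so Fatou transfers the uniform bound to `u`.
  have hfatou : ∫⁻ x, ‖u x ^ m‖ₑ ^ 2 ≤ (S : ℝ≥0∞) ^ 2 := by
    calc ∫⁻ x, ‖u x ^ m‖ₑ ^ 2
        ≤ ∫⁻ x, Filter.liminf (fun n => ‖v n x ^ m‖ₑ ^ 2) Filter.atTop := by
          refine lintegral_mono_ae ?_
          filter_upwards [hlim] with x hx
          refine le_of_eq (Filter.Tendsto.liminf_eq ?_).symm
          exact ENNReal.Tendsto.pow ((hx.pow m).enorm)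
      _ ≤ Filter.liminf (fun n => ∫⁻ x, ‖v n x ^ m‖ₑ ^ 2) Filter.atTop :=
          lintegral_liminf_le fun n =>
            (((hv1 n).continuous.pow m).enorm.measurable).pow_const 2
      _ ≤ (S : ℝ≥0∞) ^ 2 := by
          refine Filter.liminf_le_of_le (by isBoundedDefault) fun b hb => ?_
          obtain ⟨n, hn⟩ := hb.exists
          refine hn.trans ?_
          rw [lintegral_enorm_sq]
          gcongr
          exact hS _ (hv1 n) (hvc n) (hv2 n) (hvd n)
  calc ∫⁻ x, ENNReal.ofReal ((u x ^ 2) ^ γ)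
      ≤ ∫⁻ x, (‖u x‖ₑ ^ 2 + ‖u x ^ m‖ₑ ^ 2) := by
        refine lintegral_mono fun x => ?_
        have e1 : ‖u x‖ₑ ^ 2 = ENNReal.ofReal (u x ^ 2) := by
          rw [Real.enorm_eq_ofReal_abs, ← ENNReal.ofReal_pow (abs_nonneg _), sq_abs]
        have e2 : ‖u x ^ m‖ₑ ^ 2 = ENNReal.ofReal ((u x ^ 2) ^ m) := by
          rw [Real.enorm_eq_ofReal_abs, ← ENNReal.ofReal_pow (abs_nonneg _), sq_abs, ← pow_mul,
            ← pow_mul, mul_comm]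
        rw [e1, e2, ← ENNReal.ofReal_add (sq_nonneg _) (by positivity)]
        refine ENNReal.ofReal_le_ofReal ?_
        -- As `1 < γ ≤ m`, the power `γ` is below the first power on `[0, 1]` and below the power
        -- `m` beyond.
        rcases le_total (u x ^ 2) 1 with h1 | h1
        · rcases (sq_nonneg (u x)).eq_or_lt with h0 | h0
          · rw [← h0, Real.zero_rpow (by linarith)]
            positivity
          · have := Real.rpow_le_rpow_of_exponent_ge h0 h1 hγ.le
            rw [Real.rpow_one] at this
            have h3 : 0 ≤ (u x ^ 2) ^ m := by positivity
            linarith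
        · have := Real.rpow_le_rpow_of_exponent_le h1 hm
          rw [Real.rpow_natCast] at this
          linarith [sq_nonneg (u x)]
    _ = (∫⁻ x, ‖u x‖ₑ ^ 2) + ∫⁻ x, ‖u x ^ m‖ₑ ^ 2 := by
        refine lintegral_add_left' ?_ _
        exact (hug.1.aestronglyMeasurable.enorm).pow_const 2
    _ ≤ (M ^ 2 + S ^ 2 : ℝ≥0) := by
        push_cast
        refine add_le_add ?_ hfatou
        rw [lintegral_enorm_sq]
        gcongr

end Mollify

/-! ### Families of smooth functions with uniformly bounded derivatives -/

/-- The `i`-th partial derivative of a function on `ℝ^d`. -/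
def dv {d : ℕ} (i : Fin d) (f : E d → ℝ) (x : E d) : ℝ := fderiv ℝ f x (e i)

/-- The Laplacian of a function on `ℝ^d`. -/
def lap {d : ℕ} (f : E d → ℝ) (x : E d) : ℝ := ∑ i, dv i (dv i f) x

/-- All derivatives are bounded, uniformly in the family. -/
structure UnifSmooth {d : ℕ} (u : ℕ → E d → ℝ) : Prop where
  smooth : ∀ n, ContDiff ℝ ∞ (u n)
  bound : ∀ k : ℕ, ∃ C : ℝ, ∀ n x, ‖iteratedFDeriv ℝ k (u n) x‖ ≤ C

/-- Near every point the functions `u n` eventually agree with `φ`. -/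
def LocallyEventuallyEq {d : ℕ} (u : ℕ → E d → ℝ) (φ : E d → ℝ) : Prop :=
  ∀ x, ∀ᶠ n in Filter.atTop, u n =ᶠ[nhds x] φ

section UnifSmooth

variable {d : ℕ} {u v : ℕ → E d → ℝ} {φ ψ : E d → ℝ}

lemma norm_e {d : ℕ} (i : Fin d) : ‖(e i : E d)‖ = 1 := by simp [e]

lemma contDiff_dv (hφ : ContDiff ℝ ∞ φ) (i : Fin d) : ContDiff ℝ ∞ (dv i φ) :=
  (hφ.fderiv_right (m := ∞) (by simp)).clm_apply contDiff_const

lemma contDiff_lap (hφ : ContDiff ℝ ∞ φ) : ContDiff ℝ ∞ (lap φ) :=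
  ContDiff.sum fun i _ => contDiff_dv (contDiff_dv hφ i) i

lemma UnifSmooth.dv (hu : UnifSmooth u) (i : Fin d) : UnifSmooth fun n => dv i (u n) := by
  refine ⟨fun n => contDiff_dv (hu.smooth n) i, fun k => ?_⟩
  obtain ⟨C, hC⟩ := hu.bound (k + 1)
  refine ⟨1 * C, fun n x => ?_⟩
  have hf : ContDiff ℝ ∞ (fderiv ℝ (u n)) := (hu.smooth n).fderiv_right (m := ∞) (by simp)
  have h1 := (ContinuousLinearMap.apply ℝ ℝ (e i : E d)).norm_iteratedFDeriv_comp_left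
    (hf.contDiffAt (x := x)) (n := k) (by exact_mod_cast le_top)
  refine h1.trans (mul_le_mul ?_ ?_ (norm_nonneg _) zero_le_one)
  · refine ContinuousLinearMap.opNorm_le_bound _ zero_le_one fun L => ?_
    have := L.le_opNorm (e i : E d)
    rw [norm_e, mul_one] at this
    simpa using this
  · rw [norm_iteratedFDeriv_fderiv]
    exact hC n x

lemma UnifSmooth.sum {ι : Type*} {s : Finset ι} {w : ι → ℕ → E d → ℝ}
    (h : ∀ i ∈ s, UnifSmooth (w i)) : UnifSmooth fun n x => ∑ i ∈ s, w i n x := by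
  refine ⟨fun n => ContDiff.sum fun i hi => (h i hi).smooth n, fun k => ?_⟩
  have h2 : ∀ i, ∃ C : ℝ, i ∈ s → ∀ n x, ‖iteratedFDeriv ℝ k (w i n) x‖ ≤ C := fun i => by
    by_cases hi : i ∈ s
    · obtain ⟨C, hC⟩ := (h i hi).bound k
      exact ⟨C, fun _ => hC⟩
    · exact ⟨0, fun h' => absurd h' hi⟩
  choose C hC using h2
  refine ⟨∑ i ∈ s, C i, fun n x => ?_⟩
  rw [iteratedFDeriv_sum fun i hi =>
    ((h i hi).smooth n).of_le (by exact_mod_cast le_top)]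
  rw [Finset.sum_apply]
  exact (norm_sum_le _ _).trans (Finset.sum_le_sum fun i hi => hC i hi n x)

lemma UnifSmooth.lap (hu : UnifSmooth u) : UnifSmooth fun n => lap (u n) :=
  UnifSmooth.sum fun i _ => (hu.dv i).dv i

lemma UnifSmooth.mul (hu : UnifSmooth u) (hv : UnifSmooth v) :
    UnifSmooth fun n x => u n x * v n x := by
  refine ⟨fun n => (hu.smooth n).mul (hv.smooth n), fun k => ?_⟩
  choose C hC using hu.bound
  choose D hD using hv.bound
  refine ⟨∑ i ∈ Finset.range (k + 1), (k.choose i : ℝ) * C i * D (k - i), fun n x => ?_⟩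
  refine (norm_iteratedFDeriv_mul_le (hu.smooth n) (hv.smooth n) x
    (n := k) (by exact_mod_cast le_top)).trans (Finset.sum_le_sum fun i _ => ?_)
  have h0 : 0 ≤ C i := (norm_nonneg _).trans (hC i n x)
  exact mul_le_mul (mul_le_mul_of_nonneg_left (hC i n x) (Nat.cast_nonneg _)) (hD _ n x)
    (norm_nonneg _) (by positivity)

lemma UnifSmooth.exists_bound (hu : UnifSmooth u) : ∃ C : ℝ, ∀ n x, |u n x| ≤ C := by
  obtain ⟨C, hC⟩ := hu.bound 0
  exact ⟨C, fun n x => by simpa using hC n x⟩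

lemma unifSmooth_const_of_compact (hφ : ContDiff ℝ ∞ φ) (hc : HasCompactSupport φ) :
    UnifSmooth fun _ => φ := by
  refine ⟨fun _ => hφ, fun k => ?_⟩
  obtain ⟨C, hC⟩ := (hφ.continuous_iteratedFDeriv (m := k)
    (by exact_mod_cast le_top)).bounded_above_of_compact_support (hc.iteratedFDeriv (𝕜 := ℝ) k)
  exact ⟨C, fun _ x => hC x⟩

/-- A derivative of order `k` gains the factor `(n + 1)⁻¹ ^ k ≤ 1`, so dilating outward preserves
every bound. -/
lemma UnifSmooth.comp_smul (hφ : UnifSmooth fun _ => φ) :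
    UnifSmooth fun (n : ℕ) x => φ (((n : ℝ) + 1)⁻¹ • x) := by
  refine ⟨fun n => (hφ.smooth 0).comp (contDiff_const_smul _), fun k => ?_⟩
  obtain ⟨C, hC⟩ := hφ.bound k
  have hC0 : 0 ≤ C := (norm_nonneg _).trans (hC 0 0)
  refine ⟨C, fun n x => ?_⟩
  have h2 : ((n : ℝ) + 1)⁻¹ ≤ 1 := inv_le_one_of_one_le₀ (by linarith [n.cast_nonneg (α := ℝ)])
  have h1 := iteratedFDeriv_comp_const_smul (𝕜 := ℝ) (i := k) (f := φ)
    (((n : ℝ) + 1)⁻¹) ((hφ.smooth 0).of_le (by exact_mod_cast le_top))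
  rw [h1, norm_smul, norm_pow, norm_inv, Real.norm_of_nonneg (by positivity)]
  calc (((n : ℝ) + 1)⁻¹) ^ k * ‖iteratedFDeriv ℝ k φ (((n : ℝ) + 1)⁻¹ • x)‖
      ≤ 1 * C := mul_le_mul (pow_le_one₀ (by positivity) h2) (hC 0 _) (norm_nonneg _) zero_le_one
    _ = C := one_mul C

lemma unifSmooth_cutoff (d : ℕ) : UnifSmooth (cutoff d) :=
  (unifSmooth_const_of_compact (bump d).contDiff (bump d).hasCompactSupport).comp_smul

/-- Plane waves with a profile all of whose derivatives are bounded. -/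
lemma unifSmooth_planar {h : ℝ → ℝ} (hh : ContDiff ℝ ∞ h)
    (hb : ∀ k : ℕ, ∃ C, ∀ r, ‖iteratedFDeriv ℝ k h r‖ ≤ C) (θ : E d) :
    UnifSmooth fun _ x => h (inner ℝ θ x) := by
  refine ⟨fun _ => hh.comp (innerSL ℝ θ).contDiff, fun k => ?_⟩
  obtain ⟨C, hC⟩ := hb k
  refine ⟨C * ∏ _i : Fin k, ‖innerSL ℝ θ‖, fun _ x => ?_⟩
  have h1 := (innerSL ℝ θ).iteratedFDeriv_comp_right hh x (i := k) (by exact_mod_cast le_top)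
  have h2 : (fun x => h (inner ℝ θ x)) = h ∘ (innerSL ℝ θ) := rfl
  rw [h2, h1]
  refine (ContinuousMultilinearMap.norm_compContinuousLinearMap_le _ _).trans ?_
  exact mul_le_mul_of_nonneg_right (hC _) (by positivity)

lemma LocallyEventuallyEq.dv (h : LocallyEventuallyEq u φ) (i : Fin d) :
    LocallyEventuallyEq (fun n => dv i (u n)) (dv i φ) := fun x => by
  filter_upwards [h x] with n hn
  filter_upwards [hn.fderiv (𝕜 := ℝ)] with y hy
  simp [QHD.dv, hy]

lemma LocallyEventuallyEq.lap (h : LocallyEventuallyEq u φ) :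
    LocallyEventuallyEq (fun n => lap (u n)) (lap φ) := fun x => by
  have : ∀ᶠ n in Filter.atTop, ∀ i : Fin d,
      QHD.dv i (QHD.dv i (u n)) =ᶠ[nhds x] QHD.dv i (QHD.dv i φ) :=
    Filter.eventually_all.2 fun i => ((h.dv i).dv i) x
  filter_upwards [this] with n hn
  filter_upwards [Filter.eventually_all.2 hn] with y hy
  simp [QHD.lap, hy]

lemma LocallyEventuallyEq.tendsto (h : LocallyEventuallyEq u φ) (x : E d) :
    Filter.Tendsto (fun n => u n x) Filter.atTop (nhds (φ x)) :=
  Filter.EventuallyEq.tendsto (by filter_upwards [h x] with n hn using hn.self_of_nhds)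

lemma locallyEventuallyEq_cutoff (φ : E d → ℝ) :
    LocallyEventuallyEq (fun n x => cutoff d n x * φ x) φ := fun x => by
  filter_upwards [eventually_norm_lt x] with n hn
  have : ∀ᶠ y in nhds x, ‖y‖ < (n : ℝ) + 1 :=
    (continuous_norm.tendsto x).eventually (eventually_lt_nhds hn)
  filter_upwards [this] with y hy
  rw [cutoff_eq_one hy, one_mul]

end UnifSmooth

/-! ### Time dependent densities with bounded mass -/

/-- A jointly measurable function whose `L¹` norm in space is bounded in time. -/
structure IsDensity {X : Type*} [MeasureSpace X] (f : ℝ → X → ℝ) (C : ℝ) : Prop where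
  meas : Measurable fun z : ℝ × X => f z.1 z.2
  int : ∀ t, Integrable (f t)
  le : ∀ t, ∫ x, |f t x| ≤ C

/-- The pairing of a density with a function on space. -/
def pair {d : ℕ} (f : ℝ → E d → ℝ) (ψ : E d → ℝ) (t : ℝ) : ℝ := ∫ x, f t x * ψ x

section Density

variable {X : Type*} [MeasureSpace X] {f g : ℝ → X → ℝ} {C C' K : ℝ}

lemma IsDensity.nonneg (hf : IsDensity f C) : 0 ≤ C :=
  (integral_nonneg fun _ => abs_nonneg _).trans (hf.le 0)

lemma IsDensity.add (hf : IsDensity f C) (hg : IsDensity g C') :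
    IsDensity (fun t x => f t x + g t x) (C + C') := by
  refine ⟨hf.meas.add hg.meas, fun t => (hf.int t).add (hg.int t), fun t => ?_⟩
  calc ∫ x, |f t x + g t x| ≤ ∫ x, (|f t x| + |g t x|) :=
        integral_mono ((hf.int t).add (hg.int t)).abs ((hf.int t).abs.add (hg.int t).abs)
          fun x => abs_add_le _ _
    _ = (∫ x, |f t x|) + ∫ x, |g t x| := integral_add (hf.int t).abs (hg.int t).abs
    _ ≤ C + C' := add_le_add (hf.le t) (hg.le t)

lemma IsDensity.const_mul (hf : IsDensity f C) (c : ℝ) :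
    IsDensity (fun t x => c * f t x) (|c| * C) := by
  refine ⟨hf.meas.const_mul c, fun t => (hf.int t).const_mul c, fun t => ?_⟩
  simp only [abs_mul]
  rw [integral_const_mul]
  exact mul_le_mul_of_nonneg_left (hf.le t) (abs_nonneg c)

lemma IsDensity.sum {ι : Type*} {s : Finset ι} {F : ι → ℝ → X → ℝ} {D : ι → ℝ}
    (h : ∀ i ∈ s, IsDensity (F i) (D i)) :
    IsDensity (fun t x => ∑ i ∈ s, F i t x) (∑ i ∈ s, D i) := by
  classical
  induction s using Finset.induction_on with
  | empty => exact ⟨by simp, fun t => by simp, fun t => by simp⟩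
  | insert a s ha ih =>
    simp only [Finset.sum_insert ha]
    exact (h a (Finset.mem_insert_self a s)).add
      (ih fun i hi => h i (Finset.mem_insert_of_mem hi))

/-- Products of functions bounded in `L²`. -/
lemma IsDensity.of_sq (hf : Measurable fun z : ℝ × X => f z.1 z.2)
    (hg : Measurable fun z : ℝ × X => g z.1 z.2)
    (hfi : ∀ t, Integrable fun x => f t x ^ 2) (hgi : ∀ t, Integrable fun x => g t x ^ 2)
    (hfC : ∀ t, ∫ x, f t x ^ 2 ≤ C) (hgC : ∀ t, ∫ x, g t x ^ 2 ≤ C) :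
    IsDensity (fun t x => f t x * g t x) C := by
  have hm := hf.mul hg
  have hb : ∀ t x, |f t x * g t x| ≤ 1 / 2 * (f t x ^ 2 + g t x ^ 2) := fun t x => by
    rw [abs_le]
    constructor <;> nlinarith [sq_nonneg (f t x + g t x), sq_nonneg (f t x - g t x)]
  have hi : ∀ t, Integrable fun x => 1 / 2 * (f t x ^ 2 + g t x ^ 2) := fun t =>
    ((hfi t).add (hgi t)).const_mul _
  have hint : ∀ t, Integrable fun x => f t x * g t x := fun t =>
    (hi t).mono' (hm.comp measurable_prodMk_left).aestronglyMeasurable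
      (Filter.Eventually.of_forall (hb t))
  refine ⟨hm, hint, fun t => ?_⟩
  calc ∫ x, |f t x * g t x| ≤ ∫ x, 1 / 2 * (f t x ^ 2 + g t x ^ 2) :=
        integral_mono (hint t).abs (hi t) (hb t)
    _ = 1 / 2 * ((∫ x, f t x ^ 2) + ∫ x, g t x ^ 2) := by
        rw [integral_const_mul, integral_add (hfi t) (hgi t)]
    _ ≤ C := by linarith [hfC t, hgC t]

lemma IsDensity.bdd_mul (hf : IsDensity f C) (hg : Measurable fun z : ℝ × X => g z.1 z.2)
    (hK0 : 0 ≤ K) (hK : ∀ t x, |g t x| ≤ K) : IsDensity (fun t x => g t x * f t x) (K * C) := by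
  have hi : ∀ t, Integrable fun x => g t x * f t x := fun t =>
    (hf.int t).bdd_mul (hg.comp measurable_prodMk_left).aestronglyMeasurable
      (Filter.Eventually.of_forall (hK t))
  refine ⟨hg.mul hf.meas, hi, fun t => ?_⟩
  calc ∫ x, |g t x * f t x| ≤ ∫ x, K * |f t x| :=
        integral_mono (hi t).abs ((hf.int t).abs.const_mul K) fun x => by
          simp only [abs_mul]
          exact mul_le_mul_of_nonneg_right (hK t x) (abs_nonneg _)
    _ = K * ∫ x, |f t x| := integral_const_mul _ _
    _ ≤ K * C := mul_le_mul_of_nonneg_left (hf.le t) hK0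

lemma IsDensity.abs_integral_le (hf : IsDensity f C) (t : ℝ) : |∫ x, f t x| ≤ C :=
  abs_integral_le_integral_abs.trans (hf.le t)

lemma locallyIntegrable_of_bdd {A : ℝ → ℝ} (hA : Measurable A) (hC : ∀ t, |A t| ≤ C) :
    LocallyIntegrable A :=
  (continuous_const (y := C)).locallyIntegrable.mono hA.aestronglyMeasurable
    (Filter.Eventually.of_forall fun t => (hC t).trans (le_abs_self C))

variable [SFinite (volume : Measure X)]

lemma IsDensity.measurable_integral (hf : IsDensity f C) : Measurable fun t => ∫ x, f t x :=
  (hf.meas.stronglyMeasurable.integral_prod_right (ν := volume)).measurable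

/-- Fubini's theorem for densities. -/
lemma IsDensity.integrable_prod (hf : IsDensity f C) {μ : Measure ℝ} [SFinite μ] {k : ℝ → ℝ}
    (hk : Integrable k μ) :
    Integrable (fun z : ℝ × X => f z.1 z.2 * k z.1) (μ.prod volume) := by
  have hm : AEStronglyMeasurable (fun z : ℝ × X => f z.1 z.2 * k z.1) (μ.prod volume) :=
    hf.meas.aestronglyMeasurable.mul hk.aestronglyMeasurable.comp_fst
  rw [integrable_prod_iff hm]
  refine ⟨Filter.Eventually.of_forall fun t => (hf.int t).mul_const (k t), ?_⟩
  have h1 : Integrable (fun t => C * |k t|) μ := hk.abs.const_mul C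
  refine h1.mono' hm.norm.integral_prod_right' (Filter.Eventually.of_forall fun t => ?_)
  simp only [norm_mul, Real.norm_eq_abs]
  rw [integral_mul_const, abs_mul, abs_abs, abs_of_nonneg (integral_nonneg fun _ => abs_nonneg _)]
  exact mul_le_mul_of_nonneg_right (hf.le t) (abs_nonneg _)

lemma IsDensity.integral_prod (hf : IsDensity f C) {μ : Measure ℝ} [SFinite μ] {k : ℝ → ℝ}
    (hk : Integrable k μ) :
    ∫ z, f z.1 z.2 * k z.1 ∂(μ.prod (volume : Measure X)) = ∫ t, (∫ x, f t x) * k t ∂μ := by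
  rw [MeasureTheory.integral_prod _ (hf.integrable_prod hk)]
  congr 1
  funext t
  exact integral_mul_const (k t) (f t)

end Density

section Pairing

variable {d : ℕ} {f : ℝ → E d → ℝ} {C K : ℝ} {ψ : E d → ℝ}

lemma IsDensity.mul_bdd (hf : IsDensity f C) (hψ : Continuous ψ) (hK : ∀ x, |ψ x| ≤ K) :
    IsDensity (fun t x => f t x * ψ x) (C * K) := by
  have hi : ∀ t, Integrable fun x => f t x * ψ x := fun t =>
    (hf.int t).mul_bdd hψ.aestronglyMeasurable (Filter.Eventually.of_forall hK)
  refine ⟨hf.meas.mul (hψ.measurable.comp measurable_snd), hi, fun t => ?_⟩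
  have hK0 : 0 ≤ K := (abs_nonneg _).trans (hK 0)
  calc ∫ x, |f t x * ψ x| ≤ ∫ x, |f t x| * K :=
        integral_mono (hi t).abs ((hf.int t).abs.mul_const K) fun x => by
          simp only [abs_mul]
          exact mul_le_mul_of_nonneg_left (hK x) (abs_nonneg _)
    _ = (∫ x, |f t x|) * K := integral_mul_const _ _
    _ ≤ C * K := mul_le_mul_of_nonneg_right (hf.le t) hK0

lemma IsDensity.measurable_pair (hf : IsDensity f C) (hψ : Continuous ψ)
    (hK : ∀ x, |ψ x| ≤ K) : Measurable (pair f ψ) := (hf.mul_bdd hψ hK).measurable_integral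

lemma IsDensity.abs_pair_le (hf : IsDensity f C) (hψ : Continuous ψ)
    (hK : ∀ x, |ψ x| ≤ K) (t : ℝ) : |pair f ψ t| ≤ C * K := (hf.mul_bdd hψ hK).abs_integral_le t

lemma IsDensity.tendsto_pair (hf : IsDensity f C) {u : ℕ → E d → ℝ}
    (hu : ∀ n, Continuous (u n)) (hK : ∀ n x, |u n x| ≤ K)
    (hlim : ∀ x, Filter.Tendsto (fun n => u n x) Filter.atTop (nhds (ψ x))) (t : ℝ) :
    Filter.Tendsto (fun n => pair f (u n) t) Filter.atTop (nhds (pair f ψ t)) := by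
  refine tendsto_integral_of_dominated_convergence (fun x => |f t x| * K)
    (fun n => (hf.int t).aestronglyMeasurable.mul (hu n).aestronglyMeasurable)
    ((hf.int t).abs.mul_const K) (fun n => Filter.Eventually.of_forall fun x => ?_)
    (Filter.Eventually.of_forall fun x => (hlim x).const_mul _)
  rw [Real.norm_eq_abs, abs_mul]
  exact mul_le_mul_of_nonneg_left (hK n x) (abs_nonneg _)

end Pairing

lemma tendsto_integral_mul_of_bdd {μ : Measure ℝ} {A : ℕ → ℝ → ℝ} {B k : ℝ → ℝ} {K : ℝ}
    (hA : ∀ n, Measurable (A n)) (hK : ∀ n t, |A n t| ≤ K) (hk : Integrable k μ)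
    (hlim : ∀ t, Filter.Tendsto (fun n => A n t) Filter.atTop (nhds (B t))) :
    Filter.Tendsto (fun n => ∫ t, A n t * k t ∂μ) Filter.atTop (nhds (∫ t, B t * k t ∂μ)) := by
  refine tendsto_integral_of_dominated_convergence (fun t => K * |k t|)
    (fun n => (hA n).aestronglyMeasurable.mul hk.aestronglyMeasurable)
    (hk.abs.const_mul K) (fun n => Filter.Eventually.of_forall fun t => ?_)
    (Filter.Eventually.of_forall fun t => (hlim t).mul_const _)
  rw [Real.norm_eq_abs, abs_mul]
  exact mul_le_mul_of_nonneg_right (hK n t) (abs_nonneg _)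

/-! ### Regular representatives of a solution -/

/-- Jointly measurable fields which are bounded in the energy space at all times. -/
structure RegularFields {d : ℕ} (γ M S : ℝ) (R : ℝ → E d → ℝ) (G Λ : ℝ → E d → E d) : Prop where
  meas_R : Measurable fun z : ℝ × E d => R z.1 z.2
  meas_G : Measurable fun z : ℝ × E d => G z.1 z.2
  meas_Λ : Measurable fun z : ℝ × E d => Λ z.1 z.2
  int_R : ∀ t, Integrable fun x => R t x ^ 2
  int_G : ∀ t, Integrable fun x => ‖G t x‖ ^ 2
  int_Λ : ∀ t, Integrable fun x => ‖Λ t x‖ ^ 2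
  int_pow : ∀ t, Integrable fun x => rho R t x ^ γ
  le_R : ∀ t, ∫ x, R t x ^ 2 ≤ M ^ 2
  le_G : ∀ t, ∫ x, ‖G t x‖ ^ 2 ≤ M ^ 2
  le_Λ : ∀ t, ∫ x, ‖Λ t x‖ ^ 2 ≤ M ^ 2
  le_pow : ∀ t, ∫ x, rho R t x ^ γ ≤ S

/-- The fields agree almost everywhere on `(0, T) × ℝ^d`. -/
def AgreeAE {d : ℕ} {F : Type*} (T : EReal) (u v : ℝ → E d → F) : Prop :=
  ∀ᵐ z : ℝ × E d ∂((volume.restrict (timeInterval T)).prod volume), u z.1 z.2 = v z.1 z.2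

lemma AgreeAE.slice {d : ℕ} {F : Type*} {T : EReal} {u v : ℝ → E d → F} (h : AgreeAE T u v) :
    ∀ᵐ t ∂(volume.restrict (timeInterval T)), u t =ᵐ[volume] v t :=
  Measure.ae_ae_of_ae_prod h

lemma restrict_slab (d : ℕ) (T : EReal) :
    (volume : Measure (ℝ × E d)).restrict (slab d T) =
      (volume.restrict (timeInterval T)).prod volume := by
  have h : slab d T = timeInterval T ×ˢ (Set.univ : Set (E d)) := by
    ext z; simp [slab]
  rw [h, Measure.volume_eq_prod, ← Measure.prod_restrict, Measure.restrict_univ]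

lemma isOpen_slab (d : ℕ) (T : EReal) : IsOpen (slab d T) :=
  (isOpen_timeInterval T).preimage continuous_fst

lemma MemL2Loc.aestronglyMeasurable {d : ℕ} {F : Type} [NormedAddCommGroup F] {T : EReal}
    {u : ℝ → E d → F} (hu : MemL2Loc T u) :
    AEStronglyMeasurable (fun z : ℝ × E d => u z.1 z.2)
      ((volume.restrict (timeInterval T)).prod volume) := by
  rw [← restrict_slab]
  refine LocallyIntegrableOn.aestronglyMeasurable ?_
  rw [locallyIntegrableOn_iff (isOpen_slab d T).isLocallyClosed]
  intro K hK hKc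
  have h := hu K hKc fun z hz => ⟨(hK hz).1.le, (hK hz).2⟩
  have : IsFiniteMeasure ((volume : Measure (ℝ × E d)).restrict K) :=
    ⟨by rw [Measure.restrict_apply_univ]; exact hKc.measure_lt_top⟩
  exact h.integrable one_le_two

lemma integrable_of_lintegral_le {α : Type*} [MeasurableSpace α] {μ : Measure α} {f : α → ℝ}
    (hf : AEStronglyMeasurable f μ) (h0 : ∀ x, 0 ≤ f x) {c : ℝ} (hc : 0 ≤ c)
    (h : ∫⁻ x, ENNReal.ofReal (f x) ∂μ ≤ ENNReal.ofReal c) :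
    Integrable f μ ∧ ∫ x, f x ∂μ ≤ c := by
  have hi : Integrable f μ := by
    refine ⟨hf, ?_⟩
    rw [hasFiniteIntegral_iff_ofReal (Filter.Eventually.of_forall h0)]
    exact h.trans_lt ENNReal.ofReal_lt_top
  refine ⟨hi, ?_⟩
  rw [← ofReal_integral_eq_lintegral_ofReal hi (Filter.Eventually.of_forall h0)] at h
  exact (ENNReal.ofReal_le_ofReal_iff hc).1 h

lemma enorm_sq_eq_ofReal {F : Type*} [NormedAddCommGroup F] (x : F) :
    ‖x‖ₑ ^ 2 = ENNReal.ofReal (‖x‖ ^ 2) := by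
  rw [ENNReal.ofReal_pow (norm_nonneg _), ofReal_norm]

/-- A solution bounded in the energy space has regular representatives. -/
lemma exists_regularFields {d : ℕ} {γ : ℝ} (hγ : Admissible d γ) (M : ℝ≥0) : ∃ S : ℝ≥0,
    ∀ (T : EReal) (ρ₀ : E d → ℝ) (J₀ : E d → E d) (R : ℝ → E d → ℝ) (G Λ : ℝ → E d → E d),
      IsFiniteEnergyWeakSolution γ T ρ₀ J₀ R G Λ → energyNorm T R G Λ ≤ M →
      ∃ (R' : ℝ → E d → ℝ) (G' Λ' : ℝ → E d → E d), RegularFields γ M S R' G' Λ' ∧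
        AgreeAE T R R' ∧ AgreeAE T G G' ∧ AgreeAE T Λ Λ' := by
  obtain ⟨S, hS⟩ := sobolev_weak hγ M
  have hγ1 : 1 < γ := by rcases hγ with h | h <;> simp [h.2]
  refine ⟨S, fun T ρ₀ J₀ R G Λ sol hM => ?_⟩
  have hR := sol.memL2Loc_R.aestronglyMeasurable
  have hG := sol.memL2Loc_G.aestronglyMeasurable
  have hΛ := sol.memL2Loc_Λ.aestronglyMeasurable
  set Rm : ℝ × E d → ℝ := hR.mk _ with hRm
  set Gm : ℝ × E d → E d := hG.mk _ with hGm
  set Λm : ℝ × E d → E d := hΛ.mk _ with hΛm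
  have mR : Measurable Rm := hR.stronglyMeasurable_mk.measurable
  have mG : Measurable Gm := hG.stronglyMeasurable_mk.measurable
  have mΛ : Measurable Λm := hΛ.stronglyMeasurable_mk.measurable
  have aR : ∀ᵐ t ∂(volume.restrict (timeInterval T)), ∀ᵐ x, R t x = Rm (t, x) :=
    Measure.ae_ae_of_ae_prod hR.ae_eq_mk
  have aG : ∀ᵐ t ∂(volume.restrict (timeInterval T)), ∀ᵐ x, G t x = Gm (t, x) :=
    Measure.ae_ae_of_ae_prod hG.ae_eq_mk
  have aΛ : ∀ᵐ t ∂(volume.restrict (timeInterval T)), ∀ᵐ x, Λ t x = Λm (t, x) :=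
    Measure.ae_ae_of_ae_prod hΛ.ae_eq_mk
  -- The good times, at which all four bounds hold for the measurable versions; they fill `(0, T)`
  -- up to a null set.
  set B : Set ℝ := {t | (∫⁻ x, ‖Rm (t, x)‖ₑ ^ 2 ≤ (M : ℝ≥0∞) ^ 2 ∧
      ∫⁻ x, ‖Gm (t, x)‖ₑ ^ 2 ≤ (M : ℝ≥0∞) ^ 2) ∧ (∫⁻ x, ‖Λm (t, x)‖ₑ ^ 2 ≤ (M : ℝ≥0∞) ^ 2 ∧
      ∫⁻ x, ENNReal.ofReal ((Rm (t, x) ^ 2) ^ γ) ≤ (S : ℝ≥0∞))} with hB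
  have mB : MeasurableSet B := by
    refine MeasurableSet.inter (MeasurableSet.inter ?_ ?_) (MeasurableSet.inter ?_ ?_)
    · exact measurableSet_le (mR.enorm.pow_const 2).lintegral_prod_right' measurable_const
    · exact measurableSet_le (mG.enorm.pow_const 2).lintegral_prod_right' measurable_const
    · exact measurableSet_le (mΛ.enorm.pow_const 2).lintegral_prod_right' measurable_const
    · exact measurableSet_le (((mR.pow_const 2).pow_const γ).ennreal_ofReal).lintegral_prod_right'
        measurable_const
  have e1 := ae_le_essSup (f := fun t => eLpNorm (R t) 2 volume + eLpNorm (G t) 2 volume)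
    (μ := volume.restrict (timeInterval T))
  have e2 := ae_le_essSup (f := fun t => eLpNorm (Λ t) 2 volume)
    (μ := volume.restrict (timeInterval T))
  unfold energyNorm at hM
  have aB : ∀ᵐ t ∂(volume.restrict (timeInterval T)), t ∈ B := by
    filter_upwards [aR, aG, aΛ, e1, e2, sol.weakGradient] with t hRt hGt hΛt h1 h2 h3
    have k1 : eLpNorm (R t) 2 volume ≤ M :=
      (le_self_add.trans h1).trans (le_self_add.trans hM)
    have k2 : eLpNorm (G t) 2 volume ≤ M :=
      (le_add_self.trans h1).trans (le_self_add.trans hM)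
    have k3 : eLpNorm (Λ t) 2 volume ≤ M := h2.trans (le_add_self.trans hM)
    refine ⟨⟨?_, ?_⟩, ?_, ?_⟩
    · rw [lintegral_enorm_sq, ← eLpNorm_congr_ae hRt]; gcongr
    · rw [lintegral_enorm_sq, ← eLpNorm_congr_ae hGt]; gcongr
    · rw [lintegral_enorm_sq, ← eLpNorm_congr_ae hΛt]; gcongr
    · refine le_trans (le_of_eq (lintegral_congr_ae ?_)) (hS _ _ h3 k1 k2)
      filter_upwards [hRt] with x hx
      rw [hx]
  have aB' : ∀ᵐ z : ℝ × E d ∂((volume.restrict (timeInterval T)).prod volume), z.1 ∈ B :=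
    Measure.quasiMeasurePreserving_fst.ae aB
  classical
  -- Setting the fields to zero at bad times makes the bounds valid at every real time, with no
  -- exceptional set left.
  refine ⟨fun t x => if t ∈ B then Rm (t, x) else 0, fun t x => if t ∈ B then Gm (t, x) else 0,
    fun t x => if t ∈ B then Λm (t, x) else 0, ?_, ?_, ?_, ?_⟩
  · have mB' : MeasurableSet {z : ℝ × E d | z.1 ∈ B} := measurable_fst mB
    have qR : ∀ t, (Integrable fun x => (if t ∈ B then Rm (t, x) else 0) ^ 2) ∧
        ∫ x, (if t ∈ B then Rm (t, x) else 0) ^ 2 ≤ (M : ℝ) ^ 2 := fun t => by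
      by_cases ht : t ∈ B
      · simp only [ht, if_true]
        refine integrable_of_lintegral_le
          ((mR.comp measurable_prodMk_left).pow_const 2).aestronglyMeasurable
          (fun x => sq_nonneg _) (by positivity) ?_
        have := ht.1.1
        simp only [enorm_sq_eq_ofReal, Real.norm_eq_abs, sq_abs] at this
        rwa [ENNReal.ofReal_pow M.coe_nonneg, ENNReal.ofReal_coe_nnreal]
      · simp [ht]
    have qG : ∀ t, (Integrable fun x => ‖if t ∈ B then Gm (t, x) else 0‖ ^ 2) ∧
        ∫ x, ‖if t ∈ B then Gm (t, x) else 0‖ ^ 2 ≤ (M : ℝ) ^ 2 := fun t => by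
      by_cases ht : t ∈ B
      · simp only [ht, if_true]
        refine integrable_of_lintegral_le
          ((mG.comp measurable_prodMk_left).norm.pow_const 2).aestronglyMeasurable
          (fun x => sq_nonneg _) (by positivity) ?_
        have := ht.1.2
        simp only [enorm_sq_eq_ofReal] at this
        rwa [ENNReal.ofReal_pow M.coe_nonneg, ENNReal.ofReal_coe_nnreal]
      · simp [ht]
    have qΛ : ∀ t, (Integrable fun x => ‖if t ∈ B then Λm (t, x) else 0‖ ^ 2) ∧
        ∫ x, ‖if t ∈ B then Λm (t, x) else 0‖ ^ 2 ≤ (M : ℝ) ^ 2 := fun t => by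
      by_cases ht : t ∈ B
      · simp only [ht, if_true]
        refine integrable_of_lintegral_le
          ((mΛ.comp measurable_prodMk_left).norm.pow_const 2).aestronglyMeasurable
          (fun x => sq_nonneg _) (by positivity) ?_
        have := ht.2.1
        simp only [enorm_sq_eq_ofReal] at this
        rwa [ENNReal.ofReal_pow M.coe_nonneg, ENNReal.ofReal_coe_nnreal]
      · simp [ht]
    have qp : ∀ t, (Integrable fun x => ((if t ∈ B then Rm (t, x) else 0) ^ 2) ^ γ) ∧
        ∫ x, ((if t ∈ B then Rm (t, x) else 0) ^ 2) ^ γ ≤ (S : ℝ) := fun t => by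
      by_cases ht : t ∈ B
      · simp only [ht, if_true]
        refine integrable_of_lintegral_le
          (((mR.comp measurable_prodMk_left).pow_const 2).pow_const γ).aestronglyMeasurable
          (fun x => by positivity) (by positivity) ?_
        rw [ENNReal.ofReal_coe_nnreal]
        exact ht.2.2
      · have : ((0 : ℝ) ^ 2) ^ γ = 0 := by
          rw [zero_pow two_ne_zero, Real.zero_rpow (by linarith)]
        simp only [ht, if_false, this]
        simp
    exact ⟨Measurable.ite mB' mR measurable_const, Measurable.ite mB' mG measurable_const,
      Measurable.ite mB' mΛ measurable_const, fun t => (qR t).1, fun t => (qG t).1,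
      fun t => (qΛ t).1, fun t => (qp t).1, fun t => (qR t).2, fun t => (qG t).2,
      fun t => (qΛ t).2, fun t => (qp t).2⟩
  · filter_upwards [hR.ae_eq_mk, aB'] with z h1 h2
    rw [if_pos h2, h1]
  · filter_upwards [hG.ae_eq_mk, aB'] with z h1 h2
    rw [if_pos h2, h1]
  · filter_upwards [hΛ.ae_eq_mk, aB'] with z h1 h2
    rw [if_pos h2, h1]

section Densities

variable {d : ℕ} {γ M S : ℝ} {R : ℝ → E d → ℝ} {G Λ : ℝ → E d → E d}

lemma rho_nonneg (R : ℝ → E d → ℝ) (t : ℝ) (x : E d) : 0 ≤ rho R t x := sq_nonneg _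

lemma RegularFields.density_rho (h : RegularFields γ M S R G Λ) : IsDensity (rho R) (M ^ 2) := by
  have := IsDensity.of_sq h.meas_R h.meas_R h.int_R h.int_R h.le_R h.le_R
  simp only [← sq] at this
  exact this

lemma measurable_inner_field {V : ℝ → E d → E d} (hV : Measurable fun z : ℝ × E d => V z.1 z.2)
    (θ : E d) : Measurable fun z : ℝ × E d => inner ℝ θ (V z.1 z.2) :=
  (continuous_const.inner continuous_id).measurable.comp hV

lemma sq_inner_le {θ : E d} (hθ : ‖θ‖ ≤ 1) (v : E d) : (inner ℝ θ v) ^ 2 ≤ ‖v‖ ^ 2 := by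
  rw [← sq_abs]
  refine pow_le_pow_left₀ (abs_nonneg _) ((abs_real_inner_le_norm θ v).trans ?_) 2
  exact mul_le_of_le_one_left (norm_nonneg _) hθ

lemma integrable_sq_inner {V : ℝ → E d → E d} (hV : Measurable fun z : ℝ × E d => V z.1 z.2)
    (hi : ∀ t, Integrable fun x => ‖V t x‖ ^ 2) {θ : E d} (hθ : ‖θ‖ ≤ 1) (t : ℝ) :
    Integrable fun x => (inner ℝ θ (V t x)) ^ 2 := by
  refine (hi t).mono' ?_ (Filter.Eventually.of_forall fun x => ?_)
  · exact (((measurable_inner_field hV θ).comp measurable_prodMk_left).pow_const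
      2).aestronglyMeasurable
  · rw [Real.norm_of_nonneg (sq_nonneg _)]
    exact sq_inner_le hθ _

lemma integral_sq_inner_le {V : ℝ → E d → E d} (hV : Measurable fun z : ℝ × E d => V z.1 z.2)
    (hi : ∀ t, Integrable fun x => ‖V t x‖ ^ 2) (hM : ∀ t, ∫ x, ‖V t x‖ ^ 2 ≤ M)
    {θ : E d} (hθ : ‖θ‖ ≤ 1) (t : ℝ) : ∫ x, (inner ℝ θ (V t x)) ^ 2 ≤ M :=
  (integral_mono (integrable_sq_inner hV hi hθ t) (hi t) fun _ => sq_inner_le hθ _).trans (hM t)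

lemma RegularFields.density_mom (h : RegularFields γ M S R G Λ) {θ : E d} (hθ : ‖θ‖ ≤ 1) :
    IsDensity (fun t x => R t x * inner ℝ θ (Λ t x)) (M ^ 2) :=
  IsDensity.of_sq h.meas_R (measurable_inner_field h.meas_Λ θ) h.int_R
    (integrable_sq_inner h.meas_Λ h.int_Λ hθ) h.le_R
    (integral_sq_inner_le h.meas_Λ h.int_Λ h.le_Λ hθ)

lemma RegularFields.density_ΛΛ (h : RegularFields γ M S R G Λ) {θ θ' : E d} (hθ : ‖θ‖ ≤ 1)
    (hθ' : ‖θ'‖ ≤ 1) :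
    IsDensity (fun t x => inner ℝ θ (Λ t x) * inner ℝ θ' (Λ t x)) (M ^ 2) :=
  IsDensity.of_sq (measurable_inner_field h.meas_Λ θ) (measurable_inner_field h.meas_Λ θ')
    (integrable_sq_inner h.meas_Λ h.int_Λ hθ) (integrable_sq_inner h.meas_Λ h.int_Λ hθ')
    (integral_sq_inner_le h.meas_Λ h.int_Λ h.le_Λ hθ)
    (integral_sq_inner_le h.meas_Λ h.int_Λ h.le_Λ hθ')

lemma RegularFields.density_GG (h : RegularFields γ M S R G Λ) {θ θ' : E d} (hθ : ‖θ‖ ≤ 1)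
    (hθ' : ‖θ'‖ ≤ 1) :
    IsDensity (fun t x => inner ℝ θ (G t x) * inner ℝ θ' (G t x)) (M ^ 2) :=
  IsDensity.of_sq (measurable_inner_field h.meas_G θ) (measurable_inner_field h.meas_G θ')
    (integrable_sq_inner h.meas_G h.int_G hθ) (integrable_sq_inner h.meas_G h.int_G hθ')
    (integral_sq_inner_le h.meas_G h.int_G h.le_G hθ)
    (integral_sq_inner_le h.meas_G h.int_G h.le_G hθ')

lemma RegularFields.density_pressure (h : RegularFields γ M S R G Λ) (hγ : 1 < γ) :
    IsDensity (fun t x => pressure γ (rho R t x)) ((γ - 1) / γ * S) := by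
  have hγ0 : 0 ≤ (γ - 1) / γ := div_nonneg (by linarith) (by linarith)
  have h0 : ∀ t x, 0 ≤ rho R t x ^ γ := fun t x => Real.rpow_nonneg (rho_nonneg R t x) γ
  have h1 : IsDensity (fun t x => rho R t x ^ γ) S :=
    ⟨(h.meas_R.pow_const 2).pow_const γ, h.int_pow, fun t => by
      simpa only [abs_of_nonneg (h0 t _)] using h.le_pow t⟩
  have := h1.const_mul ((γ - 1) / γ)
  rwa [abs_of_nonneg hγ0] at this

end Densities

/-! ### The weak equations tested with products of functions of time and space -/

/-- The momentum paired with the gradient of `φ`. -/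
def flux {d : ℕ} (R : ℝ → E d → ℝ) (Λ : ℝ → E d → E d) (φ : E d → ℝ) (t : ℝ) : ℝ :=
  ∑ i, pair (fun t x => R t x * Λ t x i) (dv i φ) t

/-- The stress tensor paired with the Hessian of `φ`, including the dispersive term. -/
def stress {d : ℕ} (γ : ℝ) (R : ℝ → E d → ℝ) (G Λ : ℝ → E d → E d) (φ : E d → ℝ) (t : ℝ) : ℝ :=
  (∑ i, ∑ j, (pair (fun t x => Λ t x i * Λ t x j) (dv j (dv i φ)) t
      + pair (fun t x => G t x i * G t x j) (dv j (dv i φ)) t))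
    + pair (fun t x => pressure γ (rho R t x)) (lap φ) t
    - 1 / 4 * pair (rho R) (lap (lap φ)) t

section Tensor

variable {d : ℕ} {T : EReal} {χ : ℝ → ℝ} {φ : E d → ℝ}

lemma fderiv_tensor (hχ : Differentiable ℝ χ) (hφ : Differentiable ℝ φ) (z v : ℝ × E d) :
    fderiv ℝ (fun w : ℝ × E d => χ w.1 * φ w.2) z v =
      deriv χ z.1 * v.1 * φ z.2 + χ z.1 * fderiv ℝ φ z.2 v.2 := by
  have h1 : HasFDerivAt (fun w : ℝ × E d => χ w.1)
      ((fderiv ℝ χ z.1).comp (ContinuousLinearMap.fst ℝ ℝ (E d))) z :=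
    (hχ z.1).hasFDerivAt.comp z hasFDerivAt_fst
  have h2 : HasFDerivAt (fun w : ℝ × E d => φ w.2)
      ((fderiv ℝ φ z.2).comp (ContinuousLinearMap.snd ℝ ℝ (E d))) z :=
    (hφ z.2).hasFDerivAt.comp z hasFDerivAt_snd
  rw [(h1.fun_mul h2).fderiv]
  simp only [add_apply, smul_apply,
    ContinuousLinearMap.comp_apply, ContinuousLinearMap.coe_fst', ContinuousLinearMap.coe_snd',
    smul_eq_mul]
  have h3 : fderiv ℝ χ z.1 v.1 = deriv χ z.1 * v.1 := by
    rw [fderiv_eq_smul_deriv, smul_eq_mul, mul_comm]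
  rw [h3]
  ring

lemma dt_tensor (hχ : Differentiable ℝ χ) (hφ : Differentiable ℝ φ) (z : ℝ × E d) :
    dt (fun w : ℝ × E d => χ w.1 * φ w.2) z = φ z.2 * deriv χ z.1 := by
  rw [dt, fderiv_tensor hχ hφ]
  simp [mul_comm]

lemma dx_tensor (hχ : Differentiable ℝ χ) (hφ : Differentiable ℝ φ) (i : Fin d) (z : ℝ × E d) :
    dx i (fun w : ℝ × E d => χ w.1 * φ w.2) z = χ z.1 * dv i φ z.2 := by
  rw [dx, fderiv_tensor hχ hφ]
  simp [dv]

lemma isTest_tensor {F : Type} [NormedAddCommGroup F] [NormedSpace ℝ F] {ζ : E d → F}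
    (hχ : IsTimeTest T χ) (hζ : ContDiff ℝ ∞ ζ) (hc : HasCompactSupport ζ) :
    IsTest T fun z : ℝ × E d => χ z.1 • ζ z.2 := by
  have hsub : Function.support (fun z : ℝ × E d => χ z.1 • ζ z.2) ⊆ tsupport χ ×ˢ tsupport ζ := by
    intro z hz
    rw [Function.mem_support] at hz
    refine ⟨subset_tsupport _ fun h => hz ?_, subset_tsupport _ fun h => hz ?_⟩
    · simp [h]
    · simp [h]
  have hts : tsupport (fun z : ℝ × E d => χ z.1 • ζ z.2) ⊆ tsupport χ ×ˢ tsupport ζ :=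
    closure_minimal hsub ((isClosed_tsupport _).prod (isClosed_tsupport _))
  refine ⟨(hχ.smooth.comp contDiff_fst).smul (hζ.comp contDiff_snd), ?_, ?_⟩
  · exact (hχ.compact.isCompact.prod hc.isCompact).of_isClosed_subset (isClosed_tsupport _) hts
  · exact fun z hz => hχ.support (hts hz).1

end Tensor

lemma hasCompactSupport_dv {d : ℕ} {φ : E d → ℝ} (h : HasCompactSupport φ) (i : Fin d) :
    HasCompactSupport (dv i φ) := by
  refine (h.fderiv (𝕜 := ℝ)).mono fun x hx => ?_
  rw [Function.mem_support] at hx ⊢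
  intro h0
  exact hx (by simp [dv, h0])

/-- The gradient of `φ` as a vector field. -/
def grad {d : ℕ} (φ : E d → ℝ) (x : E d) : E d := WithLp.toLp 2 fun i => dv i φ x

lemma grad_apply {d : ℕ} (φ : E d → ℝ) (x : E d) (i : Fin d) : grad φ x i = dv i φ x := rfl

lemma contDiff_grad {d : ℕ} {φ : E d → ℝ} (h : ContDiff ℝ ∞ φ) : ContDiff ℝ ∞ (grad φ) :=
  contDiff_euclidean.2 fun i => contDiff_dv h i

lemma hasCompactSupport_grad {d : ℕ} {φ : E d → ℝ} (h : HasCompactSupport φ) :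
    HasCompactSupport (grad φ) := by
  refine (h.fderiv (𝕜 := ℝ)).mono fun x hx => ?_
  rw [Function.mem_support] at hx ⊢
  intro h0
  refine hx ?_
  ext i
  simp [grad_apply, dv, h0]

lemma inner_e {d : ℕ} (i : Fin d) (v : E d) : inner ℝ (e i) v = v i := by
  simp [e, EuclideanSpace.inner_single_left]

section RegularDensities

variable {d : ℕ} {γ M S : ℝ} {R : ℝ → E d → ℝ} {G Λ : ℝ → E d → E d}

lemma RegularFields.density_mom_coord (h : RegularFields γ M S R G Λ) (i : Fin d) :
    IsDensity (fun t x => R t x * Λ t x i) (M ^ 2) := by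
  simpa only [inner_e] using h.density_mom (norm_e i).le

lemma RegularFields.density_ΛΛ_coord (h : RegularFields γ M S R G Λ) (i j : Fin d) :
    IsDensity (fun t x => Λ t x i * Λ t x j) (M ^ 2) := by
  simpa only [inner_e] using h.density_ΛΛ (norm_e i).le (norm_e j).le

lemma RegularFields.density_GG_coord (h : RegularFields γ M S R G Λ) (i j : Fin d) :
    IsDensity (fun t x => G t x i * G t x j) (M ^ 2) := by
  simpa only [inner_e] using h.density_GG (norm_e i).le (norm_e j).le

end RegularDensities

/-- The equations satisfied by the moments of a solution. -/
structure WeakEquations {d : ℕ} (γ : ℝ) (T : EReal) (ρ₀ : E d → ℝ) (R : ℝ → E d → ℝ)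
    (G Λ : ℝ → E d → E d) : Prop where
  mass : ∀ φ, ContDiff ℝ ∞ φ → HasCompactSupport φ → ∀ χ, IsTimeTest T χ →
    (∫ t in timeInterval T, (pair (rho R) φ t * deriv χ t + flux R Λ φ t * χ t))
      + (∫ x, ρ₀ x * φ x) * χ 0 = 0
  momentum : ∀ φ, ContDiff ℝ ∞ φ → HasCompactSupport φ → ∃ j₀ : ℝ, ∀ χ, IsTimeTest T χ →
    (∫ t in timeInterval T, (flux R Λ φ t * deriv χ t + stress γ R G Λ φ t * χ t))
      + j₀ * χ 0 = 0

/-- Fubini in the form needed for separated tests, with `k` and `l` in the roles of `χ'` and `χ`. -/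
lemma integral_slab_two {d : ℕ} {T : EReal} {f g : ℝ → E d → ℝ} {C C' : ℝ} (hf : IsDensity f C)
    (hg : IsDensity g C') {k l : ℝ → ℝ} (hk : Integrable k) (hl : Integrable l) :
    ∫ z in slab d T, (f z.1 z.2 * k z.1 + g z.1 z.2 * l z.1) =
      ∫ t in timeInterval T, ((∫ x, f t x) * k t + (∫ x, g t x) * l t) := by
  have hk' := hk.integrableOn (s := timeInterval T)
  have hl' := hl.integrableOn (s := timeInterval T)
  rw [restrict_slab, integral_add (hf.integrable_prod hk') (hg.integrable_prod hl'),
    hf.integral_prod hk', hg.integral_prod hl', integral_add]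
  · exact hk'.bdd_mul hf.measurable_integral.aestronglyMeasurable
      (Filter.Eventually.of_forall hf.abs_integral_le)
  · exact hl'.bdd_mul hg.measurable_integral.aestronglyMeasurable
      (Filter.Eventually.of_forall hg.abs_integral_le)

lemma bdd_of_compact {d : ℕ} {φ : E d → ℝ} (hφ : ContDiff ℝ ∞ φ) (hc : HasCompactSupport φ) :
    ∃ K, ∀ x, |φ x| ≤ K := hφ.continuous.bounded_above_of_compact_support hc

/-- Test the continuity equation with `χ(t) φ(x)` and the momentum equation with `χ(t) ∇φ(x)`. The
divergence of the latter is `χ Δφ`, so the pressure meets `Δφ` and the dispersive term meets `Δ²φ`.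
-/
lemma IsFiniteEnergyWeakSolution.weakEquations {d : ℕ} {γ : ℝ} {T : EReal} {ρ₀ : E d → ℝ}
    {J₀ : E d → E d} {R R' : ℝ → E d → ℝ} {G Λ G' Λ' : ℝ → E d → E d} {M S : ℝ}
    (sol : IsFiniteEnergyWeakSolution γ T ρ₀ J₀ R G Λ) (hγ : 1 < γ)
    (reg : RegularFields γ M S R' G' Λ') (hR : AgreeAE T R R') (hG : AgreeAE T G G')
    (hΛ : AgreeAE T Λ Λ') : WeakEquations γ T ρ₀ R' G' Λ' := by
  constructor
  · intro φ hφ hc χ hχ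
    have hφ1 : Differentiable ℝ φ := hφ.differentiable (by simp)
    have hχ1 : Differentiable ℝ χ := hχ.smooth.differentiable (by simp)
    have hd : Continuous (deriv χ) := hχ.smooth.continuous_deriv (by simp)
    have key := sol.continuity (fun z => χ z.1 • φ z.2) (isTest_tensor hχ hφ hc)
    simp only [smul_eq_mul] at key
    obtain ⟨K, hK⟩ := bdd_of_compact hφ hc
    have hKi : ∀ i : Fin d, ∃ K, ∀ x, |dv i φ x| ≤ K := fun i =>
      bdd_of_compact (contDiff_dv hφ i) (hasCompactSupport_dv hc i)
    choose K' hK' using hKi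
    have D1 := reg.density_rho.mul_bdd hφ.continuous hK
    have D2i : ∀ i ∈ Finset.univ, IsDensity (fun t x => R' t x * Λ' t x i * dv i φ x)
        (M ^ 2 * K' i) := fun i _ =>
      (reg.density_mom_coord i).mul_bdd (contDiff_dv hφ i).continuous (hK' i)
    have D2 := IsDensity.sum D2i
    have e1 : ∫ z in slab d T, (rho R z.1 z.2 * dt (fun z => χ z.1 * φ z.2) z
          + ∑ i, mom R Λ z.1 z.2 i * dx i (fun z => χ z.1 * φ z.2) z)
        = ∫ z in slab d T, (rho R' z.1 z.2 * φ z.2 * deriv χ z.1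
          + (∑ i, R' z.1 z.2 * Λ' z.1 z.2 i * dv i φ z.2) * χ z.1) := by
      rw [restrict_slab]
      refine integral_congr_ae ?_
      filter_upwards [hR, hΛ] with z h1 h2
      simp only [dt_tensor hχ1 hφ1, dx_tensor hχ1 hφ1, rho, mom, h1, h2, PiLp.smul_apply,
        smul_eq_mul]
      rw [Finset.sum_mul]
      congr 1
      · ring
      · exact Finset.sum_congr rfl fun i _ => by ring
    rw [e1, integral_slab_two D1 D2 (hd.integrable_of_hasCompactSupport hχ.compact.deriv)
      (hχ.smooth.continuous.integrable_of_hasCompactSupport hχ.compact)] at key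
    have e2 : ∀ t, ∫ x, ∑ i, R' t x * Λ' t x i * dv i φ x = flux R' Λ' φ t := fun t => by
      rw [integral_finsetSum _ fun i hi => (D2i i hi).int t]
      rfl
    have e3 : ∫ x, ρ₀ x * (χ 0 * φ x) = (∫ x, ρ₀ x * φ x) * χ 0 := by
      rw [← integral_mul_const]
      exact integral_congr_ae (Filter.Eventually.of_forall fun x => by simp only; ring)
    simp only [e2, e3] at key
    exact key
  · intro φ hφ hc
    refine ⟨∫ x, ∑ i, J₀ x i * dv i φ x, fun χ hχ => ?_⟩
    have hχ1 : Differentiable ℝ χ := hχ.smooth.differentiable (by simp)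
    have hd : Continuous (deriv χ) := hχ.smooth.continuous_deriv (by simp)
    have key := sol.momentum (fun z => χ z.1 • grad φ z.2)
      (isTest_tensor hχ (contDiff_grad hφ) (hasCompactSupport_grad hc))
    simp only [PiLp.smul_apply, smul_eq_mul, grad_apply] at key
    have s1 : ∀ i : Fin d, ContDiff ℝ ∞ (dv i φ) := contDiff_dv hφ
    have s2 : ∀ i j : Fin d, ContDiff ℝ ∞ (dv j (dv i φ)) := fun i j => contDiff_dv (s1 i) j
    have s3 : ContDiff ℝ ∞ (lap φ) := contDiff_lap hφ
    have f1 : ∀ i : Fin d, Differentiable ℝ (dv i φ) := fun i => (s1 i).differentiable (by simp)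
    have U := unifSmooth_const_of_compact hφ hc
    have hK1 : ∀ i : Fin d, ∃ K, ∀ x, |dv i φ x| ≤ K := fun i =>
      let ⟨K, hK⟩ := (U.dv i).exists_bound; ⟨K, hK 0⟩
    have hK2 : ∀ i j : Fin d, ∃ K, ∀ x, |dv j (dv i φ) x| ≤ K := fun i j =>
      let ⟨K, hK⟩ := ((U.dv i).dv j).exists_bound; ⟨K, hK 0⟩
    obtain ⟨K3, hK3⟩ := U.lap.exists_bound
    obtain ⟨K4, hK4⟩ := U.lap.lap.exists_bound
    choose K1 hK1 using hK1
    choose K2 hK2 using hK2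
    have D1i : ∀ i ∈ Finset.univ, IsDensity (fun t x => R' t x * Λ' t x i * dv i φ x)
        (M ^ 2 * K1 i) := fun i _ =>
      (reg.density_mom_coord i).mul_bdd (s1 i).continuous (hK1 i)
    have D1 := IsDensity.sum D1i
    have Da : ∀ i j : Fin d, IsDensity (fun t x => Λ' t x i * Λ' t x j * dv j (dv i φ) x)
        (M ^ 2 * K2 i j) := fun i j =>
      (reg.density_ΛΛ_coord i j).mul_bdd (s2 i j).continuous (hK2 i j)
    have Db : ∀ i j : Fin d, IsDensity (fun t x => G' t x i * G' t x j * dv j (dv i φ) x)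
        (M ^ 2 * K2 i j) := fun i j =>
      (reg.density_GG_coord i j).mul_bdd (s2 i j).continuous (hK2 i j)
    have Dc := (reg.density_pressure hγ).mul_bdd s3.continuous (hK3 0)
    have De := reg.density_rho.mul_bdd (contDiff_lap s3).continuous (hK4 0)
    have Dij : ∀ i ∈ Finset.univ, IsDensity (fun t x => ∑ j, (Λ' t x i * Λ' t x j * dv j (dv i φ) x
        + G' t x i * G' t x j * dv j (dv i φ) x)) (∑ j, (M ^ 2 * K2 i j + M ^ 2 * K2 i j)) :=
      fun i _ => IsDensity.sum fun j _ => (Da i j).add (Db i j)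
    have Ds := IsDensity.sum Dij
    have D2 := (Ds.add Dc).add (De.const_mul (-(1 / 4)))
    have dxl : ∀ z : ℝ × E d, ∑ i, dx i (fun w : ℝ × E d => χ w.1 * dv i φ w.2) z =
        χ z.1 * lap φ z.2 := fun z => by
      simp only [dx_tensor hχ1 (f1 _), lap, Finset.mul_sum]
    have dxll : ∀ z : ℝ × E d, ∑ j, dx j (dx j fun y : ℝ × E d => χ y.1 * lap φ y.2) z =
        χ z.1 * lap (lap φ) z.2 := fun z => by
      have : ∀ j : Fin d, (dx j fun y : ℝ × E d => χ y.1 * lap φ y.2) =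
          fun y => χ y.1 * dv j (lap φ) y.2 := fun j =>
        funext fun y => dx_tensor hχ1 (s3.differentiable (by simp)) j y
      simp only [this]
      simp only [dx_tensor hχ1 ((contDiff_dv s3 _).differentiable (by simp))]
      rw [lap, Finset.mul_sum]
    simp only [dxl, dxll] at key
    have e1 : ∫ z in slab d T, ((∑ i, mom R Λ z.1 z.2 i * dt (fun w => χ w.1 * dv i φ w.2) z)
          + (∑ i, ∑ j, Λ z.1 z.2 i * Λ z.1 z.2 j * dx j (fun w => χ w.1 * dv i φ w.2) z)
          + pressure γ (rho R z.1 z.2) * (χ z.1 * lap φ z.2)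
          + (∑ i, ∑ j, G z.1 z.2 i * G z.1 z.2 j * dx j (fun w => χ w.1 * dv i φ w.2) z)
          - 1 / 4 * rho R z.1 z.2 * (χ z.1 * lap (lap φ) z.2))
        = ∫ z in slab d T, ((∑ i, R' z.1 z.2 * Λ' z.1 z.2 i * dv i φ z.2) * deriv χ z.1
          + ((∑ i, ∑ j, (Λ' z.1 z.2 i * Λ' z.1 z.2 j * dv j (dv i φ) z.2
              + G' z.1 z.2 i * G' z.1 z.2 j * dv j (dv i φ) z.2))
            + pressure γ (rho R' z.1 z.2) * lap φ z.2
            + -(1 / 4) * (rho R' z.1 z.2 * lap (lap φ) z.2)) * χ z.1) := by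
      rw [restrict_slab]
      refine integral_congr_ae ?_
      filter_upwards [hR, hG, hΛ] with z h1 h2 h3
      simp only [dt_tensor hχ1 (f1 _), dx_tensor hχ1 (f1 _), rho, mom, h1, h2, h3,
        PiLp.smul_apply, smul_eq_mul, Finset.sum_add_distrib, add_mul, Finset.sum_mul]
      have r1 : ∀ i : Fin d, R' z.1 z.2 * Λ' z.1 z.2 i * (dv i φ z.2 * deriv χ z.1) =
        R' z.1 z.2 * Λ' z.1 z.2 i * dv i φ z.2 * deriv χ z.1 := fun i => by ring
      have r2 : ∀ i j : Fin d, Λ' z.1 z.2 i * Λ' z.1 z.2 j * (χ z.1 * dv j (dv i φ) z.2) =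
        Λ' z.1 z.2 i * Λ' z.1 z.2 j * dv j (dv i φ) z.2 * χ z.1 := fun i j => by ring
      have r3 : ∀ i j : Fin d, G' z.1 z.2 i * G' z.1 z.2 j * (χ z.1 * dv j (dv i φ) z.2) =
        G' z.1 z.2 i * G' z.1 z.2 j * dv j (dv i φ) z.2 * χ z.1 := fun i j => by ring
      simp only [r1, r2, r3]
      ring
    rw [e1, integral_slab_two D1 D2 (hd.integrable_of_hasCompactSupport hχ.compact.deriv)
      (hχ.smooth.continuous.integrable_of_hasCompactSupport hχ.compact)] at key
    have e2 : ∀ t, ∫ x, ∑ i, R' t x * Λ' t x i * dv i φ x = flux R' Λ' φ t := fun t => by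
      rw [integral_finsetSum _ fun i hi => (D1i i hi).int t]
      rfl
    have e4 : ∀ t, ∫ x, ((∑ i, ∑ j, (Λ' t x i * Λ' t x j * dv j (dv i φ) x
              + G' t x i * G' t x j * dv j (dv i φ) x))
            + pressure γ (rho R' t x) * lap φ x
            + -(1 / 4) * (rho R' t x * lap (lap φ) x)) = stress γ R' G' Λ' φ t := fun t => by
      rw [integral_add ((Ds.add Dc).int t) ((De.const_mul (-(1 / 4))).int t),
        integral_add (Ds.int t) (Dc.int t), integral_finsetSum _ fun i hi => (Dij i hi).int t,
        integral_const_mul, stress, sub_eq_add_neg, neg_mul]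
      congr 2
      refine Finset.sum_congr rfl fun i _ => ?_
      rw [integral_finsetSum _ fun j _ => ((Da i j).add (Db i j)).int t]
      exact Finset.sum_congr rfl fun j _ => integral_add ((Da i j).int t) ((Db i j).int t)
    have e3 : ∫ x, ∑ i, J₀ x i * (χ 0 * dv i φ x) = (∫ x, ∑ i, J₀ x i * dv i φ x) * χ 0 := by
      rw [← integral_mul_const]
      refine integral_congr_ae (Filter.Eventually.of_forall fun x => ?_)
      simp only
      rw [Finset.sum_mul]
      exact Finset.sum_congr rfl fun i _ => by ring
    simp only [e2, e3, e4] at key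
    exact key

/-! ### Limits of test functions -/

section Limits

variable {d : ℕ} {γ M S : ℝ} {R : ℝ → E d → ℝ} {G Λ : ℝ → E d → E d} {φ : E d → ℝ}
  {u : ℕ → E d → ℝ} {K : ℝ}

lemma abs_lap_le (hK : ∀ i j x, |dv j (dv i φ) x| ≤ K) (x : E d) : |lap φ x| ≤ d * K := by
  refine (Finset.abs_sum_le_sum_abs _ _).trans ?_
  refine (Finset.sum_le_sum fun i _ => hK i i x).trans (le_of_eq ?_)
  simp

lemma RegularFields.measurable_flux (reg : RegularFields γ M S R G Λ) (hφ : ContDiff ℝ ∞ φ)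
    (hK : ∀ i x, |dv i φ x| ≤ K) : Measurable (flux R Λ φ) := by
  unfold flux
  exact Finset.measurable_sum _ fun i _ =>
    (reg.density_mom_coord i).measurable_pair (contDiff_dv hφ i).continuous (hK i)

lemma RegularFields.abs_flux_le (reg : RegularFields γ M S R G Λ) (hφ : ContDiff ℝ ∞ φ)
    (hK : ∀ i x, |dv i φ x| ≤ K) (t : ℝ) : |flux R Λ φ t| ≤ d * (M ^ 2 * K) := by
  unfold flux
  refine (Finset.abs_sum_le_sum_abs _ _).trans ?_
  refine (Finset.sum_le_sum fun i _ => (reg.density_mom_coord i).abs_pair_le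
    (contDiff_dv hφ i).continuous (hK i) t).trans (le_of_eq ?_)
  simp

lemma RegularFields.measurable_stress (reg : RegularFields γ M S R G Λ) (hγ : 1 < γ)
    (hφ : ContDiff ℝ ∞ φ) (hK : ∀ i j x, |dv j (dv i φ) x| ≤ K)
    (hK' : ∀ x, |lap (lap φ) x| ≤ K) : Measurable (stress γ R G Λ φ) := by
  have s2 : ∀ i j : Fin d, Continuous (dv j (dv i φ)) := fun i j =>
    (contDiff_dv (contDiff_dv hφ i) j).continuous
  unfold stress
  refine (((Finset.measurable_sum _ fun i _ => Finset.measurable_sum _ fun j _ => ?_)).add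
    ?_).sub (Measurable.const_mul ?_ _)
  · exact ((reg.density_ΛΛ_coord i j).measurable_pair (s2 i j) (hK i j)).add
      ((reg.density_GG_coord i j).measurable_pair (s2 i j) (hK i j))
  · exact (reg.density_pressure hγ).measurable_pair (contDiff_lap hφ).continuous (abs_lap_le hK)
  · exact reg.density_rho.measurable_pair (contDiff_lap (contDiff_lap hφ)).continuous hK'

/-- The constant in the bound for the stress. -/
def stressConst (d : ℕ) (γ M S K : ℝ) : ℝ :=
  (d * (d * (M ^ 2 * K + M ^ 2 * K))) + (γ - 1) / γ * S * (d * K) + 1 / 4 * (M ^ 2 * K)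

lemma RegularFields.abs_stress_le (reg : RegularFields γ M S R G Λ) (hγ : 1 < γ)
    (hφ : ContDiff ℝ ∞ φ) (hK : ∀ i j x, |dv j (dv i φ) x| ≤ K)
    (hK' : ∀ x, |lap (lap φ) x| ≤ K) (t : ℝ) :
    |stress γ R G Λ φ t| ≤ stressConst d γ M S K := by
  have s2 : ∀ i j : Fin d, Continuous (dv j (dv i φ)) := fun i j =>
    (contDiff_dv (contDiff_dv hφ i) j).continuous
  unfold stress stressConst
  refine (abs_sub _ _).trans (add_le_add ((abs_add_le _ _).trans (add_le_add ?_ ?_)) ?_)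
  · refine (Finset.abs_sum_le_sum_abs _ _).trans ((Finset.sum_le_sum fun i _ =>
      (Finset.abs_sum_le_sum_abs _ _).trans (Finset.sum_le_sum fun j _ =>
        (abs_add_le _ _).trans (add_le_add ((reg.density_ΛΛ_coord i j).abs_pair_le (s2 i j)
          (hK i j) t) ((reg.density_GG_coord i j).abs_pair_le (s2 i j) (hK i j) t)))).trans
          (le_of_eq ?_))
    simp
    ring
  · exact (reg.density_pressure hγ).abs_pair_le (contDiff_lap hφ).continuous (abs_lap_le hK) t
  · rw [abs_mul, abs_of_pos (by norm_num : (0 : ℝ) < 1 / 4)]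
    exact mul_le_mul_of_nonneg_left
      (reg.density_rho.abs_pair_le (contDiff_lap (contDiff_lap hφ)).continuous hK' t) (by norm_num)

lemma RegularFields.tendsto_flux (reg : RegularFields γ M S R G Λ)
    (hu : ∀ n, ContDiff ℝ ∞ (u n)) (hlim : LocallyEventuallyEq u φ)
    (hK : ∀ n i x, |dv i (u n) x| ≤ K) (t : ℝ) :
    Filter.Tendsto (fun n => flux R Λ (u n) t) Filter.atTop (nhds (flux R Λ φ t)) :=
  tendsto_finsetSum _ fun i _ => (reg.density_mom_coord i).tendsto_pair
    (fun n => (contDiff_dv (hu n) i).continuous) (fun n => hK n i) (hlim.dv i).tendsto t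

lemma RegularFields.tendsto_stress (reg : RegularFields γ M S R G Λ) (hγ : 1 < γ)
    (hu : ∀ n, ContDiff ℝ ∞ (u n)) (hlim : LocallyEventuallyEq u φ)
    (hK : ∀ n i j x, |dv j (dv i (u n)) x| ≤ K)
    (hK' : ∀ n x, |lap (lap (u n)) x| ≤ K) (t : ℝ) :
    Filter.Tendsto (fun n => stress γ R G Λ (u n) t) Filter.atTop
      (nhds (stress γ R G Λ φ t)) := by
  have s2 : ∀ n, ∀ i j : Fin d, Continuous (dv j (dv i (u n))) := fun n i j =>
    (contDiff_dv (contDiff_dv (hu n) i) j).continuous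
  have l2 : ∀ i j : Fin d, ∀ x, Filter.Tendsto (fun n => dv j (dv i (u n)) x) Filter.atTop
      (nhds (dv j (dv i φ) x)) := fun i j => ((hlim.dv i).dv j).tendsto
  unfold stress
  refine Filter.Tendsto.sub (Filter.Tendsto.add (tendsto_finsetSum _ fun i _ =>
    tendsto_finsetSum _ fun j _ => Filter.Tendsto.add ?_ ?_) ?_) (Filter.Tendsto.const_mul _ ?_)
  · exact (reg.density_ΛΛ_coord i j).tendsto_pair (fun n => s2 n i j) (fun n => hK n i j)
      (l2 i j) t
  · exact (reg.density_GG_coord i j).tendsto_pair (fun n => s2 n i j) (fun n => hK n i j)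
      (l2 i j) t
  · exact (reg.density_pressure hγ).tendsto_pair (fun n => (contDiff_lap (hu n)).continuous)
      (fun n => abs_lap_le (hK n)) hlim.lap.tendsto t
  · exact reg.density_rho.tendsto_pair
      (fun n => (contDiff_lap (contDiff_lap (hu n))).continuous) hK' hlim.lap.lap.tendsto t

end Limits

lemma exists_common_bound {ι : Type*} [Finite ι] {α : Type*} {f : ι → α → ℝ}
    (h : ∀ i, ∃ K, ∀ x, |f i x| ≤ K) : ∃ K, ∀ i x, |f i x| ≤ K := by
  classical
  choose K hK using h
  obtain ⟨B, hB⟩ := (Set.finite_range K).bddAbove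
  exact ⟨B, fun i x => (hK i x).trans (hB ⟨i, rfl⟩)⟩

lemma UnifSmooth.exists_bound_dv {d : ℕ} {u : ℕ → E d → ℝ} (hu : UnifSmooth u) :
    ∃ K, ∀ n i x, |QHD.dv i (u n) x| ≤ K := by
  obtain ⟨K, hK⟩ := exists_common_bound (ι := Fin d) (f := fun i (p : ℕ × E d) =>
    QHD.dv i (u p.1) p.2) fun i =>
    let ⟨K, hK⟩ := (hu.dv i).exists_bound; ⟨K, fun p => hK p.1 p.2⟩
  exact ⟨K, fun n i x => hK i (n, x)⟩

lemma UnifSmooth.exists_bound_dv_dv {d : ℕ} {u : ℕ → E d → ℝ} (hu : UnifSmooth u) :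
    ∃ K, (∀ n i j x, |QHD.dv j (QHD.dv i (u n)) x| ≤ K) ∧
      ∀ n x, |QHD.lap (QHD.lap (u n)) x| ≤ K := by
  obtain ⟨K, hK⟩ := exists_common_bound (ι := Fin d × Fin d) (f := fun i (p : ℕ × E d) =>
    QHD.dv i.2 (QHD.dv i.1 (u p.1)) p.2) fun i =>
    let ⟨K, hK⟩ := ((hu.dv i.1).dv i.2).exists_bound; ⟨K, fun p => hK p.1 p.2⟩
  obtain ⟨L, hL⟩ := hu.lap.lap.exists_bound
  exact ⟨max K L, fun n i j x => (hK (i, j) (n, x)).trans (le_max_left _ _),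
    fun n x => (hL n x).trans (le_max_right _ _)⟩

/-! ### Test functions in space without compact support. -/

section BoundedTests

variable {d : ℕ} {γ M S : ℝ} {R : ℝ → E d → ℝ} {G Λ : ℝ → E d → E d} {φ : E d → ℝ}
  {T : EReal} {ρ₀ : E d → ℝ}

lemma unifSmooth_cutoff_mul (hφ : UnifSmooth fun _ => φ) :
    UnifSmooth fun n x => cutoff d n x * φ x := (unifSmooth_cutoff d).mul hφ

/-- The cut-off functions have uniformly bounded derivatives and agree with `φ` near each point
eventually, so dominated convergence applies against densities of bounded mass. Time tests supported
inside `(0, T)` remove the initial term, whose integral need not exist for such `φ`. -/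
lemma WeakEquations.mass_bdd (weq : WeakEquations γ T ρ₀ R G Λ)
    (reg : RegularFields γ M S R G Λ) (hφ : UnifSmooth fun _ => φ) {χ : ℝ → ℝ}
    (hχ : IsTimeTest T χ) (hχT : tsupport χ ⊆ timeInterval T) :
    ∫ t in timeInterval T, (pair (rho R) φ t * deriv χ t + flux R Λ φ t * χ t) = 0 := by
  set u : ℕ → E d → ℝ := fun n x => cutoff d n x * φ x with hu
  have hU : UnifSmooth u := unifSmooth_cutoff_mul hφ
  have hL : LocallyEventuallyEq u φ := locallyEventuallyEq_cutoff φ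
  have huc : ∀ n, HasCompactSupport (u n) := fun n => (cutoff_compact d n).mul_right
  obtain ⟨K₀, hK₀⟩ := hU.exists_bound
  obtain ⟨K₁, hK₁⟩ := hU.exists_bound_dv
  have hφ0 : ∀ x, |φ x| ≤ K₀ := fun x =>
    le_of_tendsto (hL.tendsto x).abs (Filter.Eventually.of_forall fun n => hK₀ n x)
  have hφ1 : ∀ i x, |dv i φ x| ≤ K₁ := fun i x =>
    le_of_tendsto ((hL.dv i).tendsto x).abs (Filter.Eventually.of_forall fun n => hK₁ n i x)
  have hd : Continuous (deriv χ) := hχ.smooth.continuous_deriv (by simp)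
  have i1 : IntegrableOn (deriv χ) (timeInterval T) :=
    (hd.integrable_of_hasCompactSupport hχ.compact.deriv).integrableOn
  have i2 : IntegrableOn χ (timeInterval T) :=
    (hχ.smooth.continuous.integrable_of_hasCompactSupport hχ.compact).integrableOn
  have hz : χ 0 = 0 := image_eq_zero_of_notMem_tsupport fun h => lt_irrefl _ (hχT h).1
  have split : ∀ ψ : E d → ℝ, ContDiff ℝ ∞ ψ → (∀ x, |ψ x| ≤ K₀) → (∀ i x, |dv i ψ x| ≤ K₁) →
      ∫ t in timeInterval T, (pair (rho R) ψ t * deriv χ t + flux R Λ ψ t * χ t) =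
      (∫ t in timeInterval T, pair (rho R) ψ t * deriv χ t) +
        ∫ t in timeInterval T, flux R Λ ψ t * χ t := fun ψ hψ h0 h1 => by
    refine integral_add ?_ ?_
    · exact i1.bdd_mul (reg.density_rho.measurable_pair hψ.continuous h0).aestronglyMeasurable
        (Filter.Eventually.of_forall (reg.density_rho.abs_pair_le hψ.continuous h0))
    · exact i2.bdd_mul (reg.measurable_flux hψ h1).aestronglyMeasurable
        (Filter.Eventually.of_forall (reg.abs_flux_le hψ h1))
  rw [split φ (hφ.smooth 0) hφ0 hφ1]
  have t1 := tendsto_integral_mul_of_bdd (μ := volume.restrict (timeInterval T))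
    (A := fun n => pair (rho R) (u n))
    (fun n => reg.density_rho.measurable_pair (hU.smooth n).continuous (hK₀ n))
    (fun n => reg.density_rho.abs_pair_le (hU.smooth n).continuous (hK₀ n)) i1
    (fun t => reg.density_rho.tendsto_pair (fun n => (hU.smooth n).continuous) hK₀ hL.tendsto t)
  have t2 := tendsto_integral_mul_of_bdd (μ := volume.restrict (timeInterval T))
    (A := fun n => flux R Λ (u n))
    (fun n => reg.measurable_flux (hU.smooth n) (hK₁ n))
    (fun n => reg.abs_flux_le (hU.smooth n) (hK₁ n)) i2
    (fun t => reg.tendsto_flux hU.smooth hL hK₁ t)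
  refine tendsto_nhds_unique (t1.add t2) ?_
  refine tendsto_const_nhds.congr fun n => ?_
  rw [← split (u n) (hU.smooth n) (hK₀ n) (hK₁ n)]
  have := weq.mass (u n) (hU.smooth n) (huc n) χ hχ
  rw [hz, mul_zero, add_zero] at this
  exact this.symm

/-- The same limit for the momentum equation, where the cut-off test is differentiated up to four
times; this is why uniform bounds on all derivatives are carried along. -/
lemma WeakEquations.momentum_bdd (weq : WeakEquations γ T ρ₀ R G Λ)
    (reg : RegularFields γ M S R G Λ) (hγ : 1 < γ) (hφ : UnifSmooth fun _ => φ) {χ : ℝ → ℝ}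
    (hχ : IsTimeTest T χ) (hχT : tsupport χ ⊆ timeInterval T) :
    ∫ t in timeInterval T, (flux R Λ φ t * deriv χ t + stress γ R G Λ φ t * χ t) = 0 := by
  set u : ℕ → E d → ℝ := fun n x => cutoff d n x * φ x with hu
  have hU : UnifSmooth u := unifSmooth_cutoff_mul hφ
  have hL : LocallyEventuallyEq u φ := locallyEventuallyEq_cutoff φ
  have huc : ∀ n, HasCompactSupport (u n) := fun n => (cutoff_compact d n).mul_right
  obtain ⟨K₁, hK₁⟩ := hU.exists_bound_dv
  obtain ⟨K₂, hK₂, hK₄⟩ := hU.exists_bound_dv_dv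
  have hφ1 : ∀ i x, |dv i φ x| ≤ K₁ := fun i x =>
    le_of_tendsto ((hL.dv i).tendsto x).abs (Filter.Eventually.of_forall fun n => hK₁ n i x)
  have hφ2 : ∀ i j x, |dv j (dv i φ) x| ≤ K₂ := fun i j x =>
    le_of_tendsto (((hL.dv i).dv j).tendsto x).abs
      (Filter.Eventually.of_forall fun n => hK₂ n i j x)
  have hφ4 : ∀ x, |lap (lap φ) x| ≤ K₂ := fun x =>
    le_of_tendsto (hL.lap.lap.tendsto x).abs (Filter.Eventually.of_forall fun n => hK₄ n x)
  have hd : Continuous (deriv χ) := hχ.smooth.continuous_deriv (by simp)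
  have i1 : IntegrableOn (deriv χ) (timeInterval T) :=
    (hd.integrable_of_hasCompactSupport hχ.compact.deriv).integrableOn
  have i2 : IntegrableOn χ (timeInterval T) :=
    (hχ.smooth.continuous.integrable_of_hasCompactSupport hχ.compact).integrableOn
  have hz : χ 0 = 0 := image_eq_zero_of_notMem_tsupport fun h => lt_irrefl _ (hχT h).1
  have split : ∀ ψ : E d → ℝ, ContDiff ℝ ∞ ψ → (∀ i x, |dv i ψ x| ≤ K₁) →
      (∀ i j x, |dv j (dv i ψ) x| ≤ K₂) → (∀ x, |lap (lap ψ) x| ≤ K₂) →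
      ∫ t in timeInterval T, (flux R Λ ψ t * deriv χ t + stress γ R G Λ ψ t * χ t) =
      (∫ t in timeInterval T, flux R Λ ψ t * deriv χ t) +
        ∫ t in timeInterval T, stress γ R G Λ ψ t * χ t := fun ψ hψ h1 h2 h4 => by
    refine integral_add ?_ ?_
    · exact i1.bdd_mul (reg.measurable_flux hψ h1).aestronglyMeasurable
        (Filter.Eventually.of_forall (reg.abs_flux_le hψ h1))
    · exact i2.bdd_mul (reg.measurable_stress hγ hψ h2 h4).aestronglyMeasurable
        (Filter.Eventually.of_forall (reg.abs_stress_le hγ hψ h2 h4))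
  rw [split φ (hφ.smooth 0) hφ1 hφ2 hφ4]
  have t1 := tendsto_integral_mul_of_bdd (μ := volume.restrict (timeInterval T))
    (A := fun n => flux R Λ (u n))
    (fun n => reg.measurable_flux (hU.smooth n) (hK₁ n))
    (fun n => reg.abs_flux_le (hU.smooth n) (hK₁ n)) i1
    (fun t => reg.tendsto_flux hU.smooth hL hK₁ t)
  have t2 := tendsto_integral_mul_of_bdd (μ := volume.restrict (timeInterval T))
    (A := fun n => stress γ R G Λ (u n))
    (fun n => reg.measurable_stress hγ (hU.smooth n) (hK₂ n) (hK₄ n))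
    (fun n => reg.abs_stress_le hγ (hU.smooth n) (hK₂ n) (hK₄ n)) i2
    (fun t => reg.tendsto_stress hγ hU.smooth hL hK₂ hK₄ t)
  refine tendsto_nhds_unique (t1.add t2) ?_
  refine tendsto_const_nhds.congr fun n => ?_
  rw [← split (u n) (hU.smooth n) (hK₁ n) (hK₂ n) (hK₄ n)]
  obtain ⟨j₀, hj⟩ := weq.momentum (u n) (hU.smooth n) (huc n)
  have := hj χ hχ
  rw [hz, mul_zero, add_zero] at this
  exact this.symm

end BoundedTests

/-! ### Moments along a direction -/

/-- A smoothing kernel `g` together with an odd-type primitive `S` of `2 g`. -/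
structure IsKernel (g S : ℝ → ℝ) : Prop where
  smooth : ContDiff ℝ ∞ g
  compact : HasCompactSupport g
  nonneg : ∀ r, 0 ≤ g r
  integral_eq : ∫ r, g r = 1
  hasDerivAt : ∀ r, HasDerivAt S (2 * g r) r
  abs_le : ∀ r, |S r| ≤ 1

lemma inner_eq_sum {d : ℕ} (θ v : E d) : inner ℝ θ v = ∑ i, θ i * v i := by
  rw [PiLp.inner_apply]
  exact Finset.sum_congr rfl fun i _ => by simp [mul_comm]

lemma sum_sq_eq_one {d : ℕ} {θ : E d} (hθ : ‖θ‖ = 1) : ∑ i, θ i * θ i = 1 := by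
  rw [← inner_eq_sum, real_inner_self_eq_norm_sq, hθ, one_pow]

lemma planar_add {d : ℕ} {θ : E d} {a b : E d → ℝ} {k : ℝ → ℝ} {C : ℝ} (ha : Integrable a)
    (hb : Integrable b) (hk : Continuous k) (hC : ∀ r, |k r| ≤ C) (s : ℝ) :
    planar θ (fun x => a x + b x) k s = planar θ a k s + planar θ b k s := by
  unfold planar
  rw [← integral_add (integrable_planar_integrand ha hk hC s)
    (integrable_planar_integrand hb hk hC s)]
  simp only [add_mul]

/-! ### Derivatives of plane waves. -/

section PlaneWave

variable {d : ℕ} {θ : E d} {k k' k'' : ℝ → ℝ}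

lemma dv_planeWave (hk : ∀ r, HasDerivAt k (k' r) r) (c s : ℝ) (i : Fin d) :
    dv i (fun x : E d => c * k (s - inner ℝ θ x)) =
      fun x => -(c * θ i) * k' (s - inner ℝ θ x) := by
  funext x
  have h1 : HasFDerivAt (fun x : E d => s - inner ℝ θ x) (-(innerSL ℝ θ)) x :=
    ((innerSL ℝ θ).hasFDerivAt).const_sub s
  have h2 := ((hk (s - inner ℝ θ x)).comp_hasFDerivAt x h1).const_mul c
  rw [dv]
  have h3 : HasFDerivAt (fun x : E d => c * k (s - inner ℝ θ x))
    (c • k' (s - inner ℝ θ x) • -(innerSL ℝ θ)) x := h2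
  rw [h3.fderiv]
  have h4 : inner ℝ θ (e i) = θ i := by rw [real_inner_comm, inner_e]
  simp [h4]
  ring

lemma lap_planeWave (hθ : ‖θ‖ = 1) (hk : ∀ r, HasDerivAt k (k' r) r)
    (hk' : ∀ r, HasDerivAt k' (k'' r) r) (c s : ℝ) :
    lap (fun x : E d => c * k (s - inner ℝ θ x)) = fun x => c * k'' (s - inner ℝ θ x) := by
  funext x
  simp only [lap, dv_planeWave hk, dv_planeWave hk']
  have : ∀ i : Fin d, -(-(c * θ i) * θ i) * k'' (s - inner ℝ θ x) =
      (θ i * θ i) * (c * k'' (s - inner ℝ θ x)) := fun i => by ring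
  simp only [this]
  rw [← Finset.sum_mul, sum_sq_eq_one hθ, one_mul]

end PlaneWave

section Kernel

variable {g S : ℝ → ℝ}

lemma contDiff_deriv {g : ℝ → ℝ} (h : ContDiff ℝ ∞ g) : ContDiff ℝ ∞ (deriv g) :=
  (contDiff_infty_iff_deriv.1 h).2

lemma hasDerivAt_of_smooth {g : ℝ → ℝ} (h : ContDiff ℝ ∞ g) (r : ℝ) :
    HasDerivAt g (deriv g r) r := ((h.differentiable (by simp)) r).hasDerivAt

lemma bdd_of_smooth_compact {g : ℝ → ℝ} (h : ContDiff ℝ ∞ g) (hc : HasCompactSupport g) :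
    ∃ C, ∀ r, |g r| ≤ C := h.continuous.bounded_above_of_compact_support hc

lemma IsKernel.smooth_S (h : IsKernel g S) : ContDiff ℝ ∞ S := by
  rw [contDiff_infty_iff_deriv]
  refine ⟨fun r => (h.hasDerivAt r).differentiableAt, ?_⟩
  rw [show deriv S = fun r => 2 * g r from funext fun r => (h.hasDerivAt r).deriv]
  exact contDiff_const.mul h.smooth

/-- Fits step-like profiles, which are bounded without compact support while their first derivative
is compactly supported. -/
lemma iteratedFDeriv_bdd {h : ℝ → ℝ} (hh : ContDiff ℝ ∞ h) {C : ℝ} (hC : ∀ r, |h r| ≤ C)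
    (hd : HasCompactSupport (deriv h)) (k : ℕ) : ∃ C, ∀ r, ‖iteratedFDeriv ℝ k h r‖ ≤ C := by
  cases k with
  | zero => exact ⟨C, fun r => by simpa using hC r⟩
  | succ k =>
    have h1 : ContDiff ℝ ∞ (fderiv ℝ h) := hh.fderiv_right (m := ∞) (by simp)
    have h2 : HasCompactSupport (fderiv ℝ h) := by
      refine hd.mono fun r hr => ?_
      rw [Function.mem_support] at hr ⊢
      intro h0
      refine hr ?_
      ext
      simpa using h0
    obtain ⟨D, hD⟩ := (h1.continuous_iteratedFDeriv (m := k)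
      (by exact_mod_cast le_top)).bounded_above_of_compact_support (h2.iteratedFDeriv (𝕜 := ℝ) k)
    exact ⟨D, fun r => by rw [← norm_iteratedFDeriv_fderiv]; exact hD r⟩

lemma IsKernel.unifSmooth {d : ℕ} (h : IsKernel g S) (θ : E d) (s : ℝ) :
    UnifSmooth fun _ (x : E d) => S (s - inner ℝ θ x) := by
  have hs : ContDiff ℝ ∞ fun r => S (s - r) := h.smooth_S.comp (contDiff_const.sub contDiff_id)
  refine unifSmooth_planar (h := fun r => S (s - r)) hs
    (iteratedFDeriv_bdd hs (fun r => h.abs_le _) ?_) θ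
  have e1 : deriv (fun r => S (s - r)) = fun r => -(2 * g (s - r)) := funext fun r =>
    ((h.hasDerivAt (s - r)).comp_const_sub s r).deriv
  rw [e1]
  have h2 : HasCompactSupport fun r => g (s - r) := h.compact.comp_homeomorph (Homeomorph.subLeft s)
  exact (h2.mul_left (f := fun _ => (2 : ℝ))).neg

end Kernel

/-- The normal stress along `θ`. -/
def normalStress {d : ℕ} (γ : ℝ) (R : ℝ → E d → ℝ) (G Λ : ℝ → E d → E d) (θ : E d) (t : ℝ)
    (x : E d) : ℝ :=
  inner ℝ θ (Λ t x) ^ 2 + inner ℝ θ (G t x) ^ 2 + pressure γ (rho R t x)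

/-- The momentum along `θ`. -/
def normalMom {d : ℕ} (R : ℝ → E d → ℝ) (Λ : ℝ → E d → E d) (θ : E d) (t : ℝ) (x : E d) : ℝ :=
  R t x * inner ℝ θ (Λ t x)

section Moments

variable {d : ℕ} {γ M S₀ : ℝ} {R : ℝ → E d → ℝ} {G Λ : ℝ → E d → E d} {θ : E d}
  {g S : ℝ → ℝ}

lemma RegularFields.density_normalMom (reg : RegularFields γ M S₀ R G Λ) (hθ : ‖θ‖ = 1) :
    IsDensity (normalMom R Λ θ) (M ^ 2) := reg.density_mom hθ.le

lemma RegularFields.density_normalStress (reg : RegularFields γ M S₀ R G Λ) (hγ : 1 < γ)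
    (hθ : ‖θ‖ = 1) :
    IsDensity (normalStress γ R G Λ θ) (M ^ 2 + M ^ 2 + (γ - 1) / γ * S₀) := by
  have := ((reg.density_ΛΛ hθ.le hθ.le).add (reg.density_GG hθ.le hθ.le)).add
    (reg.density_pressure hγ)
  simp only [← sq] at this
  exact this

/-- The gradient of the plane step is `-2 g(s - θ·x) θ`, so only the component of the momentum along
`θ` enters. -/
lemma RegularFields.flux_planeWave (reg : RegularFields γ M S₀ R G Λ) (ker : IsKernel g S)
    (s t : ℝ) :
    flux R Λ (fun x => S (s - inner ℝ θ x)) t = -(2 * planar θ (normalMom R Λ θ t) g s) := by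
  obtain ⟨C, hC⟩ := bdd_of_smooth_compact ker.smooth ker.compact
  have hd : ∀ i, dv i (fun x : E d => S (s - inner ℝ θ x)) =
      fun x => -(2 * θ i) * g (s - inner ℝ θ x) := fun i => by
    have := dv_planeWave (θ := θ) ker.hasDerivAt 1 s i
    simp only [one_mul] at this
    rw [this]
    funext x
    ring
  have hi : ∀ i ∈ Finset.univ, Integrable fun x =>
      R t x * Λ t x i * (-(2 * θ i) * g (s - inner ℝ θ x)) := fun i _ => by
    have := (integrable_planar_integrand (θ := θ) ((reg.density_mom_coord i).int t)
      ker.smooth.continuous hC s).const_mul (-(2 * θ i))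
    refine this.congr (Filter.Eventually.of_forall fun x => ?_)
    simp only
    ring
  unfold flux
  simp only [hd, pair]
  rw [← integral_finsetSum _ hi, planar, ← integral_const_mul, ← integral_neg]
  refine integral_congr_ae (Filter.Eventually.of_forall fun x => ?_)
  simp only [normalMom, inner_eq_sum θ (Λ t x), Finset.mul_sum, Finset.sum_mul,
    ← Finset.sum_neg_distrib]
  exact Finset.sum_congr rfl fun i _ => by ring

/-- The Hessian of the plane step is `2 g' θ ⊗ θ` with trace `2 g'` since `|θ| = 1`, and its
bilaplacian is `2 g'''`; the stress collapses to its normal component. -/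
lemma RegularFields.stress_planeWave (reg : RegularFields γ M S₀ R G Λ) (hγ : 1 < γ)
    (hθ : ‖θ‖ = 1) (ker : IsKernel g S) (s t : ℝ) :
    stress γ R G Λ (fun x => S (s - inner ℝ θ x)) t =
      2 * planar θ (normalStress γ R G Λ θ t) (deriv g) s
        - 1 / 2 * planar θ (rho R t) (deriv (deriv (deriv g))) s := by
  have s1 := contDiff_deriv ker.smooth
  have s2 := contDiff_deriv s1
  have s3 := contDiff_deriv s2
  obtain ⟨C, hC⟩ := bdd_of_smooth_compact s1 ker.compact.deriv
  have hd : ∀ i, dv i (fun x : E d => S (s - inner ℝ θ x)) =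
      fun x => -(2 * θ i) * g (s - inner ℝ θ x) := fun i => by
    have := dv_planeWave (θ := θ) ker.hasDerivAt 1 s i
    simp only [one_mul] at this
    rw [this]
    funext x
    ring
  have hS2 : ∀ r, HasDerivAt (fun r => 2 * g r) (2 * deriv g r) r := fun r =>
    (hasDerivAt_of_smooth ker.smooth r).const_mul 2
  have hl : lap (fun x : E d => S (s - inner ℝ θ x)) =
      fun x => 2 * deriv g (s - inner ℝ θ x) := by
    have := lap_planeWave hθ ker.hasDerivAt hS2 1 s
    simp only [one_mul] at this
    exact this
  have hll : lap (lap (fun x : E d => S (s - inner ℝ θ x))) =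
      fun x => 2 * deriv (deriv (deriv g)) (s - inner ℝ θ x) := by
    rw [hl]
    exact lap_planeWave hθ (hasDerivAt_of_smooth s1) (hasDerivAt_of_smooth s2) 2 s
  have hdd : ∀ i j, dv j (dv i (fun x : E d => S (s - inner ℝ θ x))) =
      fun x => 2 * θ i * θ j * deriv g (s - inner ℝ θ x) := fun i j => by
    rw [hd, dv_planeWave (hasDerivAt_of_smooth ker.smooth)]
    funext x
    ring
  have hI : ∀ {a : E d → ℝ}, Integrable a → ∀ c : ℝ,
      Integrable fun x => a x * (c * deriv g (s - inner ℝ θ x)) := fun ha c => by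
    refine ((integrable_planar_integrand (θ := θ) ha s1.continuous hC s).const_mul c).congr
      (Filter.Eventually.of_forall fun x => ?_)
    simp only
    ring
  have e1 : ∀ V : ℝ → E d → E d, (∀ i j : Fin d, Integrable fun x => V t x i * V t x j) →
      ∑ i, ∑ j, pair (fun t x => V t x i * V t x j)
        (fun x => 2 * θ i * θ j * deriv g (s - inner ℝ θ x)) t =
      2 * planar θ (fun x => inner ℝ θ (V t x) ^ 2) (deriv g) s := fun V hV => by
    simp only [pair]
    have h1 : ∀ i ∈ Finset.univ, ∑ j, ∫ x, V t x i * V t x j *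
        (2 * θ i * θ j * deriv g (s - inner ℝ θ x)) = ∫ x, ∑ j, V t x i * V t x j *
        (2 * θ i * θ j * deriv g (s - inner ℝ θ x)) := fun i _ =>
      (integral_finsetSum _ fun j _ => hI (hV i j) _).symm
    rw [Finset.sum_congr rfl h1, ← integral_finsetSum _ fun i _ =>
      integrable_finsetSum _ fun j _ => hI (hV i j) _, planar, ← integral_const_mul]
    refine integral_congr_ae (Filter.Eventually.of_forall fun x => ?_)
    simp only [inner_eq_sum θ (V t x), sq, Finset.sum_mul, Finset.mul_sum]
    refine Finset.sum_congr rfl fun i _ => Finset.sum_congr rfl fun j _ => by ring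
  have hΛ : ∀ i j : Fin d, Integrable fun x => Λ t x i * Λ t x j := fun i j =>
    (reg.density_ΛΛ_coord i j).int t
  have hG : ∀ i j : Fin d, Integrable fun x => G t x i * G t x j := fun i j =>
    (reg.density_GG_coord i j).int t
  unfold stress
  simp only [Finset.sum_add_distrib, hdd, hll]
  rw [hl, e1 Λ hΛ, e1 G hG]
  have e2 : pair (fun t x => pressure γ (rho R t x)) (fun x => 2 * deriv g (s - inner ℝ θ x)) t
      = 2 * planar θ (fun x => pressure γ (rho R t x)) (deriv g) s := by
    rw [pair, planar, ← integral_const_mul]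
    exact integral_congr_ae (Filter.Eventually.of_forall fun x => by simp only; ring)
  have e3 : pair (rho R) (fun x => 2 * deriv (deriv (deriv g)) (s - inner ℝ θ x)) t
      = 2 * planar θ (rho R t) (deriv (deriv (deriv g))) s := by
    rw [pair, planar, ← integral_const_mul]
    exact integral_congr_ae (Filter.Eventually.of_forall fun x => by simp only; ring)
  have iΛ := integrable_sq_inner reg.meas_Λ reg.int_Λ hθ.le t
  have iG := integrable_sq_inner reg.meas_G reg.int_G hθ.le t
  have ip := (reg.density_pressure hγ).int t
  have e4 : planar θ (normalStress γ R G Λ θ t) (deriv g) s =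
      planar θ (fun x => inner ℝ θ (Λ t x) ^ 2) (deriv g) s +
      planar θ (fun x => inner ℝ θ (G t x) ^ 2) (deriv g) s +
      planar θ (fun x => pressure γ (rho R t x)) (deriv g) s := by
    have h12 : Integrable fun x => inner ℝ θ (Λ t x) ^ 2 + inner ℝ θ (G t x) ^ 2 := iΛ.add iG
    rw [← planar_add iΛ iG s1.continuous hC, ← planar_add h12 ip s1.continuous hC]
    rfl
  rw [e2, e3, e4]
  ring

end Moments

/-! ### The interaction Morawetz estimate along a direction -/

section PlanarDensity

variable {d : ℕ} {f : ℝ → E d → ℝ} {C K : ℝ} {θ : E d} {k : ℝ → ℝ}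

lemma IsDensity.measurable_planar (hf : IsDensity f C) (hk : Continuous k) :
    Measurable fun z : ℝ × ℝ => planar θ (f z.1) k z.2 := by
  have h : StronglyMeasurable fun w : (ℝ × ℝ) × E d =>
      f w.1.1 w.2 * k (w.1.2 - inner ℝ θ w.2) := by
    refine Measurable.stronglyMeasurable ?_
    refine (hf.meas.comp (measurable_fst.fst.prodMk measurable_snd)).mul ?_
    exact hk.measurable.comp (measurable_fst.snd.sub (measurable_const.inner measurable_snd))
  exact h.integral_prod_right.measurable

lemma IsDensity.abs_planar_le (hf : IsDensity f C) (hK : ∀ r, |k r| ≤ K) (t s : ℝ) :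
    |planar θ (f t) k s| ≤ K * C :=
  (QHD.abs_planar_le (hf.int t) hK s).trans
    (mul_le_mul_of_nonneg_left (hf.le t) ((abs_nonneg _).trans (hK 0)))

lemma IsDensity.planar (hf : IsDensity f C) (hk : Continuous k) (hki : Integrable k) :
    IsDensity (fun t s => planar θ (f t) k s) (C * ∫ r, |k r|) where
  meas := hf.measurable_planar hk
  int t := integrable_planar (hf.int t) hk hki
  le t := (integral_abs_planar_le (hf.int t) hk hki).trans
    (mul_le_mul_of_nonneg_right (hf.le t) (integral_nonneg fun _ => abs_nonneg _))

lemma IsDensity.integral_swap {X : Type*} [MeasureSpace X] [SFinite (volume : Measure X)]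
    {f : ℝ → X → ℝ} (hf : IsDensity f C) {μ : Measure ℝ} [SFinite μ] (hk : Integrable k μ) :
    ∫ s, ∫ t, f t s * k t ∂μ = ∫ t, (∫ s, f t s) * k t ∂μ := by
  rw [← integral_integral_swap (f := fun t s => f t s * k t) (hf.integrable_prod hk)]
  simp only [integral_mul_const]

end PlanarDensity

lemma integrable_of_smooth_compact {g : ℝ → ℝ} (h : ContDiff ℝ ∞ g) (hc : HasCompactSupport g) :
    Integrable g := h.continuous.integrable_of_hasCompactSupport hc

/-- If a family of functions of time has weak derivatives, so does its integral. -/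
lemma exists_isPrimitive_integral {T : EReal} (hT : 0 < T) {A B : ℝ → ℝ → ℝ} {C C' : ℝ}
    (hA : IsDensity A C) (hB : IsDensity B C')
    (h : ∀ s, ∀ χ, IsTimeTest T χ → tsupport χ ⊆ timeInterval T →
      ∫ t in timeInterval T, (A t s * deriv χ t + B t s * χ t) = 0) :
    ∃ c, IsPrimitive T (fun t => ∫ s, A t s) (fun t => ∫ s, B t s) c := by
  refine exists_isPrimitive_of_weak hT
    (locallyIntegrable_of_bdd hA.measurable_integral hA.abs_integral_le)
    (locallyIntegrable_of_bdd hB.measurable_integral hB.abs_integral_le) fun χ hχ hχT => ?_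
  have i1 : Integrable χ (volume.restrict (timeInterval T)) :=
    (integrable_of_smooth_compact hχ.smooth hχ.compact).restrict
  have i2 : Integrable (deriv χ) (volume.restrict (timeInterval T)) :=
    (integrable_of_smooth_compact (contDiff_deriv hχ.smooth) hχ.compact.deriv).restrict
  have pA := hA.integrable_prod i2
  have pB := hB.integrable_prod i1
  have qA : Integrable (fun t => (∫ s, A t s) * deriv χ t)
      (volume.restrict (timeInterval T)) := by
    refine i2.bdd_mul hA.measurable_integral.aestronglyMeasurable
      (Filter.Eventually.of_forall hA.abs_integral_le)
  have qB : Integrable (fun t => (∫ s, B t s) * χ t) (volume.restrict (timeInterval T)) :=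
    i1.bdd_mul hB.measurable_integral.aestronglyMeasurable
      (Filter.Eventually.of_forall hB.abs_integral_le)
  rw [integral_add qA qB, ← hA.integral_swap i2, ← hB.integral_swap i1,
    ← integral_add pA.integral_prod_right pB.integral_prod_right]
  have h0 : ∀ᵐ s, (∫ t in timeInterval T, A t s * deriv χ t)
      + (∫ t in timeInterval T, B t s * χ t) = 0 := by
    filter_upwards [pA.prod_left_ae, pB.prod_left_ae] with s h1 h2
    rw [← integral_add h1 h2]
    exact h s χ hχ hχT
  rw [integral_congr_ae h0, integral_zero]

section Morawetz

variable {d : ℕ} {γ M S₀ : ℝ} {T : EReal} {ρ₀ : E d → ℝ} {R : ℝ → E d → ℝ} {G Λ : ℝ → E d → E d}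
  {θ : E d} {g S : ℝ → ℝ}

/-- The interaction functional along `θ`. -/
def interaction (R : ℝ → E d → ℝ) (Λ : ℝ → E d → E d) (θ : E d) (g S : ℝ → ℝ) (t s : ℝ) : ℝ :=
  planar θ (rho R t) S s * (-2 * planar θ (normalMom R Λ θ t) g s)

/-- The time derivative of the interaction functional. -/
def interactionRate (γ : ℝ) (R : ℝ → E d → ℝ) (G Λ : ℝ → E d → E d) (θ : E d) (g S : ℝ → ℝ)
    (t s : ℝ) : ℝ :=
  (-2 * planar θ (normalMom R Λ θ t) g s) * (-2 * planar θ (normalMom R Λ θ t) g s)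
    + planar θ (rho R t) S s * (2 * planar θ (normalStress γ R G Λ θ t) (deriv g) s
      + -(1 / 2) * planar θ (rho R t) (deriv (deriv (deriv g))) s)

lemma IsKernel.integral_abs (ker : IsKernel g S) : ∫ r, |g r| = 1 := by
  rw [← ker.integral_eq]
  exact integral_congr_ae (Filter.Eventually.of_forall fun r => abs_of_nonneg (ker.nonneg r))

/-- One factor is bounded by `M ^ 2` because `|S| ≤ 1`, the other has `L¹` norm at most `2 * M ^ 2`
because `g` has mass one. The bound is therefore independent of the kernel, which permits the later
limit. -/
lemma RegularFields.density_interaction (reg : RegularFields γ M S₀ R G Λ) (ker : IsKernel g S)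
    (hθ : ‖θ‖ = 1) : IsDensity (interaction R Λ θ g S) (2 * M ^ 4) := by
  have h1 := ((reg.density_normalMom hθ).planar (θ := θ) ker.smooth.continuous
    (integrable_of_smooth_compact ker.smooth ker.compact)).const_mul (-2)
  have h2 := h1.bdd_mul (reg.density_rho.measurable_planar (θ := θ) ker.smooth_S.continuous)
    (by positivity) (reg.density_rho.abs_planar_le ker.abs_le)
  rw [ker.integral_abs] at h2
  have e1 : 1 * M ^ 2 * (|(-2 : ℝ)| * (M ^ 2 * 1)) = 2 * M ^ 4 := by norm_num; ring
  rw [e1] at h2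
  exact h2

/-- Purely qualitative: this bound depends on the kernel and on `S₀`, but serves only to justify
Fubini and the use of primitives. -/
lemma RegularFields.exists_density_interactionRate (reg : RegularFields γ M S₀ R G Λ)
    (hγ : 1 < γ) (ker : IsKernel g S) (hθ : ‖θ‖ = 1) :
    ∃ C, IsDensity (interactionRate γ R G Λ θ g S) C := by
  have s1 := contDiff_deriv ker.smooth
  have s3 := contDiff_deriv (contDiff_deriv s1)
  have c1 := ker.compact.deriv
  have c3 := c1.deriv.deriv
  obtain ⟨K, hK⟩ := bdd_of_smooth_compact ker.smooth ker.compact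
  have hJ := reg.density_normalMom hθ
  have hJp := (hJ.planar (θ := θ) ker.smooth.continuous
    (integrable_of_smooth_compact ker.smooth ker.compact)).const_mul (-2)
  have hb : ∀ t s, |-2 * planar θ (normalMom R Λ θ t) g s| ≤ 2 * (K * M ^ 2) := fun t s => by
    rw [abs_mul]
    norm_num
    exact hJ.abs_planar_le hK t s
  have h1 := hJp.bdd_mul hJp.meas ((abs_nonneg _).trans (hb 0 0)) hb
  have h2 := ((reg.density_normalStress hγ hθ).planar (θ := θ) s1.continuous
    (integrable_of_smooth_compact s1 c1)).const_mul 2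
  have h3 := (reg.density_rho.planar (θ := θ) s3.continuous
    (integrable_of_smooth_compact s3 c3)).const_mul (-(1 / 2))
  have h4 := (h2.add h3).bdd_mul
    (reg.density_rho.measurable_planar (θ := θ) ker.smooth_S.continuous)
    (by positivity) (reg.density_rho.abs_planar_le ker.abs_le)
  exact ⟨_, h1.add h4⟩

/-- For fixed `s` the product rule applies to the moment of the plane step and its flux: the first
equation differentiates the moment into the flux, the second differentiates the flux into the
stress. -/
lemma WeakEquations.weak_interaction (weq : WeakEquations γ T ρ₀ R G Λ) (hT : 0 < T)
    (reg : RegularFields γ M S₀ R G Λ) (hγ : 1 < γ) (ker : IsKernel g S) (hθ : ‖θ‖ = 1) (s : ℝ)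
    {χ : ℝ → ℝ} (hχ : IsTimeTest T χ) (hχT : tsupport χ ⊆ timeInterval T) :
    ∫ t in timeInterval T, (interaction R Λ θ g S t s * deriv χ t
      + interactionRate γ R G Λ θ g S t s * χ t) = 0 := by
  have hu := ker.unifSmooth θ s
  have hφ : ContDiff ℝ ∞ fun x : E d => S (s - inner ℝ θ x) := hu.smooth 0
  obtain ⟨K, hK⟩ := hu.exists_bound_dv
  obtain ⟨K', hK', hK''⟩ := hu.exists_bound_dv_dv
  have lF : LocallyIntegrable (flux R Λ fun x => S (s - inner ℝ θ x)) :=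
    locallyIntegrable_of_bdd (reg.measurable_flux hφ (hK 0)) (reg.abs_flux_le hφ (hK 0))
  have lX : LocallyIntegrable (stress γ R G Λ fun x => S (s - inner ℝ θ x)) :=
    locallyIntegrable_of_bdd (reg.measurable_stress hγ hφ (hK' 0) (hK'' 0))
      (reg.abs_stress_le hγ hφ (hK' 0) (hK'' 0))
  have hSb : ∀ x : E d, |S (s - inner ℝ θ x)| ≤ 1 := fun x => ker.abs_le _
  have lN : LocallyIntegrable (pair (rho R) fun x => S (s - inner ℝ θ x)) :=
    locallyIntegrable_of_bdd (reg.density_rho.measurable_pair hφ.continuous hSb)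
      (reg.density_rho.abs_pair_le hφ.continuous hSb)
  obtain ⟨c, hc⟩ := exists_isPrimitive_of_weak hT lN lF fun χ hχ hχT =>
    weq.mass_bdd reg hu hχ hχT
  obtain ⟨c', hc'⟩ := exists_isPrimitive_of_weak hT lF lX fun χ hχ hχT =>
    weq.momentum_bdd reg hγ hu hχ hχT
  have hm := hc.mul hc' lF lX
  have hbN := reg.density_rho.abs_pair_le hφ.continuous hSb
  have hl : LocallyIntegrable fun t => flux R Λ (fun x => S (s - inner ℝ θ x)) t *
      flux R Λ (fun x => S (s - inner ℝ θ x)) t + pair (rho R) (fun x => S (s - inner ℝ θ x)) t *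
      stress γ R G Λ (fun x => S (s - inner ℝ θ x)) t := by
    have mF := reg.measurable_flux hφ (hK 0)
    refine locallyIntegrable_of_bdd ((mF.mul mF).add
      ((reg.density_rho.measurable_pair hφ.continuous hSb).mul
      (reg.measurable_stress hγ hφ (hK' 0) (hK'' 0))))
      (C := (d * (M ^ 2 * K)) * (d * (M ^ 2 * K)) + (M ^ 2 * 1) * stressConst d γ M S₀ K')
      fun t => ?_
    have b1 := reg.abs_flux_le hφ (hK 0) t
    have b2 := reg.abs_stress_le hγ hφ (hK' 0) (hK'' 0) t
    refine (abs_add_le _ _).trans (add_le_add ?_ ?_)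
    · rw [abs_mul]
      exact mul_le_mul b1 b1 (abs_nonneg _) ((abs_nonneg _).trans b1)
    · rw [abs_mul]
      exact mul_le_mul (hbN t) b2 (abs_nonneg _) ((abs_nonneg _).trans (hbN t))
  have hw := hm.weak hT hl hχ
  have h0 : χ 0 = 0 := by
    by_contra h
    exact lt_irrefl _ (hχT (subset_tsupport _ h)).1
  rw [h0, mul_zero, neg_zero] at hw
  rw [← hw]
  congr 1
  funext t
  rw [reg.flux_planeWave ker s t, reg.stress_planeWave hγ hθ ker s t]
  simp only [interaction, interactionRate, pair, planar]
  ring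

lemma sqrtRhoP_eq (γ : ℝ) (R : ℝ → E d → ℝ) (t : ℝ) (x : E d) :
    sqrtRhoP γ R t x = |R t x| * Real.sqrt (pressure γ (rho R t x)) := by
  rw [sqrtRhoP, Real.sqrt_mul (rho_nonneg R t x), rho, Real.sqrt_sq_eq_abs]

lemma pressure_nonneg (hγ : 1 < γ) (R : ℝ → E d → ℝ) (t : ℝ) (x : E d) :
    0 ≤ pressure γ (rho R t x) :=
  mul_nonneg (div_nonneg (by linarith) (by linarith)) (Real.rpow_nonneg (rho_nonneg R t x) _)

lemma RegularFields.density_sqrtRhoP (reg : RegularFields γ M S₀ R G Λ) (hγ : 1 < γ) :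
    ∃ C, IsDensity (sqrtRhoP γ R) C := by
  have hp := reg.density_pressure hγ
  have hr := reg.density_rho
  have e1 : sqrtRhoP γ R = fun t x => |R t x| * Real.sqrt (pressure γ (rho R t x)) :=
    funext fun t => funext fun x => sqrtRhoP_eq γ R t x
  refine ⟨max (M ^ 2) ((γ - 1) / γ * S₀), ?_⟩
  rw [e1]
  have e2 : ∀ t x, Real.sqrt (pressure γ (rho R t x)) ^ 2 = pressure γ (rho R t x) :=
    fun t x => Real.sq_sqrt (pressure_nonneg hγ R t x)
  refine IsDensity.of_sq (f := fun t x => |R t x|)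
    (g := fun t x => Real.sqrt (pressure γ (rho R t x))) ?_ hp.meas.sqrt ?_ ?_ ?_ ?_
  · exact reg.meas_R.abs
  · simpa only [sq_abs] using reg.int_R
  · simpa only [e2] using hp.int
  · simpa only [sq_abs] using fun t => (reg.le_R t).trans (le_max_left _ _)
  · intro t
    simp only [e2]
    exact ((le_abs_self _).trans (hp.abs_integral_le t)).trans (le_max_right _ _)

/-- The positive terms of the interaction Morawetz identity. -/
def morawetz (γ : ℝ) (R : ℝ → E d → ℝ) (θ : E d) (g : ℝ → ℝ) (t : ℝ) : ℝ :=
  (∫ s, planar θ (rho R t) (deriv g) s ^ 2) + 4 * ∫ s, planar θ (sqrtRhoP γ R t) g s ^ 2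

lemma IsDensity.integrable_planar_mul {f f' : ℝ → E d → ℝ} {C C' K : ℝ} {k k' : ℝ → ℝ}
    (hf : IsDensity f C) (hf' : IsDensity f' C') (hk : Continuous k) (hK : ∀ r, |k r| ≤ K)
    (hk' : Continuous k') (hki' : Integrable k') (t : ℝ) :
    Integrable fun s => QHD.planar θ (f t) k s * QHD.planar θ (f' t) k' s :=
  (integrable_planar (hf'.int t) hk' hki').bdd_mul
    (continuous_planar (hf.int t) hk hK).aestronglyMeasurable
    (Filter.Eventually.of_forall fun s => QHD.abs_planar_le (hf.int t) hK s)

lemma planar_nonneg {a : E d → ℝ} {k : ℝ → ℝ} (ha : ∀ x, 0 ≤ a x) (hk : ∀ r, 0 ≤ k r) (s : ℝ) :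
    0 ≤ planar θ a k s := integral_nonneg fun x => mul_nonneg (ha x) (hk _)

/-- Cauchy–Schwarz with weight `g` twice, for `√ρ · (θ·Λ)` and for `√ρ · √p`. The contribution of
`(θ·∇√ρ)²` to the right side is nonnegative and is dropped. -/
lemma RegularFields.sq_planar_add_le (reg : RegularFields γ M S₀ R G Λ) (hγ : 1 < γ)
    (ker : IsKernel g S) (hθ : ‖θ‖ = 1) (t s : ℝ) :
    planar θ (normalMom R Λ θ t) g s ^ 2 + planar θ (sqrtRhoP γ R t) g s ^ 2 ≤
      planar θ (rho R t) g s * planar θ (normalStress γ R G Λ θ t) g s := by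
  obtain ⟨K, hK⟩ := bdd_of_smooth_compact ker.smooth ker.compact
  have hc := ker.smooth.continuous
  obtain ⟨C, hσ⟩ := reg.density_sqrtRhoP hγ
  have iΛ := integrable_sq_inner reg.meas_Λ reg.int_Λ hθ.le t
  have iG := integrable_sq_inner reg.meas_G reg.int_G hθ.le t
  have ip := (reg.density_pressure hγ).int t
  have h1 := sq_planar_mul_le (θ := θ) (reg.int_R t) iΛ ((reg.density_normalMom hθ).int t) hc
    ker.nonneg hK s
  have e1 : sqrtRhoP γ R t = fun x => |R t x| * Real.sqrt (pressure γ (rho R t x)) :=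
    funext fun x => sqrtRhoP_eq γ R t x
  have e2 : ∀ x, Real.sqrt (pressure γ (rho R t x)) ^ 2 = pressure γ (rho R t x) :=
    fun x => Real.sq_sqrt (pressure_nonneg hγ R t x)
  have h2 := sq_planar_mul_le (θ := θ) (u := fun x => |R t x|)
    (v := fun x => Real.sqrt (pressure γ (rho R t x))) (by simpa only [sq_abs] using reg.int_R t)
    (by simpa only [e2] using ip) (by rw [← e1]; exact hσ.int t) hc ker.nonneg hK s
  simp only [sq_abs, e2] at h2
  rw [← e1] at h2
  have h12 : Integrable fun x => inner ℝ θ (Λ t x) ^ 2 + inner ℝ θ (G t x) ^ 2 := iΛ.add iG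
  have e3 : planar θ (normalStress γ R G Λ θ t) g s =
      planar θ (fun x => inner ℝ θ (Λ t x) ^ 2) g s +
      planar θ (fun x => inner ℝ θ (G t x) ^ 2) g s +
      planar θ (fun x => pressure γ (rho R t x)) g s := by
    rw [← planar_add iΛ iG hc hK, ← planar_add h12 ip hc hK]
    rfl
  have h3 : 0 ≤ planar θ (rho R t) g s * planar θ (fun x => inner ℝ θ (G t x) ^ 2) g s :=
    mul_nonneg (planar_nonneg (rho_nonneg R t) ker.nonneg s)
      (planar_nonneg (fun x => sq_nonneg _) ker.nonneg s)
  rw [e3]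
  have h1' : planar θ (normalMom R Λ θ t) g s ^ 2 ≤ planar θ (rho R t) g s *
    planar θ (fun x => inner ℝ θ (Λ t x) ^ 2) g s := h1
  have h2' : planar θ (sqrtRhoP γ R t) g s ^ 2 ≤ planar θ (rho R t) g s *
    planar θ (fun x => pressure γ (rho R t x)) g s := h2
  linarith

/-- Once the `s`-derivatives are moved off the stress, the momentum square appears with coefficient
`4` against `-4 ρ_g q_g`, and the directional Cauchy–Schwarz inequality absorbs it while leaving `4
(√(ρp))_g²`. -/
lemma RegularFields.morawetz_le (reg : RegularFields γ M S₀ R G Λ) (hγ : 1 < γ)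
    (ker : IsKernel g S) (hθ : ‖θ‖ = 1) (t : ℝ) :
    morawetz γ R θ g t ≤ -∫ s, interactionRate γ R G Λ θ g S t s := by
  have s1 := contDiff_deriv ker.smooth
  have s2 := contDiff_deriv s1
  have s3 := contDiff_deriv s2
  have c1 := ker.compact.deriv
  obtain ⟨K, hK⟩ := bdd_of_smooth_compact ker.smooth ker.compact
  obtain ⟨K1, hK1⟩ := bdd_of_smooth_compact s1 c1
  obtain ⟨K2, hK2⟩ := bdd_of_smooth_compact s2 c1.deriv
  obtain ⟨K3, hK3⟩ := bdd_of_smooth_compact s3 c1.deriv.deriv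
  have i0 := integrable_of_smooth_compact ker.smooth ker.compact
  have i1 := integrable_of_smooth_compact s1 c1
  have i2 := integrable_of_smooth_compact s2 c1.deriv
  have i3 := integrable_of_smooth_compact s3 c1.deriv.deriv
  have hc := ker.smooth.continuous
  have hr := reg.density_rho
  have hQ := reg.density_normalStress hγ hθ
  have hJ := reg.density_normalMom hθ
  obtain ⟨C, hσ⟩ := reg.density_sqrtRhoP hγ
  have iJ := hJ.integrable_planar_mul (θ := θ) hJ hc hK hc i0 t
  have iσ := hσ.integrable_planar_mul (θ := θ) hσ hc hK hc i0 t
  have iQ := hr.integrable_planar_mul (θ := θ) hQ hc hK hc i0 t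
  have iSQ := hr.integrable_planar_mul (θ := θ) hQ ker.smooth_S.continuous ker.abs_le
    s1.continuous i1 t
  have iSr := hr.integrable_planar_mul (θ := θ) hr ker.smooth_S.continuous ker.abs_le
    s3.continuous i3 t
  have h2K : ∀ r, |2 * g r| ≤ 2 * K := fun r => by
    rw [abs_mul, abs_two]
    exact mul_le_mul_of_nonneg_left (hK r) two_pos.le
  -- The step `S` differentiates to `2g`, turning the nonlocal product with `q_{g'}` into the local
  -- one `-2 ρ_g q_g`.
  have p1 := integral_planar_mul_planar (θ := θ) (hr.int t) (hQ.int t) ker.hasDerivAt ker.abs_le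
    (continuous_const.mul hc) h2K (hasDerivAt_of_smooth ker.smooth) hK i0 s1.continuous hK1 i1
  -- Together with `p3`, two integrations by parts replace `∫ ρ_S ρ_{g'''}` by `2 ∫ ρ_{g'}²`; the
  -- coefficient `-1/2` makes this a dissipation.
  have p2 := integral_planar_mul_planar (θ := θ) (hr.int t) (hr.int t) ker.hasDerivAt ker.abs_le
    (continuous_const.mul hc) h2K (hasDerivAt_of_smooth s2) hK2 i2 s3.continuous hK3 i3
  have p3 := integral_planar_mul_planar (θ := θ) (hr.int t) (hr.int t)
    (hasDerivAt_of_smooth ker.smooth) hK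
    s1.continuous hK1 (hasDerivAt_of_smooth s1) hK1 i1 s2.continuous hK2 i2
  have e2 : ∀ s, planar θ (rho R t) (fun r => 2 * g r) s = 2 * planar θ (rho R t) g s := fun s => by
    simp only [planar, ← integral_const_mul]
    congr 1
    funext x
    ring
  simp only [e2, mul_assoc, integral_const_mul] at p1 p2
  have e3 : ∫ s, interactionRate γ R G Λ θ g S t s =
      4 * (∫ s, planar θ (normalMom R Λ θ t) g s * planar θ (normalMom R Λ θ t) g s)
      + (2 * ∫ s, planar θ (rho R t) S s * planar θ (normalStress γ R G Λ θ t) (deriv g) s)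
      + (-(1 / 2)) * ∫ s, planar θ (rho R t) S s *
        planar θ (rho R t) (deriv (deriv (deriv g))) s := by
    rw [← integral_const_mul, ← integral_const_mul, ← integral_const_mul,
      ← integral_add (iJ.const_mul 4) (iSQ.const_mul 2)]
    rw [← integral_add (f := fun s => _ + _) ((iJ.const_mul 4).add (iSQ.const_mul 2))
      (iSr.const_mul _)]
    congr 1
    funext s
    simp only [interactionRate]
    ring
  have h4 : (∫ s, planar θ (normalMom R Λ θ t) g s * planar θ (normalMom R Λ θ t) g s)
      + (∫ s, planar θ (sqrtRhoP γ R t) g s * planar θ (sqrtRhoP γ R t) g s) ≤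
      ∫ s, planar θ (rho R t) g s * planar θ (normalStress γ R G Λ θ t) g s := by
    rw [← integral_add iJ iσ]
    refine integral_mono (iJ.add iσ) iQ fun s => ?_
    have := reg.sq_planar_add_le hγ ker hθ t s
    simpa only [sq] using this
  rw [e3, p1, p2, p3, morawetz]
  simp only [sq]
  linarith

/-- Continuity from below of the measure with density `f` along rational endpoints; this treats
finite and infinite `T` at once. -/
lemma setLIntegral_timeInterval_le {f : ℝ → ℝ≥0∞} {C : ℝ≥0∞}
    (h : ∀ t ∈ timeInterval T, ∫⁻ r in Set.Ioc 0 t, f r ≤ C) :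
    ∫⁻ r in timeInterval T, f r ≤ C := by
  have hU : timeInterval T = ⋃ q : {q : ℚ // (q : ℝ) ∈ timeInterval T}, Set.Ioc (0 : ℝ) q := by
    ext t
    simp only [Set.mem_iUnion]
    constructor
    · intro ht
      obtain ⟨b, hb, hbT⟩ := EReal.lt_iff_exists_rat_btwn.1 ht.2
      have hb' : t < (b : ℝ) := EReal.coe_lt_coe_iff.1 hb
      exact ⟨⟨b, ht.1.trans hb', hbT⟩, ht.1, hb'.le⟩
    · rintro ⟨q, hq⟩
      exact Ioc_subset_timeInterval q.2 hq
  have hdir : Directed (· ⊆ ·)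
      fun q : {q : ℚ // (q : ℝ) ∈ timeInterval T} => Set.Ioc (0 : ℝ) q := by
    have hm : Monotone fun q : {q : ℚ // (q : ℝ) ∈ timeInterval T} => Set.Ioc (0 : ℝ) q :=
      fun q q' hq => Set.Ioc_subset_Ioc_right (by exact_mod_cast hq)
    exact hm.directed_le
  rw [← withDensity_apply f (measurableSet_timeInterval T), hU, hdir.measure_iUnion]
  refine iSup_le fun q => ?_
  rw [withDensity_apply f measurableSet_Ioc]
  exact h _ q.2

/-- A bounded quantity with nonpositive rate has finite total dissipation. -/
lemma IsPrimitive.lintegral_le {A B F : ℝ → ℝ} {c C K : ℝ} (h : IsPrimitive T A B c) (hT : 0 < T)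
    (hA : ∀ t, |A t| ≤ C) (hB : Measurable B) (hK : ∀ t, |B t| ≤ K)
    (hF : ∀ t, F t ≤ -B t) (hF0 : ∀ t, 0 ≤ F t) :
    ∫⁻ t in timeInterval T, ENNReal.ofReal (F t) ≤ ENNReal.ofReal (2 * C) := by
  have hl := locallyIntegrable_of_bdd hB hK
  have hcont : Continuous fun t => c + ∫ s in (0 : ℝ)..t, B s :=
    continuous_const.add (locallyIntegrable_primitive hl)
  have hbd : ∀ t ∈ timeInterval T, |c + ∫ s in (0 : ℝ)..t, B s| ≤ C := fun t ht => by
    -- The primitive is bounded by `C` only almost everywhere; rewriting the bound as an equality of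
    -- continuous functions makes it hold throughout the open interval.
    have h1 : (fun t => max |c + ∫ s in (0 : ℝ)..t, B s| C)
        =ᵐ[volume.restrict (timeInterval T)] fun _ => C := by
      filter_upwards [h] with t ht
      rw [← ht]
      exact max_eq_right (hA t)
    have h2 := Measure.eqOn_open_of_ae_eq h1 (isOpen_timeInterval T)
      (hcont.abs.max continuous_const).continuousOn continuousOn_const ht
    exact (le_max_left _ _).trans h2.le
  -- The value at time `0` is the limit of values at positive times, so the initial interaction
  -- obeys the same bound.
  have hc : |c| ≤ C := by
    obtain ⟨a, ha⟩ := exists_mem_timeInterval hT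
    have hcl : IsClosed {t | |c + ∫ s in (0 : ℝ)..t, B s| ≤ C} :=
      isClosed_le hcont.abs continuous_const
    have hsub : Set.Ioo 0 a ⊆ {t | |c + ∫ s in (0 : ℝ)..t, B s| ≤ C} := fun t ht =>
      hbd t (Ioc_subset_timeInterval ha ⟨ht.1, ht.2.le⟩)
    have h0 : (0 : ℝ) ∈ closure (Set.Ioo 0 a) := by
      rw [closure_Ioo ha.1.ne]
      exact ⟨le_rfl, ha.1.le⟩
    have := hcl.closure_subset_iff.2 hsub h0
    simpa using this
  refine setLIntegral_timeInterval_le fun t ht => ?_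
  have hi : IntegrableOn B (Set.Ioc 0 t) :=
    (intervalIntegrable_iff_integrableOn_Ioc_of_le ht.1.le).1 (LocallyIntegrable.intervalIntegrable' hl 0 t)
  calc ∫⁻ r in Set.Ioc 0 t, ENNReal.ofReal (F r)
      ≤ ∫⁻ r in Set.Ioc 0 t, ENNReal.ofReal (-B r) :=
        lintegral_mono fun r => ENNReal.ofReal_le_ofReal (hF r)
    _ = ENNReal.ofReal (∫ r in Set.Ioc 0 t, -B r) :=
        (ofReal_integral_eq_lintegral_ofReal hi.neg
          (Filter.Eventually.of_forall fun r => (hF0 r).trans (hF r))).symm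
    _ ≤ ENNReal.ofReal (2 * C) := by
        refine ENNReal.ofReal_le_ofReal ?_
        rw [integral_neg, ← intervalIntegral.integral_of_le ht.1.le]
        have h1 := abs_le.1 (hbd t ht)
        have h2 := abs_le.1 hc
        linarith [h1.1, h2.2]

/-- The interaction Morawetz estimate along the direction `θ`. -/
lemma WeakEquations.lintegral_morawetz_le (weq : WeakEquations γ T ρ₀ R G Λ) (hT : 0 < T)
    (reg : RegularFields γ M S₀ R G Λ) (hγ : 1 < γ) (ker : IsKernel g S) (hθ : ‖θ‖ = 1) :
    ∫⁻ t in timeInterval T, ENNReal.ofReal (morawetz γ R θ g t)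
      ≤ ENNReal.ofReal (4 * M ^ 4) := by
  have hW := reg.density_interaction ker hθ
  obtain ⟨C, hD⟩ := reg.exists_density_interactionRate hγ ker hθ
  obtain ⟨c, hc⟩ := exists_isPrimitive_integral hT hW hD fun s χ hχ hχT =>
    weq.weak_interaction hT reg hγ ker hθ s hχ hχT
  have := hc.lintegral_le hT hW.abs_integral_le hD.measurable_integral hD.abs_integral_le
    (F := morawetz γ R θ g) (reg.morawetz_le hγ ker hθ) fun t =>
      add_nonneg (integral_nonneg fun s => sq_nonneg _)
        (mul_nonneg (by norm_num) (integral_nonneg fun s => sq_nonneg _))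
  refine this.trans (le_of_eq ?_)
  congr 1
  ring

end Morawetz

/-! ### From directional bounds to space-time bounds -/

section Kernels

/-- Bump functions on the line which shrink to the origin. -/
def lineBump (n : ℕ) : ContDiffBump (0 : ℝ) :=
  ⟨((n : ℝ) + 1)⁻¹ / 2, ((n : ℝ) + 1)⁻¹, by positivity, half_lt_self (by positivity)⟩

/-- An approximate identity on the line. -/
def kernel (n : ℕ) : ℝ → ℝ := (lineBump n).normed volume

/-- The primitive of `2 * kernel n` which runs from `-1` to `1`. -/
def kernelStep (n : ℕ) (r : ℝ) : ℝ := 2 * (∫ s in Set.Iic r, kernel n s) - 1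

lemma isKernel_kernel (n : ℕ) : IsKernel (kernel n) (kernelStep n) := by
  have hs : ContDiff ℝ ∞ (kernel n) := (lineBump n).contDiff_normed
  have hc : HasCompactSupport (kernel n) := (lineBump n).hasCompactSupport_normed
  have hi := integrable_of_smooth_compact hs hc
  have h0 : ∀ r, 0 ≤ kernel n r := (lineBump n).nonneg_normed
  have h1 : ∫ r, kernel n r = 1 := (lineBump n).integral_normed
  refine ⟨hs, hc, h0, h1, fun r => ?_, fun r => ?_⟩
  · have e1 : kernelStep n = fun r =>
        2 * ((∫ s in Set.Iic 0, kernel n s) + ∫ s in (0 : ℝ)..r, kernel n s) - 1 := by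
      funext r
      rw [kernelStep, ← intervalIntegral.integral_Iic_sub_Iic hi.integrableOn hi.integrableOn]
      ring
    rw [e1]
    exact (((intervalIntegral.integral_hasDerivAt_right (hi.intervalIntegrable)
      (hs.continuous.stronglyMeasurableAtFilter _ _) hs.continuous.continuousAt).const_add
        _).const_mul 2).sub_const 1
  · have h2 : 0 ≤ ∫ s in Set.Iic r, kernel n s := integral_nonneg h0
    have h3 : ∫ s in Set.Iic r, kernel n s ≤ 1 := by
      rw [← h1]
      exact setIntegral_le_integral hi (Filter.Eventually.of_forall h0)
    rw [kernelStep, abs_le]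
    constructor <;> linarith

/-- Such a function is Schwartz, and so is its transform. -/
lemma integrable_fourier_of_smooth_compact {g : ℝ → ℝ} (h : ContDiff ℝ ∞ g)
    (hc : HasCompactSupport g) : Integrable (𝓕 fun s => (g s : ℂ)) := by
  have h1 : HasCompactSupport fun s => (g s : ℂ) := hc.comp_left (g := Complex.ofReal) rfl
  have h2 : ContDiff ℝ ∞ fun s => (g s : ℂ) := Complex.ofRealCLM.contDiff.comp h
  have := (𝓕 (h1.toSchwartzMap h2)).integrable (μ := volume)
  rw [SchwartzMap.fourier_coe] at this
  exact this

lemma measurable_fourier_of_integrable {g : ℝ → ℝ} (h : Integrable g) :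
    Measurable (𝓕 fun s => (g s : ℂ)) := by
  have h1 : Integrable fun s => (g s : ℂ) := h.ofReal
  exact (VectorFourier.fourierIntegral_continuous Real.continuous_fourierChar continuous_inner
    h1).measurable

lemma fourier_deriv_eq {g : ℝ → ℝ} (h : ContDiff ℝ ∞ g) (hc : HasCompactSupport g) (κ : ℝ) :
    𝓕 (fun s => ((deriv g s : ℝ) : ℂ)) κ =
      (2 * Real.pi * Complex.I * κ) * 𝓕 (fun s => (g s : ℂ)) κ := by
  have h2 : ∀ s, HasDerivAt (fun s => (g s : ℂ)) ((deriv g s : ℝ) : ℂ) s := fun s =>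
    (hasDerivAt_of_smooth h s).ofReal_comp
  have e1 : deriv (fun s => (g s : ℂ)) = fun s => ((deriv g s : ℝ) : ℂ) :=
    funext fun s => (h2 s).deriv
  have h3 := Real.fourier_deriv (f := fun s => (g s : ℂ))
    (integrable_of_smooth_compact h hc).ofReal (fun s => (h2 s).differentiableAt) (by
      rw [e1]
      exact (integrable_of_smooth_compact (contDiff_deriv h) hc.deriv).ofReal)
  rw [e1] at h3
  rw [h3]
  simp

/-- The transform at `κ` is the convolution at `0` of an approximate identity with a continuous
character, whose value there is `1`. -/
lemma tendsto_fourier_kernel (κ : ℝ) :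
    Filter.Tendsto (fun n => 𝓕 (fun s => (kernel n s : ℂ)) κ) Filter.atTop (nhds 1) := by
  have hr : Filter.Tendsto (fun n => (lineBump n).rOut) Filter.atTop (nhds 0) :=
    tendsto_one_div_add_atTop_nhds_zero_nat.congr fun n => by simp [lineBump]
  have hcont : Continuous fun s : ℝ => ((Real.fourierChar (s * κ) : Circle) : ℂ) :=
    continuous_subtype_val.comp (Real.continuous_fourierChar.comp (by fun_prop))
  have h := ContDiffBump.convolution_tendsto_right_of_continuous (μ := volume) hr hcont 0
  simp only [zero_mul, AddChar.map_zero_eq_one, Circle.coe_one] at h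
  refine h.congr fun n => ?_
  rw [Real.fourier_eq]
  refine integral_congr_ae (Filter.Eventually.of_forall fun s => ?_)
  simp [kernel, Circle.smul_def, mul_comm]

end Kernels

/-! ### Polar coordinates. -/

section Polar

/-- Integration in polar coordinates. -/
lemma lintegral_polar {d : ℕ} {F : E d → ℝ≥0∞} (hd : d ≠ 0) (hF : Measurable F) :
    ∫⁻ ξ, F ξ = ∫⁻ θ : Metric.sphere (0 : E d) 1, (∫⁻ r in Set.Ioi (0 : ℝ),
      ENNReal.ofReal (r ^ (d - 1)) * F (r • θ.1)) ∂(volume : Measure (E d)).toSphere := by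
  have : Nonempty (Fin d) := ⟨⟨0, Nat.pos_of_ne_zero hd⟩⟩
  have : Nontrivial (E d) := inferInstance
  have hmp := (volume : Measure (E d)).measurePreserving_homeomorphUnitSphereProd
  have e1 : ∫⁻ ξ, F ξ =
      ∫⁻ x : ({(0)}ᶜ : Set (E d)), F x.1 ∂((volume : Measure (E d)).comap (↑)) := by
    rw [lintegral_subtype_comap (measurableSet_singleton _).compl F, restrict_compl_singleton]
  have hm : Measurable fun y : Metric.sphere (0 : E d) 1 × Set.Ioi (0 : ℝ) => F (y.2.1 • y.1.1) :=
    hF.comp (by fun_prop)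
  have e2 := hmp.lintegral_comp hm
  have e3 : ∀ x : ({(0)}ᶜ : Set (E d)), F ((homeomorphUnitSphereProd (E d) x).2.1 •
      (homeomorphUnitSphereProd (E d) x).1.1) = F x.1 := fun x => by
    congr 1
    have := (homeomorphUnitSphereProd (E d)).symm_apply_apply x
    exact congrArg Subtype.val this
  simp only [e3] at e2
  rw [e1, e2, lintegral_prod _ hm.aemeasurable]
  refine lintegral_congr fun θ => ?_
  have hfin : Module.finrank ℝ (E d) = d := by simp
  have hmθ : Measurable fun r : Set.Ioi (0 : ℝ) => F (r.1 • θ.1) := hF.comp (by fun_prop)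
  rw [Measure.volumeIoiPow, hfin]
  refine (lintegral_withDensity_eq_lintegral_mul _ (by fun_prop) hmθ).trans ?_
  rw [← lintegral_subtype_comap measurableSet_Ioi
    fun r : ℝ => ENNReal.ofReal (r ^ (d - 1)) * F (r • θ.1)]
  rfl

end Polar

/-! ### Spectral form of the directional estimate and integration over directions. -/

section SpaceTime

variable {d : ℕ} {γ M S₀ : ℝ} {T : EReal} {ρ₀ : E d → ℝ} {R : ℝ → E d → ℝ} {G Λ : ℝ → E d → E d}
  {θ : E d}

lemma IsDensity.measurable_fourier {f : ℝ → E d → ℝ} {C : ℝ} (hf : IsDensity f C) :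
    Measurable fun z : ℝ × E d => 𝓕 (fun x => (f z.1 x : ℂ)) z.2 := by
  simp only [Real.fourier_eq]
  have h : StronglyMeasurable fun w : (ℝ × E d) × E d =>
      Real.fourierChar (-(inner ℝ w.2 w.1.2)) • (f w.1.1 w.2 : ℂ) := by
    refine Measurable.stronglyMeasurable ?_
    simp only [Circle.smul_def]
    have h1 : Measurable fun w : (ℝ × E d) × E d => (f w.1.1 w.2 : ℂ) :=
      Complex.measurable_ofReal.comp (hf.meas.comp (measurable_fst.fst.prodMk measurable_snd))
    have h2 : Continuous fun w : (ℝ × E d) × E d => -(inner ℝ w.2 w.1.2) := by fun_prop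
    have h3 : Measurable fun w : (ℝ × E d) × E d =>
        ((Real.fourierChar (-(inner ℝ w.2 w.1.2)) : Circle) : ℂ) :=
      (continuous_subtype_val.comp (Real.continuous_fourierChar.comp h2)).measurable
    exact h3.smul h1
  exact h.integral_prod_right.measurable

/-- The integrand of the homogeneous Sobolev norm on the Fourier side. -/
def sobolevDensity (s : ℝ) (u : E d → ℝ) (ξ : E d) : ℝ≥0∞ :=
  ENNReal.ofReal ((2 * Real.pi * ‖ξ‖) ^ (2 * s)) * ‖𝓕 (fun x : E d => (u x : ℂ)) ξ‖ₑ ^ 2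

lemma IsDensity.measurable_sobolevDensity {f : ℝ → E d → ℝ} {C : ℝ} (hf : IsDensity f C) (s : ℝ) :
    Measurable fun z : ℝ × E d => sobolevDensity s (f z.1) z.2 := by
  unfold sobolevDensity
  refine Measurable.mul ?_ (hf.measurable_fourier.enorm.pow_const 2)
  fun_prop

lemma measurable_comp_pair {X Y Z : Type*} [MeasurableSpace X] [MeasurableSpace Y]
    [MeasurableSpace Z] {F : X → Y → ℝ≥0∞} (hF : Measurable fun z : X × Y => F z.1 z.2)
    {f : Z → X} {g : Z → Y} (hf : Measurable f) (hg : Measurable g) :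
    Measurable fun w => F (f w) (g w) := hF.comp (hf.prodMk hg)

/-- The spectral density controlled by the interaction Morawetz estimate. -/
def spectral (γ : ℝ) (R : ℝ → E d → ℝ) (t : ℝ) (ξ : E d) : ℝ≥0∞ :=
  ENNReal.ofReal ((2 * Real.pi * ‖ξ‖) ^ 2) * ‖𝓕 (fun x : E d => (rho R t x : ℂ)) ξ‖ₑ ^ 2
    + 4 * ‖𝓕 (fun x : E d => (sqrtRhoP γ R t x : ℂ)) ξ‖ₑ ^ 2

lemma RegularFields.measurable_spectral (reg : RegularFields γ M S₀ R G Λ) (hγ : 1 < γ) :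
    Measurable fun z : ℝ × E d => spectral γ R z.1 z.2 := by
  obtain ⟨C, hσ⟩ := reg.density_sqrtRhoP hγ
  have h1 := reg.density_rho.measurable_fourier.enorm.pow_const 2
  have h2 := hσ.measurable_fourier.enorm.pow_const 2
  unfold spectral
  refine Measurable.add (Measurable.mul ?_ h1) (h2.const_mul 4)
  fun_prop

/-- Plancherel on the line for both terms; differentiating the kernel multiplies its transform by
`2πiκ`, whose modulus is `2π ‖κ • θ‖` since `θ` is a unit vector. -/
lemma RegularFields.ofReal_morawetz (reg : RegularFields γ M S₀ R G Λ) (hγ : 1 < γ)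
    (hθ : ‖θ‖ = 1) (n : ℕ) (t : ℝ) :
    ENNReal.ofReal (morawetz γ R θ (kernel n) t) =
      ∫⁻ κ : ℝ, ‖𝓕 (fun s => (kernel n s : ℂ)) κ‖ₑ ^ 2 * spectral γ R t (κ • θ) := by
  obtain ⟨C, hσ⟩ := reg.density_sqrtRhoP hγ
  have ker := isKernel_kernel n
  have s1 := contDiff_deriv ker.smooth
  have c1 := ker.compact.deriv
  obtain ⟨K, hK⟩ := bdd_of_smooth_compact ker.smooth ker.compact
  obtain ⟨K1, hK1⟩ := bdd_of_smooth_compact s1 c1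
  have h1 := lintegral_planar_sq (θ := θ) (reg.density_rho.int t) s1.continuous
    (integrable_of_smooth_compact s1 c1) hK1 (integrable_fourier_of_smooth_compact s1 c1)
  have h2 := lintegral_planar_sq (θ := θ) (hσ.int t) ker.smooth.continuous
    (integrable_of_smooth_compact ker.smooth ker.compact) hK
    (integrable_fourier_of_smooth_compact ker.smooth ker.compact)
  have m1 : Measurable fun κ : ℝ => ‖𝓕 (fun s => ((deriv (kernel n) s : ℝ) : ℂ)) κ‖ₑ ^ 2 *
      ‖𝓕 (fun x => (rho R t x : ℂ)) (κ • θ)‖ₑ ^ 2 := by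
    have n1 : Measurable (𝓕 fun s => ((deriv (kernel n) s : ℝ) : ℂ)) :=
      measurable_fourier_of_integrable (integrable_of_smooth_compact s1 c1)
    have n2 : Measurable fun κ : ℝ => 𝓕 (fun x => (rho R t x : ℂ)) (κ • θ) :=
      (continuous_fourier (reg.density_rho.int t)).measurable.comp (measurable_id.smul_const θ)
    exact (n1.enorm.pow_const 2).mul (n2.enorm.pow_const 2)
  rw [morawetz, ENNReal.ofReal_add (integral_nonneg fun s => sq_nonneg _)
    (mul_nonneg (by norm_num) (integral_nonneg fun s => sq_nonneg _)),
    ENNReal.ofReal_mul (by norm_num), ← h1, ← h2,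
    ← lintegral_const_mul' _ _ ENNReal.ofReal_ne_top, ← lintegral_add_left m1]
  refine lintegral_congr fun κ => ?_
  have e1 : ‖𝓕 (fun s => ((deriv (kernel n) s : ℝ) : ℂ)) κ‖ₑ ^ 2 =
      ENNReal.ofReal ((2 * Real.pi * ‖κ • θ‖) ^ 2) * ‖𝓕 (fun s => (kernel n s : ℂ)) κ‖ₑ ^ 2 := by
    rw [fourier_deriv_eq ker.smooth ker.compact, enorm_mul, mul_pow, enorm_sq_eq_ofReal]
    congr 3
    simp [norm_smul, hθ, abs_of_pos Real.pi_pos]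
  have e2 : ENNReal.ofReal 4 = 4 := by norm_num
  rw [e1, e2, spectral]
  ring

/-- The squared transforms of the kernels tend to `1` pointwise and the Morawetz bound does not
depend on the kernel, so Fatou yields the estimate for the unsmoothed densities. -/
lemma WeakEquations.lintegral_spectral_le (weq : WeakEquations γ T ρ₀ R G Λ) (hT : 0 < T)
    (reg : RegularFields γ M S₀ R G Λ) (hγ : 1 < γ) (hθ : ‖θ‖ = 1) :
    ∫⁻ t in timeInterval T, ∫⁻ κ : ℝ, spectral γ R t (κ • θ) ≤ ENNReal.ofReal (4 * M ^ 4) := by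
  have hm : Measurable fun z : ℝ × ℝ => spectral γ R z.1 (z.2 • θ) :=
    measurable_comp_pair (F := spectral γ R) (reg.measurable_spectral hγ) measurable_fst
      (measurable_snd.smul_const θ)
  have hk : ∀ n, Measurable fun κ : ℝ => ‖𝓕 (fun s => (kernel n s : ℂ)) κ‖ₑ ^ 2 := fun n => by
    have ker := isKernel_kernel n
    exact (measurable_fourier_of_integrable
      (integrable_of_smooth_compact ker.smooth ker.compact)).enorm.pow_const 2
  have hmn : ∀ n, Measurable fun z : ℝ × ℝ =>
      ‖𝓕 (fun s => (kernel n s : ℂ)) z.2‖ₑ ^ 2 * spectral γ R z.1 (z.2 • θ) := fun n =>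
    ((hk n).comp measurable_snd).mul hm
  rw [lintegral_lintegral (f := fun t (κ : ℝ) => spectral γ R t (κ • θ)) hm.aemeasurable]
  have hlim : ∀ z : ℝ × ℝ, Filter.Tendsto (fun n =>
      ‖𝓕 (fun s => (kernel n s : ℂ)) z.2‖ₑ ^ 2 * spectral γ R z.1 (z.2 • θ)) Filter.atTop
      (nhds (spectral γ R z.1 (z.2 • θ))) := fun z => by
    have h1 : Filter.Tendsto (fun n => ‖𝓕 (fun s => (kernel n s : ℂ)) z.2‖ₑ ^ 2) Filter.atTop
        (nhds 1) := by
      have := (tendsto_fourier_kernel z.2).enorm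
      simp only [enorm_one] at this
      have := ((ENNReal.continuous_pow 2).tendsto 1).comp this
      rw [one_pow] at this
      exact this
    have h2 := ENNReal.Tendsto.mul_const (b := spectral γ R z.1 (z.2 • θ)) h1 (Or.inl one_ne_zero)
    simpa using h2
  calc ∫⁻ z : ℝ × ℝ, spectral γ R z.1 (z.2 • θ)
        ∂((volume.restrict (timeInterval T)).prod volume)
      = ∫⁻ z : ℝ × ℝ, Filter.liminf (fun n =>
        ‖𝓕 (fun s => (kernel n s : ℂ)) z.2‖ₑ ^ 2 * spectral γ R z.1 (z.2 • θ)) Filter.atTop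
        ∂((volume.restrict (timeInterval T)).prod volume) :=
        lintegral_congr fun z => (hlim z).liminf_eq.symm
    _ ≤ _ := lintegral_liminf_le hmn
    _ ≤ ENNReal.ofReal (4 * M ^ 4) := by
        refine Filter.liminf_le_of_le (by isBoundedDefault) fun b hb => ?_
        obtain ⟨n, hn⟩ := hb.exists
        refine hn.trans ?_
        rw [lintegral_prod _ (hmn n).aemeasurable]
        simp only [← reg.ofReal_morawetz hγ hθ]
        exact weq.lintegral_morawetz_le hT reg hγ (isKernel_kernel n) hθ

/-- The constant in the space-time bound. -/
def spaceTimeConst (d : ℕ) : ℝ≥0∞ :=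
  ENNReal.ofReal ((2 * Real.pi) ^ (1 - (d : ℝ))) * (volume : Measure (E d)).toSphere Set.univ * 4

/-- The polar Jacobian `r ^ (d - 1)` cancels the factor `|ξ|^(1-d)` shared by both weights; what
remains is `|2πξ|²` for the density and `1` for `√(ρp)`. -/
lemma weight_mul_sobolevDensity_le (hd : d ≠ 0) (t : ℝ) {r : ℝ} (hr : 0 < r) (hθ : ‖θ‖ = 1) :
    ENNReal.ofReal (r ^ (d - 1)) * (sobolevDensity ((3 - (d : ℝ)) / 2) (rho R t) (r • θ)
        + sobolevDensity ((1 - (d : ℝ)) / 2) (sqrtRhoP γ R t) (r • θ)) ≤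
      ENNReal.ofReal ((2 * Real.pi) ^ (1 - (d : ℝ))) * spectral γ R t (r • θ) := by
  have hn : ‖r • θ‖ = r := by rw [norm_smul, hθ, mul_one, Real.norm_eq_abs, abs_of_pos hr]
  have h2π : 0 < 2 * Real.pi := by positivity
  have hrd : r ^ (d - 1) = r ^ ((d : ℝ) - 1) := by
    rw [← Real.rpow_natCast, Nat.cast_sub (Nat.one_le_iff_ne_zero.2 hd), Nat.cast_one]
  have w1 : r ^ (d - 1) * (2 * Real.pi * r) ^ (1 - (d : ℝ)) = (2 * Real.pi) ^ (1 - (d : ℝ)) := by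
    rw [hrd, Real.mul_rpow h2π.le hr.le, mul_left_comm, ← Real.rpow_add hr]
    simp
  have w2 : r ^ (d - 1) * (2 * Real.pi * r) ^ (3 - (d : ℝ)) =
      (2 * Real.pi) ^ (1 - (d : ℝ)) * (2 * Real.pi * r) ^ 2 := by
    rw [show 3 - (d : ℝ) = (1 - (d : ℝ)) + (2 : ℕ) by push_cast; ring,
      Real.rpow_add_natCast (by positivity), ← mul_assoc, w1]
  rw [spectral, sobolevDensity, sobolevDensity, hn, mul_div_cancel₀ _ two_ne_zero, mul_div_cancel₀ _ two_ne_zero, mul_add,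
    ← mul_assoc, ← mul_assoc, ← ENNReal.ofReal_mul (by positivity),
    ← ENNReal.ofReal_mul (by positivity), w1, w2, ENNReal.ofReal_mul (by positivity), mul_add,
    mul_assoc]
  gcongr
  -- The factor `4` in front of the second spectral term is given away.
  refine le_mul_of_one_le_left zero_le (by norm_num)

/-- The space-time bounds for regular representatives. -/
lemma WeakEquations.spaceTimeSq_le (weq : WeakEquations γ T ρ₀ R G Λ) (hT : 0 < T)
    (reg : RegularFields γ M S₀ R G Λ) (hγ : 1 < γ) (hd : d ≠ 0) :
    spaceTimeSq T ((3 - (d : ℝ)) / 2) (rho R) + spaceTimeSq T ((1 - (d : ℝ)) / 2) (sqrtRhoP γ R)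
      ≤ spaceTimeConst d * ENNReal.ofReal (M ^ 4) := by
  obtain ⟨C, hσ⟩ := reg.density_sqrtRhoP hγ
  have m1 := reg.density_rho.measurable_sobolevDensity ((3 - (d : ℝ)) / 2)
  have m2 := hσ.measurable_sobolevDensity ((1 - (d : ℝ)) / 2)
  have n1 : ∀ t, Measurable (sobolevDensity ((3 - (d : ℝ)) / 2) (rho R t)) := fun t =>
    measurable_comp_pair (F := fun t => sobolevDensity ((3 - (d : ℝ)) / 2) (rho R t)) m1
      measurable_const measurable_id
  have n2 : ∀ t, Measurable (sobolevDensity ((1 - (d : ℝ)) / 2) (sqrtRhoP γ R t)) := fun t =>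
    measurable_comp_pair (F := fun t => sobolevDensity ((1 - (d : ℝ)) / 2) (sqrtRhoP γ R t)) m2
      measurable_const measurable_id
  have mS := reg.measurable_spectral hγ
  have e1 : spaceTimeSq T ((3 - (d : ℝ)) / 2) (rho R)
      + spaceTimeSq T ((1 - (d : ℝ)) / 2) (sqrtRhoP γ R) =
      ∫⁻ t in timeInterval T, ∫⁻ ξ : E d, (sobolevDensity ((3 - (d : ℝ)) / 2) (rho R t) ξ
        + sobolevDensity ((1 - (d : ℝ)) / 2) (sqrtRhoP γ R t) ξ) := by
    refine (lintegral_add_left (Measurable.lintegral_prod_right' m1) _).symm.trans ?_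
    exact lintegral_congr fun t => (lintegral_add_left (n1 t) _).symm
  have mθ : Measurable fun w : ℝ × Metric.sphere (0 : E d) 1 =>
      ∫⁻ r in Set.Ioi (0 : ℝ), spectral γ R w.1 (r • w.2.1) := by
    refine Measurable.lintegral_prod_right'
      (f := fun w : (ℝ × Metric.sphere (0 : E d) 1) × ℝ => spectral γ R w.1.1 (w.2 • w.1.2.1)) ?_
    have hg : Measurable fun w : (ℝ × Metric.sphere (0 : E d) 1) × ℝ => w.2 • w.1.2.1 := by
      fun_prop
    exact measurable_comp_pair (F := spectral γ R) mS measurable_fst.fst hg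
  have h1 : ∀ t, ∫⁻ ξ : E d, (sobolevDensity ((3 - (d : ℝ)) / 2) (rho R t) ξ
        + sobolevDensity ((1 - (d : ℝ)) / 2) (sqrtRhoP γ R t) ξ) ≤
      ENNReal.ofReal ((2 * Real.pi) ^ (1 - (d : ℝ))) *
        ∫⁻ θ : Metric.sphere (0 : E d) 1, (∫⁻ r in Set.Ioi (0 : ℝ),
          spectral γ R t (r • θ.1)) ∂(volume : Measure (E d)).toSphere := fun t => by
    rw [lintegral_polar (F := fun ξ => _ + _) hd ((n1 t).add (n2 t)), ← lintegral_const_mul' _ _ ENNReal.ofReal_ne_top]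
    refine lintegral_mono fun θ => ?_
    rw [← lintegral_const_mul' _ _ ENNReal.ofReal_ne_top]
    refine setLIntegral_mono' measurableSet_Ioi fun r hr => ?_
    exact weight_mul_sobolevDensity_le hd t hr (mem_sphere_zero_iff_norm.1 θ.2)
  rw [e1]
  calc _ ≤ ∫⁻ t in timeInterval T, ENNReal.ofReal ((2 * Real.pi) ^ (1 - (d : ℝ))) *
        ∫⁻ θ : Metric.sphere (0 : E d) 1, (∫⁻ r in Set.Ioi (0 : ℝ),
          spectral γ R t (r • θ.1)) ∂(volume : Measure (E d)).toSphere := lintegral_mono h1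
    _ = ENNReal.ofReal ((2 * Real.pi) ^ (1 - (d : ℝ))) *
        ∫⁻ θ : Metric.sphere (0 : E d) 1, (∫⁻ t in timeInterval T, ∫⁻ r in Set.Ioi (0 : ℝ),
          spectral γ R t (r • θ.1)) ∂(volume : Measure (E d)).toSphere := by
        rw [lintegral_const_mul' _ _ ENNReal.ofReal_ne_top,
          lintegral_lintegral_swap mθ.aemeasurable]
    _ ≤ ENNReal.ofReal ((2 * Real.pi) ^ (1 - (d : ℝ))) *
        ∫⁻ _ : Metric.sphere (0 : E d) 1, ENNReal.ofReal (4 * M ^ 4)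
          ∂(volume : Measure (E d)).toSphere := by
        gcongr with θ
        -- The radial half line is enlarged to the full line spanned by `θ`.
        refine le_trans (lintegral_mono fun t => ?_)
          (weq.lintegral_spectral_le hT reg hγ (mem_sphere_zero_iff_norm.1 θ.2))
        exact setLIntegral_le_lintegral _ _
    _ = spaceTimeConst d * ENNReal.ofReal (M ^ 4) := by
        rw [lintegral_const, ENNReal.ofReal_mul (by norm_num), spaceTimeConst]
        have e2 : ENNReal.ofReal 4 = 4 := by norm_num
        rw [e2]
        ring

lemma homSobolevSq_congr {u v : E d → ℝ} (h : u =ᵐ[volume] v) (s : ℝ) :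
    homSobolevSq s u = homSobolevSq s v := by
  have e1 : 𝓕 (fun x => (u x : ℂ)) = 𝓕 (fun x => (v x : ℂ)) := by
    funext ξ
    rw [Real.fourier_eq, Real.fourier_eq]
    refine integral_congr_ae ?_
    filter_upwards [h] with x hx
    rw [hx]
  rw [homSobolevSq, homSobolevSq, e1]

lemma spaceTimeSq_congr {u v : ℝ → E d → ℝ}
    (h : ∀ᵐ t ∂(volume.restrict (timeInterval T)), u t =ᵐ[volume] v t) (s : ℝ) :
    spaceTimeSq T s u = spaceTimeSq T s v := by
  refine lintegral_congr_ae ?_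
  filter_upwards [h] with t ht
  exact homSobolevSq_congr ht s

lemma Admissible.one_lt (h : Admissible d γ) : 1 < γ := by
  rcases h with h | h
  · exact h.2
  · exact h.2.1

lemma Admissible.ne_zero (h : Admissible d γ) : d ≠ 0 := by
  rcases h with h | h <;> omega

lemma spaceTimeConst_ne_top (d : ℕ) : spaceTimeConst d ≠ ⊤ :=
  ENNReal.mul_ne_top (ENNReal.mul_ne_top ENNReal.ofReal_ne_top (measure_ne_top _ _)) (by norm_num)

/-- Space-time bounds for finite energy weak solutions. -/
theorem exists_spaceTimeSq_le (hdγ : Admissible d γ) :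
    ∃ C : ℝ≥0, ∀ (T : EReal) (M₁ : ℝ≥0) (ρ₀ : E d → ℝ) (J₀ : E d → E d)
        (R : ℝ → E d → ℝ) (G Λ : ℝ → E d → E d),
      0 < T → IsFiniteEnergyWeakSolution γ T ρ₀ J₀ R G Λ →
      energyNorm T R G Λ ≤ (M₁ : ℝ≥0∞) →
        (∀ᵐ t ∂(volume.restrict (timeInterval T)),
          Integrable (rho R t) ∧ Integrable (sqrtRhoP γ R t)) ∧
        spaceTimeSq T ((3 - (d : ℝ)) / 2) (rho R)
            + spaceTimeSq T ((1 - (d : ℝ)) / 2) (sqrtRhoP γ R)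
          ≤ (C : ℝ≥0∞) * (M₁ : ℝ≥0∞) ^ 4 := by
  refine ⟨(spaceTimeConst d).toNNReal, fun T M ρ₀ J₀ R G Λ hT sol hM => ?_⟩
  -- The Sobolev constant `S` depends on `M`, but it only makes the integrals finite and does not
  -- enter the final constant.
  obtain ⟨S, hS⟩ := exists_regularFields hdγ M
  obtain ⟨R', G', Λ', reg, hR, hG, hΛ⟩ := hS T ρ₀ J₀ R G Λ sol hM
  have weq := sol.weakEquations hdγ.one_lt reg hR hG hΛ
  obtain ⟨C, hσ⟩ := reg.density_sqrtRhoP hdγ.one_lt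
  have hr : ∀ᵐ t ∂(volume.restrict (timeInterval T)), rho R t =ᵐ[volume] rho R' t := by
    filter_upwards [hR.slice] with t ht
    filter_upwards [ht] with x hx
    rw [rho, rho, hx]
  have hs : ∀ᵐ t ∂(volume.restrict (timeInterval T)),
      sqrtRhoP γ R t =ᵐ[volume] sqrtRhoP γ R' t := by
    filter_upwards [hr] with t ht
    filter_upwards [ht] with x hx
    rw [sqrtRhoP, sqrtRhoP, hx]
  refine ⟨?_, ?_⟩
  · filter_upwards [hr, hs] with t h1 h2
    exact ⟨(reg.density_rho.int t).congr h1.symm, (hσ.int t).congr h2.symm⟩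
  · rw [spaceTimeSq_congr hr, spaceTimeSq_congr hs, ENNReal.coe_toNNReal (spaceTimeConst_ne_top d)]
    refine (weq.spaceTimeSq_le hT reg hdγ.one_lt hdγ.ne_zero).trans (le_of_eq ?_)
    rw [ENNReal.ofReal_pow M.coe_nonneg, ENNReal.ofReal_coe_nnreal]

end SpaceTime

/-! ### Truncations of the quadratic weight -/

section Truncation

lemma exists_bound_deriv_smoothTransition :
    ∃ K, 0 < K ∧ ∀ r, |deriv Real.smoothTransition r| ≤ K := by
  have hs : ContDiff ℝ ∞ Real.smoothTransition := Real.smoothTransition.contDiff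
  have h0 : ∀ r, r ∉ Set.Icc (0 : ℝ) 1 → deriv Real.smoothTransition r = 0 := fun r hr => by
    rw [Set.mem_Icc, not_and_or, not_le, not_le] at hr
    rcases hr with hr | hr
    · have : Real.smoothTransition =ᶠ[nhds r] fun _ => 0 := by
        filter_upwards [gt_mem_nhds hr] with y hy
        exact Real.smoothTransition.zero_of_nonpos hy.le
      rw [this.deriv_eq, deriv_const]
    · have : Real.smoothTransition =ᶠ[nhds r] fun _ => 1 := by
        filter_upwards [lt_mem_nhds hr] with y hy
        exact Real.smoothTransition.one_of_one_le hy.le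
      rw [this.deriv_eq, deriv_const]
  obtain ⟨K, hK⟩ := (contDiff_deriv hs).continuous.bounded_above_of_compact_support
    (HasCompactSupport.intro isCompact_Icc h0)
  exact ⟨max K 1, by positivity, fun r => (hK r).trans (le_max_left _ _)⟩

/-- A cutoff on the half line which decays so slowly that `r ↦ r * h r ^ 2` has a small
derivative. -/
lemma exists_slow_cutoff : ∃ (h h' : ℝ → ℝ) (L : ℝ),
    (∀ r, 0 ≤ r → HasDerivAt h (h' r) r) ∧ (∀ r, 0 ≤ r → ContDiffAt ℝ ∞ h r) ∧
    (∀ r, 0 ≤ h r ∧ h r ≤ 1) ∧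
    (∀ r, 0 ≤ r → r < 1 → h r = 1) ∧ (∀ r, L ≤ r → h r = 0) ∧
    ∀ r, 0 ≤ r → |h r + 2 * r * h' r| ≤ 1 := by
  obtain ⟨K, hK0, hK⟩ := exists_bound_deriv_smoothTransition
  -- Small enough for `2 * K * δ ≤ 1`, the derivative bound, and for `δ ≤ 1`, which keeps the cutoff
  -- equal to `1` on `[0, 1)`.
  set δ : ℝ := (2 * K + 1)⁻¹ with hδ
  have hδ0 : 0 < δ := by positivity
  have hδ1 : δ ≤ 1 := inv_le_one_of_one_le₀ (by linarith)
  have hδK : 2 * K * δ ≤ 1 := by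
    rw [hδ, ← div_eq_mul_inv, div_le_one (by positivity)]
    linarith
  have hs : ContDiff ℝ ∞ Real.smoothTransition := Real.smoothTransition.contDiff
  -- Cutting off in `log (1 + r)` bounds the scale-invariant quantity `r h'(r)`: it puts `2 r h'` in
  -- `[-1, 0]`, and since `h` lies in `[0, 1]` the sum lies in `[-1, 1]`.
  refine ⟨fun r => Real.smoothTransition (2 - δ * Real.log (1 + r)),
    fun r => deriv Real.smoothTransition (2 - δ * Real.log (1 + r)) * -(δ * (1 / (1 + r))),
    Real.exp (2 / δ), fun r hr => ?_, fun r hr => ?_, fun r => ?_, fun r hr hr1 => ?_,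
    fun r hr => ?_, fun r hr => ?_⟩
  · have h1 : HasDerivAt (fun r => 1 + r) 1 r := (hasDerivAt_id r).const_add 1
    have h2 := ((h1.log (by positivity)).const_mul δ).const_sub 2
    exact (hasDerivAt_of_smooth hs _).comp r h2
  · refine hs.contDiffAt.comp r (contDiffAt_const.sub (contDiffAt_const.mul ?_))
    exact (contDiffAt_const.add contDiffAt_id).log (by simp only [id]; positivity)
  · exact ⟨Real.smoothTransition.nonneg _, Real.smoothTransition.le_one _⟩
  · refine Real.smoothTransition.one_of_one_le ?_
    have h1 : Real.log (1 + r) ≤ 1 := by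
      have := Real.log_le_sub_one_of_pos (show 0 < 1 + r by positivity)
      linarith
    have h0 : 0 ≤ Real.log (1 + r) := Real.log_nonneg (by linarith)
    nlinarith
  · refine Real.smoothTransition.zero_of_nonpos ?_
    have h1 : 2 / δ ≤ Real.log (1 + r) := by
      rw [Real.le_log_iff_exp_le (by have := Real.exp_pos (2 / δ); linarith)]
      linarith
    rw [div_le_iff₀ hδ0] at h1
    linarith
  · have h0 := Real.smoothTransition.nonneg (2 - δ * Real.log (1 + r))
    have h1 := Real.smoothTransition.le_one (2 - δ * Real.log (1 + r))
    have hd0 : 0 ≤ deriv Real.smoothTransition (2 - δ * Real.log (1 + r)) :=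
      Real.smoothTransition.monotone.deriv_nonneg
    have hd1 := (abs_le.1 (hK (2 - δ * Real.log (1 + r)))).2
    set D := deriv Real.smoothTransition (2 - δ * Real.log (1 + r))
    have hq0 : 0 ≤ r * (1 / (1 + r)) := by positivity
    have hq1 : r * (1 / (1 + r)) ≤ 1 := by
      rw [mul_one_div, div_le_one (by positivity)]
      linarith
    have e1 : 2 * r * (D * -(δ * (1 / (1 + r)))) = -(2 * D * δ * (r * (1 / (1 + r)))) := by ring
    have b1 : 2 * D * δ ≤ 1 := by nlinarith
    have b2 : 0 ≤ 2 * D * δ := by positivity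
    have b3 : 2 * D * δ * (r * (1 / (1 + r))) ≤ 1 := mul_le_one₀ b1 hq0 hq1
    have b4 : 0 ≤ 2 * D * δ * (r * (1 / (1 + r))) := mul_nonneg b2 hq0
    simp only []
    rw [e1, abs_le]
    constructor <;> linarith

/-- Properties of a truncation `Φ` of `½|x|²`. -/
structure IsTruncation {d : ℕ} (Φ : E d → ℝ) : Prop where
  smooth : ContDiff ℝ ∞ Φ
  compact : HasCompactSupport Φ
  nonneg : ∀ x, 0 ≤ Φ x
  le : ∀ x, Φ x ≤ 1 / 2 * ‖x‖ ^ 2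
  eq : ∀ x, ‖x‖ < 1 → Φ x = 1 / 2 * ‖x‖ ^ 2
  grad_le : ∀ x, ‖grad Φ x‖ ^ 2 ≤ 2 * Φ x

/-- For `Φ = ½|x|² h(|x|²)²` the gradient is `h (h + 2r h') x` with `r = |x|²`. The slow decay
bounds the bracket by one, so `|∇Φ|² ≤ h² |x|² = 2Φ`. -/
lemma exists_isTruncation (d : ℕ) : ∃ Φ : E d → ℝ, IsTruncation Φ := by
  obtain ⟨h, h', L, hd, hs, hb, h1, h0, hg⟩ := exists_slow_cutoff
  refine ⟨fun x => 1 / 2 * (‖x‖ ^ 2 * h (‖x‖ ^ 2) ^ 2), ?_, ?_, fun x => ?_, fun x => ?_,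
    fun x hx => ?_, fun x => ?_⟩
  · rw [contDiff_iff_contDiffAt]
    intro x
    have hn : ContDiffAt ℝ ∞ (fun x : E d => ‖x‖ ^ 2) x := (contDiff_norm_sq ℝ).contDiffAt
    exact contDiffAt_const.mul (hn.mul (((hs _ (sq_nonneg _)).comp x hn).pow 2))
  · refine HasCompactSupport.intro (isCompact_closedBall (0 : E d) (|L| + 1)) fun x hx => ?_
    have hx' : |L| + 1 < ‖x‖ := by simpa using hx
    have : L ≤ ‖x‖ ^ 2 := by nlinarith [abs_nonneg L, le_abs_self L]
    rw [h0 _ this]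
    ring
  · positivity
  · have := hb (‖x‖ ^ 2)
    have h2 : h (‖x‖ ^ 2) ^ 2 ≤ 1 := pow_le_one₀ this.1 this.2
    have h3 : ‖x‖ ^ 2 * h (‖x‖ ^ 2) ^ 2 ≤ ‖x‖ ^ 2 := mul_le_of_le_one_right (sq_nonneg _) h2
    linarith
  · rw [h1 _ (sq_nonneg _) (by nlinarith [norm_nonneg x])]
    ring
  · have hH : HasDerivAt (fun r => 1 / 2 * (r * h r ^ 2))
        (1 / 2 * (h (‖x‖ ^ 2) * (h (‖x‖ ^ 2) + 2 * ‖x‖ ^ 2 * h' (‖x‖ ^ 2)))) (‖x‖ ^ 2) := by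
      refine (((hasDerivAt_id' (‖x‖ ^ 2)).fun_mul
        ((hd _ (sq_nonneg ‖x‖)).fun_pow 2)).const_mul (1 / 2)).congr_deriv ?_
      norm_num
      ring
    have hn : HasFDerivAt (fun x : E d => ‖x‖ ^ 2) (2 • innerSL ℝ x) x :=
      (hasStrictFDerivAt_norm_sq x).hasFDerivAt
    have hc := hH.comp_hasFDerivAt x hn
    set q := h (‖x‖ ^ 2) + 2 * ‖x‖ ^ 2 * h' (‖x‖ ^ 2) with hq
    have hgr : grad (fun x : E d => 1 / 2 * (‖x‖ ^ 2 * h (‖x‖ ^ 2) ^ 2)) x =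
        (h (‖x‖ ^ 2) * q) • x := by
      ext i
      have hc' : HasFDerivAt (fun x : E d => 1 / 2 * (‖x‖ ^ 2 * h (‖x‖ ^ 2) ^ 2)) _ x := hc
      rw [grad_apply, dv, hc'.fderiv]
      have : inner ℝ x (e i) = x i := by rw [real_inner_comm, inner_e]
      simp [this]
      ring
    have hq1 : q ^ 2 ≤ 1 := by
      have := hg (‖x‖ ^ 2) (sq_nonneg _)
      rw [← sq_abs]
      exact pow_le_one₀ (abs_nonneg _) this
    rw [hgr, norm_smul, mul_pow, Real.norm_eq_abs, sq_abs, mul_pow]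
    have : 0 ≤ h (‖x‖ ^ 2) ^ 2 * ‖x‖ ^ 2 := by positivity
    nlinarith

lemma dv_comp_smul {d : ℕ} {f : E d → ℝ} (hf : Differentiable ℝ f) (a c : ℝ) (i : Fin d) :
    dv i (fun x => a * f (c • x)) = fun x => (a * c) * dv i f (c • x) := by
  funext x
  have h : DifferentiableAt ℝ (fun x => f (c • x)) x :=
    (hf (c • x)).comp x (differentiableAt_id.const_smul c)
  simp only [dv]
  rw [fderiv_const_mul h, fderiv_comp_smul]
  simp only [FunLike.coe_smul, Pi.smul_apply, smul_eq_mul]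
  ring

lemma lap_comp_smul {d : ℕ} {f : E d → ℝ} (hf : ContDiff ℝ ∞ f) (a c : ℝ) :
    lap (fun x => a * f (c • x)) = fun x => (a * c * c) * lap f (c • x) := by
  funext x
  simp only [lap, Finset.mul_sum]
  refine Finset.sum_congr rfl fun i _ => ?_
  rw [dv_comp_smul (hf.differentiable (by simp)),
    dv_comp_smul ((contDiff_dv hf i).differentiable (by simp))]

/-- Smooth compactly supported weights which increase to `½|x|²` with bounded second
derivatives. -/
structure IsVirialWeight {d : ℕ} (φ : ℕ → E d → ℝ) (K : ℝ) : Prop where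
  smooth : ∀ n, ContDiff ℝ ∞ (φ n)
  compact : ∀ n, HasCompactSupport (φ n)
  nonneg : ∀ n x, 0 ≤ φ n x
  le : ∀ n x, φ n x ≤ 1 / 2 * ‖x‖ ^ 2
  eventuallyEq : LocallyEventuallyEq φ fun x => 1 / 2 * ‖x‖ ^ 2
  grad_le : ∀ n x, ‖grad (φ n) x‖ ^ 2 ≤ 2 * φ n x
  dv_dv_le : ∀ n i j x, |dv j (dv i (φ n)) x| ≤ K
  lap_lap_le : ∀ n x, |lap (lap (φ n)) x| ≤ K

/-- Parabolic rescaling `(n+1)² Φ(x/(n+1))` fixes `½|x|²`, second derivatives and the inequality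
`|∇φ|² ≤ 2φ`, while fourth derivatives gain `(n+1)⁻²`. -/
lemma exists_isVirialWeight (d : ℕ) : ∃ (φ : ℕ → E d → ℝ) (K : ℝ), IsVirialWeight φ K := by
  obtain ⟨Φ, hΦ⟩ := exists_isTruncation d
  obtain ⟨K, hK, hK'⟩ := (unifSmooth_const_of_compact hΦ.smooth hΦ.compact).exists_bound_dv_dv
  have hdiff : Differentiable ℝ Φ := hΦ.smooth.differentiable (by simp)
  have hpos : ∀ n : ℕ, (0 : ℝ) < (n : ℝ) + 1 := fun n => by positivity
  have hdv : ∀ (n : ℕ) (i : Fin d),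
      dv i (fun x => ((n : ℝ) + 1) ^ 2 * Φ (((n : ℝ) + 1)⁻¹ • x)) =
      fun x => ((n : ℝ) + 1) * dv i Φ (((n : ℝ) + 1)⁻¹ • x) := fun n i => by
    rw [dv_comp_smul hdiff]
    have := (hpos n).ne'
    funext x
    congr 1
    field_simp
  refine ⟨fun n x => ((n : ℝ) + 1) ^ 2 * Φ (((n : ℝ) + 1)⁻¹ • x), K, fun n => ?_, fun n => ?_,
    fun n x => ?_, fun n x => ?_, fun x => ?_, fun n x => ?_, fun n i j x => ?_, fun n x => ?_⟩
  · exact contDiff_const.mul (hΦ.smooth.comp (contDiff_const_smul _))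
  · exact (hasCompactSupport_comp_smul hΦ.compact (inv_ne_zero (hpos n).ne')).mul_left
  · exact mul_nonneg (by positivity) (hΦ.nonneg _)
  · have h1 := hΦ.le (((n : ℝ) + 1)⁻¹ • x)
    rw [norm_smul, norm_inv, Real.norm_of_nonneg (hpos n).le] at h1
    have := (hpos n).ne'
    calc ((n : ℝ) + 1) ^ 2 * Φ (((n : ℝ) + 1)⁻¹ • x)
        ≤ ((n : ℝ) + 1) ^ 2 * (1 / 2 * (((n : ℝ) + 1)⁻¹ * ‖x‖) ^ 2) := by gcongr
      _ = 1 / 2 * ‖x‖ ^ 2 := by field_simp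
  · filter_upwards [eventually_norm_lt x] with n hn
    have : ∀ᶠ y in nhds x, ‖y‖ < (n : ℝ) + 1 :=
      continuous_norm.continuousAt.eventually (gt_mem_nhds hn)
    filter_upwards [this] with y hy
    have h0 := (hpos n).ne'
    rw [hΦ.eq _ (norm_inv_smul_lt_one hy), norm_smul, norm_inv, Real.norm_of_nonneg (hpos n).le]
    field_simp
  · have e1 : grad (fun x => ((n : ℝ) + 1) ^ 2 * Φ (((n : ℝ) + 1)⁻¹ • x)) x =
        ((n : ℝ) + 1) • grad Φ (((n : ℝ) + 1)⁻¹ • x) := by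
      ext i
      rw [grad_apply, hdv]
      simp [grad_apply]
    rw [e1, norm_smul, mul_pow, Real.norm_eq_abs, sq_abs]
    have := mul_le_mul_of_nonneg_left (hΦ.grad_le (((n : ℝ) + 1)⁻¹ • x))
      (sq_nonneg ((n : ℝ) + 1))
    linarith
  · rw [hdv, dv_comp_smul ((contDiff_dv hΦ.smooth i).differentiable (by simp)),
      mul_inv_cancel₀ (hpos n).ne']
    simp only [one_mul]
    exact hK 0 i j _
  · have h0 := (hpos n).ne'
    have e1 : lap (fun x => ((n : ℝ) + 1) ^ 2 * Φ (((n : ℝ) + 1)⁻¹ • x)) =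
        fun x => 1 * lap Φ (((n : ℝ) + 1)⁻¹ • x) := by
      rw [lap_comp_smul hΦ.smooth]
      funext y
      congr 1
      field_simp
    rw [e1, lap_comp_smul (contDiff_lap hΦ.smooth), abs_mul]
    refine (mul_le_of_le_one_left (abs_nonneg _) ?_).trans (hK' 0 _)
    have hi : ((n : ℝ) + 1)⁻¹ ≤ 1 := inv_le_one_of_one_le₀ (by
      have : (0 : ℝ) ≤ n := n.cast_nonneg
      linarith)
    have hi0 : 0 ≤ ((n : ℝ) + 1)⁻¹ := (inv_pos.2 (hpos n)).le
    rw [one_mul, abs_of_nonneg (mul_nonneg hi0 hi0)]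
    exact mul_le_one₀ hi hi0 hi

lemma dv_half_norm_sq {d : ℕ} (i : Fin d) :
    dv i (fun x : E d => 1 / 2 * ‖x‖ ^ 2) = fun x => x i := by
  funext x
  have hn : HasFDerivAt (fun x : E d => 1 / 2 * ‖x‖ ^ 2) ((1 / 2 : ℝ) • (2 • innerSL ℝ x)) x :=
    ((hasStrictFDerivAt_norm_sq x).hasFDerivAt).const_mul (1 / 2)
  have : inner ℝ x (e i) = x i := by rw [real_inner_comm, inner_e]
  rw [dv, hn.fderiv]
  simp [this]

lemma dv_dv_half_norm_sq {d : ℕ} (i j : Fin d) :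
    dv j (dv i (fun x : E d => 1 / 2 * ‖x‖ ^ 2)) = fun _ => if i = j then 1 else 0 := by
  funext x
  rw [dv_half_norm_sq, dv]
  have h : HasFDerivAt (fun x : E d => x i) (EuclideanSpace.proj (𝕜 := ℝ) i) x :=
    (EuclideanSpace.proj (𝕜 := ℝ) i).hasFDerivAt
  rw [h.fderiv]
  simp [e]

lemma lap_half_norm_sq {d : ℕ} : lap (fun x : E d => 1 / 2 * ‖x‖ ^ 2) = fun _ => (d : ℝ) := by
  funext x
  simp only [lap, dv_dv_half_norm_sq]
  simp

lemma lap_lap_half_norm_sq {d : ℕ} :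
    lap (lap (fun x : E d => 1 / 2 * ‖x‖ ^ 2)) = fun _ => 0 := by
  rw [lap_half_norm_sq]
  funext x
  have h : ∀ i : Fin d, dv i (fun _ : E d => (d : ℝ)) = fun _ => 0 := fun i => by
    funext y
    simp [dv]
  simp only [lap, h]
  simp [dv]

lemma integral_norm_sq_eq {d : ℕ} {V : ℝ → E d → E d} {C : ℝ} {t : ℝ}
    (hV : ∀ i j : Fin d, IsDensity (fun t x => V t x i * V t x j) C) :
    ∑ i : Fin d, ∑ j : Fin d, pair (fun t x => V t x i * V t x j)
      (fun _ => if i = j then 1 else 0) t = ∫ x, ‖V t x‖ ^ 2 := by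
  have h1 : ∀ i j : Fin d, pair (fun t x => V t x i * V t x j)
      (fun _ => if i = j then 1 else 0) t = if i = j then ∫ x, V t x i * V t x i else 0 :=
    fun i j => by
      unfold pair
      split_ifs with h
      · subst h; simp
      · simp
  simp only [h1, Finset.sum_ite_eq, Finset.mem_univ, if_true]
  rw [← integral_finsetSum _ fun i _ => (hV i i).int t]
  congr 1
  funext x
  rw [EuclideanSpace.norm_sq_eq]
  exact Finset.sum_congr rfl fun i _ => by rw [Real.norm_eq_abs, sq_abs, sq]

/-- For the full quadratic weight the Hessian is the identity and the bilaplacian vanishes, so the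
dispersive term disappears. -/
lemma RegularFields.stress_half_norm_sq {d : ℕ} {γ M S : ℝ} {R : ℝ → E d → ℝ}
    {G Λ : ℝ → E d → E d} (reg : RegularFields γ M S R G Λ) (t : ℝ) :
    stress γ R G Λ (fun x => 1 / 2 * ‖x‖ ^ 2) t =
      (∫ x, ‖Λ t x‖ ^ 2) + (∫ x, ‖G t x‖ ^ 2) + d * ∫ x, pressure γ (rho R t x) := by
  rw [stress]
  rw [lap_lap_half_norm_sq, lap_half_norm_sq]
  simp only [dv_dv_half_norm_sq, Finset.sum_add_distrib]
  rw [integral_norm_sq_eq reg.density_ΛΛ_coord, integral_norm_sq_eq reg.density_GG_coord]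
  simp only [pair, mul_zero, integral_zero, integral_mul_const]
  ring

end Truncation

/-! ### The pseudo-conformal estimate -/

section Virial

variable {d : ℕ} {γ M S : ℝ} {T : EReal} {ρ₀ : E d → ℝ} {R : ℝ → E d → ℝ} {G Λ : ℝ → E d → E d}
  {φ : E d → ℝ}

lemma isPrimitive_id (T : EReal) : IsPrimitive T (fun t => t) (fun _ => 1) 0 :=
  Filter.Eventually.of_forall fun t => by simp

/-- In `V - tF` the two flux contributions to the derivative cancel. The factor `t` also annihilates
the initial flux, so only the initial density enters. -/
lemma WeakEquations.isPrimitive_virial (weq : WeakEquations γ T ρ₀ R G Λ) (hT : 0 < T)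
    (reg : RegularFields γ M S R G Λ) (hγ : 1 < γ) (hφ : ContDiff ℝ ∞ φ)
    (hc : HasCompactSupport φ) :
    IsPrimitive T (fun t => pair (rho R) φ t - t * flux R Λ φ t)
      (fun s => -(stress γ R G Λ φ s * s)) (∫ x, ρ₀ x * φ x) := by
  have hu := unifSmooth_const_of_compact hφ hc
  obtain ⟨K, hK⟩ := hu.exists_bound_dv
  obtain ⟨K', hK', hK''⟩ := hu.exists_bound_dv_dv
  obtain ⟨K₀, hK₀⟩ := bdd_of_compact hφ hc
  have lF : LocallyIntegrable (flux R Λ φ) :=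
    locallyIntegrable_of_bdd (reg.measurable_flux hφ (hK 0)) (reg.abs_flux_le hφ (hK 0))
  have lX : LocallyIntegrable (stress γ R G Λ φ) :=
    locallyIntegrable_of_bdd (reg.measurable_stress hγ hφ (hK' 0) (hK'' 0))
      (reg.abs_stress_le hγ hφ (hK' 0) (hK'' 0))
  have lV : LocallyIntegrable (pair (rho R) φ) :=
    locallyIntegrable_of_bdd (reg.density_rho.measurable_pair hφ.continuous hK₀)
      (reg.density_rho.abs_pair_le hφ.continuous hK₀)
  have hV := isPrimitive_of_weak hT lV lF fun χ hχ => weq.mass φ hφ hc χ hχ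
  obtain ⟨j₀, hj⟩ := weq.momentum φ hφ hc
  have hW := isPrimitive_of_weak hT lF lX hj
  have hm := (isPrimitive_id T).mul hW (locallyIntegrable_const 1) lX
  filter_upwards [hV, hm] with t h1 h2
  have i1 := LocallyIntegrable.intervalIntegrable' lF 0 t
  have i2 : IntervalIntegrable (fun s => s * stress γ R G Λ φ s) volume 0 t :=
    (LocallyIntegrable.intervalIntegrable' lX 0 t).continuousOn_mul continuousOn_id
  rw [h1, h2]
  simp only [one_mul]
  rw [intervalIntegral.integral_add i1 i2, intervalIntegral.integral_neg]
  simp only [mul_comm (stress γ R G Λ φ _)]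
  ring

/-- Expanding the square gives `½ρ|∇φ|²` where the right side has `ρφ`; the hypothesis on the
gradient is exactly the comparison required. -/
lemma RegularFields.lintegral_square_le (reg : RegularFields γ M S R G Λ) (hφ : ContDiff ℝ ∞ φ)
    (hc : HasCompactSupport φ) (hg : ∀ x, ‖grad φ x‖ ^ 2 ≤ 2 * φ x) (t : ℝ) :
    0 ≤ pair (rho R) φ t - t * flux R Λ φ t + t ^ 2 / 2 * ∫ x, ‖Λ t x‖ ^ 2 ∧
    ∫⁻ x, ENNReal.ofReal (1 / 2 * ‖t • Λ t x - R t x • grad φ x‖ ^ 2) ≤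
      ENNReal.ofReal (pair (rho R) φ t - t * flux R Λ φ t + t ^ 2 / 2 * ∫ x, ‖Λ t x‖ ^ 2) := by
  have hu := unifSmooth_const_of_compact hφ hc
  obtain ⟨K, hK⟩ := hu.exists_bound_dv
  obtain ⟨K₀, hK₀⟩ := bdd_of_compact hφ hc
  have i1 := (reg.density_rho.mul_bdd hφ.continuous hK₀).int t
  have i2 : ∀ i ∈ Finset.univ, Integrable fun x => R t x * Λ t x i * dv i φ x := fun i _ =>
    ((reg.density_mom_coord i).mul_bdd (contDiff_dv hφ i).continuous (hK 0 i)).int t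
  have i2' : Integrable fun x => ∑ i, R t x * Λ t x i * dv i φ x := integrable_finsetSum _ i2
  have i12 : Integrable fun x => rho R t x * φ x - t * ∑ i, R t x * Λ t x i * dv i φ x :=
    i1.sub (i2'.const_mul t)
  have i3 := (reg.int_Λ t).const_mul (t ^ 2 / 2)
  have e1 : pair (rho R) φ t - t * flux R Λ φ t + t ^ 2 / 2 * ∫ x, ‖Λ t x‖ ^ 2 =
      ∫ x, ((rho R t x * φ x - t * ∑ i, R t x * Λ t x i * dv i φ x)
        + t ^ 2 / 2 * ‖Λ t x‖ ^ 2) := by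
    rw [integral_add i12 i3, integral_sub i1 (i2'.const_mul t), integral_const_mul,
      integral_const_mul, integral_finsetSum _ i2]
    rfl
  have hle : ∀ x, 1 / 2 * ‖t • Λ t x - R t x • grad φ x‖ ^ 2 ≤
      (rho R t x * φ x - t * ∑ i, R t x * Λ t x i * dv i φ x) + t ^ 2 / 2 * ‖Λ t x‖ ^ 2 :=
    fun x => by
      have e2 : ∑ i, R t x * Λ t x i * dv i φ x = R t x * inner ℝ (Λ t x) (grad φ x) := by
        rw [inner_eq_sum, Finset.mul_sum]
        exact Finset.sum_congr rfl fun i _ => by rw [grad_apply]; ring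
      rw [e2, norm_sub_sq_real, norm_smul, norm_smul, inner_smul_left, inner_smul_right, mul_pow,
        mul_pow, Real.norm_eq_abs, Real.norm_eq_abs, sq_abs, sq_abs]
      have h1 := mul_le_mul_of_nonneg_left (hg x) (sq_nonneg (R t x))
      simp only [rho, conj_trivial]
      linarith
  have h0 : ∀ x, 0 ≤ (rho R t x * φ x - t * ∑ i, R t x * Λ t x i * dv i φ x)
      + t ^ 2 / 2 * ‖Λ t x‖ ^ 2 := fun x => le_trans (by positivity) (hle x)
  rw [e1]
  refine ⟨integral_nonneg h0, ?_⟩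
  rw [ofReal_integral_eq_lintegral_ofReal (f := fun x => _ + _) (i12.add i3)
    (Filter.Eventually.of_forall h0)]
  exact lintegral_mono fun x => ENNReal.ofReal_le_ofReal (hle x)

lemma integral_mul_le_of_moment {K : ℝ≥0} (hK : ∫⁻ x, ENNReal.ofReal (‖x‖ ^ 2 * ρ₀ x) ≤ K)
    (hρ : LocallyIntegrable ρ₀) (hφ : ContDiff ℝ ∞ φ) (hc : HasCompactSupport φ)
    (h0 : ∀ x, 0 ≤ φ x) (hle : ∀ x, φ x ≤ 1 / 2 * ‖x‖ ^ 2) :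
    ∫ x, ρ₀ x * φ x ≤ K / 2 := by
  have hi : Integrable fun x => ρ₀ x * φ x := by
    have := hρ.integrable_smul_right_of_hasCompactSupport hφ.continuous hc
    simpa using this
  -- The moment hypothesis sees only the positive part of `ρ₀`, so the comparison goes through
  -- positive parts.
  have h1 : ∫ x, ρ₀ x * φ x ≤ ∫ x, max (ρ₀ x * φ x) 0 :=
    integral_mono hi hi.pos_part fun x => le_max_left _ _
  have h2 : ∫⁻ x, ENNReal.ofReal (max (ρ₀ x * φ x) 0) ≤ ENNReal.ofReal (K / 2) := by
    calc ∫⁻ x, ENNReal.ofReal (max (ρ₀ x * φ x) 0)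
        ≤ ∫⁻ x, ENNReal.ofReal (1 / 2) * ENNReal.ofReal (‖x‖ ^ 2 * ρ₀ x) := by
          refine lintegral_mono fun x => ?_
          rw [← ENNReal.ofReal_mul (by norm_num)]
          rcases le_total 0 (ρ₀ x) with h | h
          · refine ENNReal.ofReal_le_ofReal (max_le ?_ (by positivity))
            have := mul_le_mul_of_nonneg_left (hle x) h
            linarith
          · rw [max_eq_right (mul_nonpos_of_nonpos_of_nonneg h (h0 x))]
            simp
      _ = ENNReal.ofReal (1 / 2) * ∫⁻ x, ENNReal.ofReal (‖x‖ ^ 2 * ρ₀ x) :=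
          lintegral_const_mul' _ _ ENNReal.ofReal_ne_top
      _ ≤ ENNReal.ofReal (1 / 2) * K := by gcongr
      _ = ENNReal.ofReal (K / 2) := by
          rw [← ENNReal.ofReal_coe_nnreal, ← ENNReal.ofReal_mul (by norm_num)]
          congr 1
          ring
  exact h1.trans (integrable_of_lintegral_le hi.pos_part.aestronglyMeasurable
    (fun x => le_max_right _ _) (by positivity) h2).2

/-- The virial rate for the weight `½|x|²`. -/
def virialRate (γ : ℝ) (R : ℝ → E d → ℝ) (G Λ : ℝ → E d → E d) (t : ℝ) : ℝ :=
  (∫ x, ‖Λ t x‖ ^ 2) + (∫ x, ‖G t x‖ ^ 2) + d * ∫ x, pressure γ (rho R t x)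

/-- Removes the truncation: the stresses are bounded uniformly in `n` and converge for each time, so
their time integrals converge, while Fatou handles the square. Finiteness of the second moment at
later times is never presupposed. -/
lemma WeakEquations.lintegral_moment_le (weq : WeakEquations γ T ρ₀ R G Λ) (hT : 0 < T)
    (reg : RegularFields γ M S R G Λ) (hγ : 1 < γ) (hρ : LocallyIntegrable ρ₀) {K : ℝ≥0}
    (hK : ∫⁻ x, ENNReal.ofReal (‖x‖ ^ 2 * ρ₀ x) ≤ K) :
    ∀ᵐ t ∂(volume.restrict (timeInterval T)),
      0 ≤ K / 2 - (∫ s in (0 : ℝ)..t, virialRate γ R G Λ s * s) + t ^ 2 / 2 * ∫ x, ‖Λ t x‖ ^ 2 ∧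
      ∫⁻ x, ENNReal.ofReal (1 / 2 * ‖t • Λ t x - R t x • x‖ ^ 2) ≤
        ENNReal.ofReal (K / 2 - (∫ s in (0 : ℝ)..t, virialRate γ R G Λ s * s)
          + t ^ 2 / 2 * ∫ x, ‖Λ t x‖ ^ 2) := by
  obtain ⟨u, B, hu⟩ := exists_isVirialWeight d
  have hall := ae_all_iff.2 fun n =>
    weq.isPrimitive_virial hT reg hγ (hu.smooth n) (hu.compact n)
  filter_upwards [hall, ae_restrict_mem (measurableSet_timeInterval T)] with t ht htI
  set a : ℕ → ℝ := fun n => K / 2 - (∫ s in (0 : ℝ)..t, stress γ R G Λ (u n) s * s)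
    + t ^ 2 / 2 * ∫ x, ‖Λ t x‖ ^ 2 with ha
  have hlim : Filter.Tendsto a Filter.atTop (nhds (K / 2 -
      (∫ s in (0 : ℝ)..t, virialRate γ R G Λ s * s) + t ^ 2 / 2 * ∫ x, ‖Λ t x‖ ^ 2)) := by
    refine (tendsto_const_nhds.sub ?_).add_const _
    simp only [intervalIntegral.integral_of_le htI.1.le]
    refine tendsto_integral_mul_of_bdd
      (fun n => reg.measurable_stress hγ (hu.smooth n) (hu.dv_dv_le n) (hu.lap_lap_le n))
      (fun n => reg.abs_stress_le hγ (hu.smooth n) (hu.dv_dv_le n) (hu.lap_lap_le n))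
      (continuous_id.integrableOn_Ioc) fun s => ?_
    have := reg.tendsto_stress hγ hu.smooth hu.eventuallyEq hu.dv_dv_le hu.lap_lap_le s
    rw [reg.stress_half_norm_sq] at this
    exact this
  have hle : ∀ n, pair (rho R) (u n) t - t * flux R Λ (u n) t
      + t ^ 2 / 2 * ∫ x, ‖Λ t x‖ ^ 2 ≤ a n := fun n => by
    have h1 := ht n
    simp only [intervalIntegral.integral_neg] at h1
    have h2 := integral_mul_le_of_moment hK hρ (hu.smooth n) (hu.compact n) (hu.nonneg n)
      (hu.le n)
    simp only [ha]
    linarith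
  have hsq := fun n => reg.lintegral_square_le (hu.smooth n) (hu.compact n) (hu.grad_le n) t
  refine ⟨ge_of_tendsto' hlim fun n => (hsq n).1.trans (hle n), ?_⟩
  have hpt : ∀ x, Filter.Tendsto (fun n => ENNReal.ofReal
      (1 / 2 * ‖t • Λ t x - R t x • grad (u n) x‖ ^ 2)) Filter.atTop
      (nhds (ENNReal.ofReal (1 / 2 * ‖t • Λ t x - R t x • x‖ ^ 2))) := fun x => by
    refine tendsto_const_nhds.congr' ?_
    have : ∀ᶠ n in Filter.atTop, ∀ i : Fin d, dv i (u n) x = x i := by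
      rw [Filter.eventually_all]
      intro i
      filter_upwards [(hu.eventuallyEq.dv i) x] with n hn
      rw [hn.eq_of_nhds, dv_half_norm_sq]
    filter_upwards [this] with n hn
    have : grad (u n) x = x := by
      ext i
      rw [grad_apply, hn]
    rw [this]
  calc ∫⁻ x, ENNReal.ofReal (1 / 2 * ‖t • Λ t x - R t x • x‖ ^ 2)
      = ∫⁻ x, Filter.liminf (fun n => ENNReal.ofReal
        (1 / 2 * ‖t • Λ t x - R t x • grad (u n) x‖ ^ 2)) Filter.atTop :=
        lintegral_congr fun x => (hpt x).liminf_eq.symm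
    _ ≤ Filter.liminf (fun n => ∫⁻ x, ENNReal.ofReal
        (1 / 2 * ‖t • Λ t x - R t x • grad (u n) x‖ ^ 2)) Filter.atTop := by
        refine lintegral_liminf_le fun n => ?_
        have m1 : Measurable fun x => Λ t x := reg.meas_Λ.comp measurable_prodMk_left
        have m2 : Measurable fun x => R t x := reg.meas_R.comp measurable_prodMk_left
        have m3 : Measurable (grad (u n)) := (contDiff_grad (hu.smooth n)).continuous.measurable
        exact ((((m1.const_smul t).sub (m2.smul m3)).norm.pow_const 2).const_mul _).ennreal_ofReal
    _ ≤ Filter.liminf (fun n => ENNReal.ofReal (a n)) Filter.atTop :=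
        Filter.liminf_le_liminf (Filter.Eventually.of_forall fun n =>
          (hsq n).2.trans (ENNReal.ofReal_le_ofReal (hle n)))
    _ = _ := (ENNReal.tendsto_ofReal hlim).liminf_eq

end Virial

/-! ### Decay -/

section Gronwall

/-- Gronwall's inequality for `y(t) ≤ A + c ∫ y(s)/s ds`. -/
lemma le_rpow_of_integral_le {Y : ℝ → ℝ} (hY : Continuous Y) {c t₀ : ℝ} (hc : 0 ≤ c)
    (ht₀ : 0 < t₀) {t : ℝ} (ht : t₀ ≤ t)
    (h : ∀ r ∈ Set.Icc t₀ t, Y r ≤ Y t₀ + c * ∫ s in t₀..r, Y s / s) :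
    Y t ≤ Y t₀ * (t / t₀) ^ c := by
  set U : ℝ → ℝ := fun r => Y t₀ + c * ∫ s in t₀..r, Y s / s with hU
  have hq : ContinuousOn (fun s => Y s / s) (Set.Ioi 0) :=
    hY.continuousOn.div continuousOn_id fun s hs => (ne_of_gt hs)
  have hUd : ∀ r, 0 < r → HasDerivAt U (c * (Y r / r)) r := fun r hr => by
    have hi : IntervalIntegrable (fun s => Y s / s) volume t₀ r := by
      refine (hq.mono fun s hs => ?_).intervalIntegrable
      exact lt_of_lt_of_le (lt_min ht₀ hr) hs.1
    have := intervalIntegral.integral_hasDerivAt_right hi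
      (hq.stronglyMeasurableAtFilter isOpen_Ioi r hr) (hq.continuousAt (Ioi_mem_nhds hr))
    exact (this.const_mul c).const_add _
  have hZd : ∀ r, 0 < r → HasDerivAt (fun r => U r * r ^ (-c))
      (c * (Y r / r) * r ^ (-c) + U r * (-c * r ^ (-c - 1))) r := fun r hr =>
    (hUd r hr).mul (Real.hasDerivAt_rpow_const (Or.inl hr.ne'))
  -- The derivative is `c r^(-c-1) (Y - U)`, and the hypothesis says `Y ≤ U`.
  have hanti : AntitoneOn (fun r => U r * r ^ (-c)) (Set.Icc t₀ t) := by
    refine antitoneOn_of_deriv_nonpos (convex_Icc _ _)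
      (fun r hr => (hZd r (ht₀.trans_le hr.1)).continuousAt.continuousWithinAt)
      (fun r hr => ?_) fun r hr => ?_
    · rw [interior_Icc] at hr
      exact (hZd r (ht₀.trans hr.1)).differentiableAt.differentiableWithinAt
    · rw [interior_Icc] at hr
      have hr0 := ht₀.trans hr.1
      rw [(hZd r hr0).deriv, Real.rpow_sub_one hr0.ne']
      have h1 := h r ⟨hr.1.le, hr.2.le⟩
      have h2 : 0 ≤ c * (r ^ (-c) / r) := by positivity
      have h3 := mul_le_mul_of_nonneg_right h1 h2
      have e1 : c * (Y r / r) * r ^ (-c) = Y r * (c * (r ^ (-c) / r)) := by ring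
      have e2 : U r * (-c * (r ^ (-c) / r)) = -(U r * (c * (r ^ (-c) / r))) := by ring
      rw [e1, e2]
      simp only [hU]
      linarith
  have ht0 := ht₀.trans_le ht
  have h1 := hanti ⟨le_rfl, ht⟩ ⟨ht, le_rfl⟩ ht
  have e0 : U t₀ = Y t₀ := by simp [hU]
  simp only [e0] at h1
  have h2 : U t ≤ Y t₀ * (t / t₀) ^ c := by
    rw [Real.div_rpow ht0.le ht₀.le]
    rw [Real.rpow_neg ht0.le, Real.rpow_neg ht₀.le, ← div_eq_mul_inv, ← div_eq_mul_inv,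
      div_le_iff₀ (Real.rpow_pos_of_pos ht0 c)] at h1
    calc U t ≤ _ := h1
      _ = _ := by ring
  exact (h t ⟨ht, le_rfl⟩).trans h2

end Gronwall

/-! ### Energy monotonicity and the pseudo-conformal inequality. -/

section Energy

variable {d : ℕ} {γ M S : ℝ} {T : EReal} {ρ₀ : E d → ℝ} {R : ℝ → E d → ℝ} {G Λ : ℝ → E d → E d}

/-- The internal part of the energy. -/
def potential (γ : ℝ) (R : ℝ → E d → ℝ) (t : ℝ) : ℝ := (∫ x, rho R t x ^ γ) / γ

/-- The energy as a real number. -/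
def totalEnergy (γ : ℝ) (R : ℝ → E d → ℝ) (G Λ : ℝ → E d → E d) (t : ℝ) : ℝ :=
  1 / 2 * (∫ x, ‖G t x‖ ^ 2) + 1 / 2 * (∫ x, ‖Λ t x‖ ^ 2) + potential γ R t

lemma RegularFields.energy_eq (reg : RegularFields γ M S R G Λ) (hγ : 1 < γ) (t : ℝ) :
    energy γ R G Λ t = ENNReal.ofReal (totalEnergy γ R G Λ t) := by
  have i1 := (reg.int_G t).const_mul (1 / 2)
  have i2 := (reg.int_Λ t).const_mul (1 / 2)
  have i3 := (reg.int_pow t).div_const γ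
  have i12 : Integrable fun x => 1 / 2 * ‖G t x‖ ^ 2 + 1 / 2 * ‖Λ t x‖ ^ 2 := i1.add i2
  have e1 : totalEnergy γ R G Λ t =
      ∫ x, (1 / 2 * ‖G t x‖ ^ 2 + 1 / 2 * ‖Λ t x‖ ^ 2 + rho R t x ^ γ / γ) := by
    rw [integral_add i12 i3, integral_add i1 i2, integral_const_mul, integral_const_mul,
      integral_div]
    rfl
  rw [e1, ofReal_integral_eq_lintegral_ofReal (f := fun x => _ + _) (i12.add i3)
    (Filter.Eventually.of_forall fun x => ?_)]
  · refine lintegral_congr fun x => ?_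
    rw [internalEnergy_eq hγ (rho_nonneg R t x)]
  · have := Real.rpow_nonneg (rho_nonneg R t x) γ
    have : 0 < γ := by linarith
    show 0 ≤ _
    positivity

lemma RegularFields.density_pow (reg : RegularFields γ M S R G Λ) :
    IsDensity (fun t x => rho R t x ^ γ) S where
  meas := (reg.meas_R.pow_const 2).pow_const γ
  int := reg.int_pow
  le t := by
    refine le_trans (le_of_eq ?_) (reg.le_pow t)
    exact integral_congr_ae (Filter.Eventually.of_forall fun x =>
      abs_of_nonneg (Real.rpow_nonneg (rho_nonneg R t x) γ))

lemma RegularFields.measurable_potential (reg : RegularFields γ M S R G Λ) :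
    Measurable (potential γ R) := reg.density_pow.measurable_integral.div_const γ

lemma potential_nonneg (hγ : 1 < γ) (R : ℝ → E d → ℝ) (t : ℝ) : 0 ≤ potential γ R t :=
  div_nonneg (integral_nonneg fun x => Real.rpow_nonneg (rho_nonneg R t x) γ) (by linarith)

lemma RegularFields.potential_le (reg : RegularFields γ M S R G Λ) (hγ : 1 < γ) (t : ℝ) :
    potential γ R t ≤ S / γ := div_le_div_of_nonneg_right (reg.le_pow t) (by linarith)

lemma measurable_integral_norm_sq {V : ℝ → E d → E d}
    (hV : Measurable fun z : ℝ × E d => V z.1 z.2) : Measurable fun t => ∫ x, ‖V t x‖ ^ 2 := by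
  have : Measurable fun z : ℝ × E d => ‖V z.1 z.2‖ ^ 2 := hV.norm.pow_const 2
  exact this.stronglyMeasurable.integral_prod_right.measurable

lemma RegularFields.measurable_totalEnergy (reg : RegularFields γ M S R G Λ) :
    Measurable (totalEnergy γ R G Λ) :=
  (((measurable_integral_norm_sq reg.meas_G).const_mul _).add
    ((measurable_integral_norm_sq reg.meas_Λ).const_mul _)).add reg.measurable_potential

lemma totalEnergy_nonneg (hγ : 1 < γ) (R : ℝ → E d → ℝ) (G Λ : ℝ → E d → E d) (t : ℝ) :
    0 ≤ totalEnergy γ R G Λ t := by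
  have h1 : 0 ≤ ∫ x, ‖G t x‖ ^ 2 := integral_nonneg fun x => sq_nonneg _
  have h2 : 0 ≤ ∫ x, ‖Λ t x‖ ^ 2 := integral_nonneg fun x => sq_nonneg _
  have h3 := potential_nonneg hγ R t
  rw [totalEnergy]
  positivity

lemma RegularFields.totalEnergy_le (reg : RegularFields γ M S R G Λ) (hγ : 1 < γ) (t : ℝ) :
    totalEnergy γ R G Λ t ≤ M ^ 2 + S / γ := by
  have h1 := reg.le_G t
  have h2 := reg.le_Λ t
  have h3 := reg.potential_le hγ t
  rw [totalEnergy]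
  linarith

/-- The power law makes the pressure integral equal to `(γ - 1)` times the internal energy; the
remaining quadratic terms are twice the total energy minus twice the internal one. -/
lemma virialRate_eq (hγ : 1 < γ) (R : ℝ → E d → ℝ) (G Λ : ℝ → E d → E d) (t : ℝ) :
    virialRate γ R G Λ t =
      2 * totalEnergy γ R G Λ t - (2 - d * (γ - 1)) * potential γ R t := by
  have hγ0 : γ ≠ 0 := by linarith
  simp only [virialRate, totalEnergy, potential, pressure, integral_const_mul]
  field_simp
  ring

/-- The order of the two almost-everywhere quantifiers is exchanged by Fubini, which needs the
measurability in time provided by regular fields. The later time is then fixed first, as required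
for integrating over earlier ones. -/
lemma ae_totalEnergy_le (hγ : 1 < γ) (reg : RegularFields γ M S R G Λ)
    (h : EnergyNonincreasing γ T R G Λ) :
    ∀ᵐ t ∂(volume.restrict (timeInterval T)), ∀ᵐ s ∂(volume.restrict (timeInterval T)),
      s ≤ t → totalEnergy γ R G Λ t ≤ totalEnergy γ R G Λ s := by
  have hm := reg.measurable_totalEnergy
  have hset : MeasurableSet {z : ℝ × ℝ | z.1 ≤ z.2 →
      totalEnergy γ R G Λ z.2 ≤ totalEnergy γ R G Λ z.1} := by
    simp only [imp_iff_not_or, not_le]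
    exact (measurableSet_lt measurable_snd measurable_fst).union
      (measurableSet_le (hm.comp measurable_snd) (hm.comp measurable_fst))
  refine (Measure.ae_ae_comm (p := fun s t => s ≤ t →
    totalEnergy γ R G Λ t ≤ totalEnergy γ R G Λ s) hset).1 ?_
  filter_upwards [h] with s hs
  filter_upwards [hs] with t ht hst
  have := ht hst
  rw [reg.energy_eq hγ, reg.energy_eq hγ] at this
  exact (ENNReal.ofReal_le_ofReal_iff (totalEnergy_nonneg hγ R G Λ s)).1 this

/-- The pseudo-conformal energy. -/
def conformal (γ : ℝ) (R : ℝ → E d → ℝ) (G Λ : ℝ → E d → E d) (t : ℝ) : ℝ :=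
  1 / 2 * (∫ x, ‖t • Λ t x - R t x • x‖ ^ 2)
    + t ^ 2 * (1 / 2 * (∫ x, ‖G t x‖ ^ 2) + potential γ R t)

/-- Inserting the virial rate leaves `-2∫ sE(s) ds`, which monotonicity bounds by `-t²E(t)`; this
cancels the kinetic term from the square and leaves the gradient and internal energies on the left.
-/
lemma WeakEquations.conformal_le (weq : WeakEquations γ T ρ₀ R G Λ) (hT : 0 < T)
    (reg : RegularFields γ M S R G Λ) (hγ : 1 < γ) (hρ : LocallyIntegrable ρ₀) {K : ℝ≥0}
    (hK : ∫⁻ x, ENNReal.ofReal (‖x‖ ^ 2 * ρ₀ x) ≤ K) (hE : EnergyNonincreasing γ T R G Λ) :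
    ∀ᵐ t ∂(volume.restrict (timeInterval T)),
      Integrable (fun x => ‖t • Λ t x - R t x • x‖ ^ 2) ∧
      conformal γ R G Λ t ≤
        K / 2 + (2 - d * (γ - 1)) * ∫ s in (0 : ℝ)..t, potential γ R s * s := by
  filter_upwards [weq.lintegral_moment_le hT reg hγ hρ hK, ae_totalEnergy_le hγ reg hE,
    ae_restrict_mem (measurableSet_timeInterval T)] with t ⟨h0, h1⟩ h2 htI
  have m1 : Measurable fun x => Λ t x := reg.meas_Λ.comp measurable_prodMk_left
  have m2 : Measurable fun x => R t x := reg.meas_R.comp measurable_prodMk_left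
  have m3 : Measurable fun x => 1 / 2 * ‖t • Λ t x - R t x • x‖ ^ 2 :=
    (((m1.const_smul t).sub (m2.smul measurable_id)).norm.pow_const 2).const_mul _
  obtain ⟨hi, hle⟩ := integrable_of_lintegral_le m3.aestronglyMeasurable
    (fun x => by positivity) h0 h1
  have hi' : Integrable fun x => ‖t • Λ t x - R t x • x‖ ^ 2 := by
    refine (hi.const_mul 2).congr (Filter.Eventually.of_forall fun x => ?_)
    simp only
    ring
  refine ⟨hi', ?_⟩
  rw [integral_const_mul] at hle
  have lE : LocallyIntegrable (totalEnergy γ R G Λ) :=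
    locallyIntegrable_of_bdd reg.measurable_totalEnergy fun s => by
      rw [abs_of_nonneg (totalEnergy_nonneg hγ R G Λ s)]
      exact reg.totalEnergy_le hγ s
  have lP : LocallyIntegrable (potential γ R) :=
    locallyIntegrable_of_bdd reg.measurable_potential fun s => by
      rw [abs_of_nonneg (potential_nonneg hγ R s)]
      exact reg.potential_le hγ s
  have jE : IntervalIntegrable (fun s => totalEnergy γ R G Λ s * s) volume 0 t :=
    (LocallyIntegrable.intervalIntegrable' lE 0 t).mul_continuousOn continuousOn_id
  have jP : IntervalIntegrable (fun s => potential γ R s * s) volume 0 t :=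
    (LocallyIntegrable.intervalIntegrable' lP 0 t).mul_continuousOn continuousOn_id
  have e1 : ∫ s in (0 : ℝ)..t, virialRate γ R G Λ s * s =
      2 * (∫ s in (0 : ℝ)..t, totalEnergy γ R G Λ s * s)
        - (2 - d * (γ - 1)) * ∫ s in (0 : ℝ)..t, potential γ R s * s := by
    rw [← intervalIntegral.integral_const_mul, ← intervalIntegral.integral_const_mul,
      ← intervalIntegral.integral_sub (jE.const_mul _) (jP.const_mul _)]
    congr 1
    funext s
    rw [virialRate_eq hγ]
    ring
  -- Integrate `E(t) ≤ E(s)` against `s ds` over `(0, t)`.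
  have h3 : t ^ 2 * totalEnergy γ R G Λ t ≤
      2 * ∫ s in (0 : ℝ)..t, totalEnergy γ R G Λ s * s := by
    have e2 : ∫ s in (0 : ℝ)..t, totalEnergy γ R G Λ t * s =
        totalEnergy γ R G Λ t * (t ^ 2 / 2) := by
      rw [intervalIntegral.integral_const_mul, integral_id]
      ring
    have h4 : ∫ s in (0 : ℝ)..t, totalEnergy γ R G Λ t * s ≤
        ∫ s in (0 : ℝ)..t, totalEnergy γ R G Λ s * s := by
      refine intervalIntegral.integral_mono_ae_restrict htI.1.le
        ((continuous_const.mul continuous_id).intervalIntegrable 0 t) jE ?_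
      rw [← restrict_Ioc_eq_restrict_Icc]
      have hsub := ae_restrict_of_ae_restrict_of_subset (Ioc_subset_timeInterval htI) h2
      filter_upwards [hsub, ae_restrict_mem measurableSet_Ioc] with s hs hsI
      exact mul_le_mul_of_nonneg_right (hs hsI.2) hsI.1.le
    rw [e2] at h4
    linarith
  rw [e1] at hle
  have e3 : t ^ 2 * totalEnergy γ R G Λ t = t ^ 2 / 2 * (∫ x, ‖Λ t x‖ ^ 2)
      + t ^ 2 * (1 / 2 * (∫ x, ‖G t x‖ ^ 2) + potential γ R t) := by
    rw [totalEnergy]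
    ring
  rw [conformal]
  linarith

end Energy

section Decay

variable {d : ℕ} {γ M S : ℝ} {T : EReal} {ρ₀ : E d → ℝ} {R : ℝ → E d → ℝ} {G Λ : ℝ → E d → E d}

lemma two_sub_two_mul_decayRate (d : ℕ) (γ : ℝ) :
    2 - 2 * decayRate d γ = max 0 (2 - d * (γ - 1)) := by
  rw [decayRate]
  rcases le_total 1 ((d : ℝ) / 2 * (γ - 1)) with h | h
  · rw [min_eq_left h, max_eq_left (by linarith)]
    ring
  · rw [min_eq_right h, max_eq_right (by linarith)]
    ring

/-- The constant in the decay of the pseudo-conformal energy. -/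
def conformalConst (d : ℕ) (γ S K t₀ : ℝ) : ℝ :=
  (K / 2 + (2 - 2 * decayRate d γ) * (S / γ * (t₀ ^ 2 / 2))) / t₀ ^ (2 - 2 * decayRate d γ)

lemma conformalConst_nonneg (hγ : 1 < γ) (hS : 0 ≤ S) {K t₀ : ℝ} (hK : 0 ≤ K) (ht₀ : 0 < t₀) :
    0 ≤ conformalConst d γ S K t₀ := by
  have h1 : 0 ≤ 2 - 2 * decayRate d γ := by
    rw [two_sub_two_mul_decayRate]
    exact le_max_left _ _
  have h2 : 0 < γ := by linarith
  rw [conformalConst]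
  positivity

lemma WeakEquations.conformal_le_rpow (weq : WeakEquations γ T ρ₀ R G Λ) (hT : 0 < T)
    (reg : RegularFields γ M S R G Λ) (hγ : 1 < γ) (hρ : LocallyIntegrable ρ₀) {K : ℝ≥0}
    (hK : ∫⁻ x, ENNReal.ofReal (‖x‖ ^ 2 * ρ₀ x) ≤ K) (hE : EnergyNonincreasing γ T R G Λ)
    {t₀ : ℝ} (ht₀ : 0 < t₀) :
    ∀ᵐ t ∂(volume.restrict (timeInterval T)), t₀ ≤ t →
      Integrable (fun x => ‖t • Λ t x - R t x • x‖ ^ 2) ∧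
      conformal γ R G Λ t ≤ conformalConst d γ S K t₀ * t ^ (2 - 2 * decayRate d γ) := by
  have hae := weq.conformal_le hT reg hγ hρ hK hE
  have hP0 := potential_nonneg hγ R
  have lP : LocallyIntegrable (potential γ R) :=
    locallyIntegrable_of_bdd reg.measurable_potential fun s => by
      rw [abs_of_nonneg (hP0 s)]
      exact reg.potential_le hγ s
  have jP : ∀ a b : ℝ, IntervalIntegrable (fun s => potential γ R s * s) volume a b := fun a b =>
    (LocallyIntegrable.intervalIntegrable' lP a b).mul_continuousOn continuousOn_id
  have hS : 0 ≤ S := reg.density_pow.nonneg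
  filter_upwards [hae, ae_restrict_mem (measurableSet_timeInterval T)] with t ⟨hi, hle⟩ htI ht
  refine ⟨hi, ?_⟩
  have ht0 : 0 < t := htI.1
  have hint0 : ∀ r, 0 ≤ r → 0 ≤ ∫ s in (0 : ℝ)..r, potential γ R s * s := fun r hr =>
    intervalIntegral.integral_nonneg hr fun s hs => mul_nonneg (hP0 s) hs.1
  rw [conformalConst, two_sub_two_mul_decayRate]
  -- In the first case the integral term has a favourable sign and the bound is just `K / 2`; in the
  -- second the inequality has to be iterated.
  rcases le_total (2 - d * (γ - 1)) 0 with hc | hc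
  · rw [max_eq_left hc]
    have := mul_nonpos_of_nonpos_of_nonneg hc (hint0 t ht0.le)
    simp only [zero_mul, Real.rpow_zero, add_zero, div_one, mul_one]
    linarith
  · rw [max_eq_right hc]
    set c : ℝ := 2 - d * (γ - 1) with hcdef
    -- Gronwall is applied to this continuous majorant, since the pseudo-conformal energy is
    -- controlled only at almost every time.
    set Y : ℝ → ℝ := fun r => K / 2 + c * ∫ s in (0 : ℝ)..r, potential γ R s * s with hY
    have hYc : Continuous Y := continuous_const.add
      (continuous_const.mul (intervalIntegral.continuous_primitive jP 0))
    have hsub : Set.Ioc 0 t ⊆ timeInterval T := Ioc_subset_timeInterval htI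
    have hG : ∀ r ∈ Set.Icc t₀ t, Y r ≤ Y t₀ + c * ∫ s in t₀..r, Y s / s := fun r hr => by
      have e1 : Y r = Y t₀ + c * ∫ s in t₀..r, potential γ R s * s := by
        simp only [hY]
        rw [← intervalIntegral.integral_add_adjacent_intervals (jP 0 t₀) (jP t₀ r)]
        ring
      rw [e1]
      have hq : IntervalIntegrable (fun s => Y s / s) volume t₀ r := by
        refine ContinuousOn.intervalIntegrable ?_
        rw [Set.uIcc_of_le hr.1]
        exact hYc.continuousOn.div continuousOn_id fun s hs => (ht₀.trans_le hs.1).ne'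
      -- The pseudo-conformal energy contains `s² P(s)` plus nonnegative terms, so `s² P(s) ≤ Y(s)`
      -- at almost every `s`.
      have h2 : ∫ s in t₀..r, potential γ R s * s ≤ ∫ s in t₀..r, Y s / s := by
        refine intervalIntegral.integral_mono_ae_restrict hr.1 (jP t₀ r) hq ?_
        have hsub' : Set.Icc t₀ r ⊆ timeInterval T := fun s hs =>
          hsub ⟨ht₀.trans_le hs.1, hs.2.trans hr.2⟩
        filter_upwards [ae_restrict_of_ae_restrict_of_subset hsub' hae,
          ae_restrict_mem measurableSet_Icc] with s hs hsI
        have hs0 : 0 < s := ht₀.trans_le hsI.1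
        rw [le_div_iff₀ hs0]
        have h3 := hs.2
        have h4 : 0 ≤ ∫ x, ‖s • Λ s x - R s x • x‖ ^ 2 := integral_nonneg fun x => sq_nonneg _
        have h5 : 0 ≤ ∫ x, ‖G s x‖ ^ 2 := integral_nonneg fun x => sq_nonneg _
        have h6 : 0 ≤ s ^ 2 * ∫ x, ‖G s x‖ ^ 2 := mul_nonneg (sq_nonneg _) h5
        rw [conformal] at h3
        simp only [hY]
        linarith
      have := mul_le_mul_of_nonneg_left h2 hc
      linarith
    have h7 := le_rpow_of_integral_le hYc hc ht₀ ht hG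
    -- Before `t₀` the Sobolev bound on the internal energy replaces Gronwall, whose coefficient
    -- `1/s` is not integrable at zero.
    have h8 : Y t₀ ≤ K / 2 + c * (S / γ * (t₀ ^ 2 / 2)) := by
      have h9 : ∫ s in (0 : ℝ)..t₀, potential γ R s * s ≤ S / γ * (t₀ ^ 2 / 2) := by
        have e2 : ∫ s in (0 : ℝ)..t₀, S / γ * s = S / γ * (t₀ ^ 2 / 2) := by
          rw [intervalIntegral.integral_const_mul, integral_id]
          ring
        rw [← e2]
        refine intervalIntegral.integral_mono_on ht₀.le (jP 0 t₀)
          ((continuous_const.mul continuous_id).intervalIntegrable 0 t₀) fun s hs => ?_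
        exact mul_le_mul_of_nonneg_right (reg.potential_le hγ s) hs.1
      have := mul_le_mul_of_nonneg_left h9 hc
      simp only [hY]
      linarith
    calc conformal γ R G Λ t ≤ Y t := hle
      _ ≤ Y t₀ * (t / t₀) ^ c := h7
      _ ≤ (K / 2 + c * (S / γ * (t₀ ^ 2 / 2))) * (t / t₀) ^ c :=
        mul_le_mul_of_nonneg_right h8 (Real.rpow_nonneg (by positivity) _)
      _ = _ := by
        rw [Real.div_rpow ht0.le ht₀.le]
        ring

lemma eLpNorm_two_le {F : Type*} [NormedAddCommGroup F] {f : E d → F}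
    (hf : Integrable fun x => ‖f x‖ ^ 2) {b : ℝ} (hb : 0 ≤ b) (h : ∫ x, ‖f x‖ ^ 2 ≤ b ^ 2) :
    eLpNorm f 2 volume ≤ ENNReal.ofReal b := by
  have h1 : eLpNorm f 2 volume ^ 2 ≤ ENNReal.ofReal b ^ 2 := by
    rw [← lintegral_enorm_sq, ← ENNReal.ofReal_pow hb]
    simp only [enorm_sq_eq_ofReal]
    rw [← ofReal_integral_eq_lintegral_ofReal hf (Filter.Eventually.of_forall fun x => sq_nonneg _)]
    exact ENNReal.ofReal_le_ofReal h
  exact (ENNReal.pow_le_pow_left_iff two_ne_zero).1 h1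

/-- The constant in the decay estimate. -/
def decayConst (d : ℕ) (γ S K t₀ : ℝ) : ℝ :=
  Real.sqrt (2 * conformalConst d γ S K t₀) + Real.sqrt (2 * conformalConst d γ S K t₀)
    + Real.sqrt (γ * conformalConst d γ S K t₀)

/-- Each of the three nonnegative terms of the pseudo-conformal energy is bounded separately and
divided by `t²`. The square roots carry the factor `2` of the quadratic terms and the `γ`
normalising the internal energy. -/
lemma WeakEquations.decay (weq : WeakEquations γ T ρ₀ R G Λ) (hT : 0 < T)
    (reg : RegularFields γ M S R G Λ) (hγ : 1 < γ) (hρ : LocallyIntegrable ρ₀) {K : ℝ≥0}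
    (hK : ∫⁻ x, ENNReal.ofReal (‖x‖ ^ 2 * ρ₀ x) ≤ K) (hE : EnergyNonincreasing γ T R G Λ)
    {t₀ : ℝ} (ht₀ : 0 < t₀) :
    ∀ᵐ t ∂(volume.restrict (timeInterval T)), t₀ ≤ t →
      eLpNorm (G t) 2 volume + eLpNorm (fun x => Λ t x - t⁻¹ • R t x • x) 2 volume
          + eLpNorm (fun x => rho R t x ^ (γ / 2)) 2 volume
        ≤ ENNReal.ofReal (decayConst d γ S K t₀) * ENNReal.ofReal (t ^ (-decayRate d γ)) := by
  filter_upwards [weq.conformal_le_rpow hT reg hγ hρ hK hE ht₀] with t h ht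
  obtain ⟨hi, hle⟩ := h ht
  have ht0 : 0 < t := ht₀.trans_le ht
  have hγ0 : 0 < γ := by linarith
  set C := conformalConst d γ S K t₀ with hC
  have hC0 : 0 ≤ C := conformalConst_nonneg hγ reg.density_pow.nonneg K.coe_nonneg ht₀
  set τ := t ^ (-decayRate d γ) with hτ
  have hτ0 : 0 ≤ τ := Real.rpow_nonneg ht0.le _
  have hpow : t ^ (2 - 2 * decayRate d γ) = t ^ 2 * τ ^ 2 := by
    rw [hτ, ← Real.rpow_mul_natCast ht0.le, ← Real.rpow_natCast t 2, ← Real.rpow_add ht0]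
    congr 1
    push_cast
    ring
  rw [hpow] at hle
  have ht2 : 0 < t ^ 2 := by positivity
  have hA : 0 ≤ ∫ x, ‖t • Λ t x - R t x • x‖ ^ 2 := integral_nonneg fun x => sq_nonneg _
  have hB : 0 ≤ ∫ x, ‖G t x‖ ^ 2 := integral_nonneg fun x => sq_nonneg _
  have hP := potential_nonneg hγ R t
  rw [conformal] at hle
  have hsq : ∀ a : ℝ, 0 ≤ a → (Real.sqrt (a * C) * τ) ^ 2 = a * (C * τ ^ 2) := fun a ha => by
    rw [mul_pow, Real.sq_sqrt (mul_nonneg ha hC0)]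
    ring
  have b1 : eLpNorm (G t) 2 volume ≤ ENNReal.ofReal (Real.sqrt (2 * C) * τ) := by
    refine eLpNorm_two_le (reg.int_G t) (by positivity) ?_
    rw [hsq 2 two_pos.le]
    have : t ^ 2 * ∫ x, ‖G t x‖ ^ 2 ≤ t ^ 2 * (2 * (C * τ ^ 2)) := by
      have := mul_nonneg ht2.le hP
      linarith
    exact le_of_mul_le_mul_left this ht2
  have b2 : eLpNorm (fun x => Λ t x - t⁻¹ • R t x • x) 2 volume ≤
      ENNReal.ofReal (Real.sqrt (2 * C) * τ) := by
    have e1 : ∀ x, ‖Λ t x - t⁻¹ • R t x • x‖ ^ 2 =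
        (t ^ 2)⁻¹ * ‖t • Λ t x - R t x • x‖ ^ 2 := fun x => by
      have : Λ t x - t⁻¹ • R t x • x = t⁻¹ • (t • Λ t x - R t x • x) := by
        rw [smul_sub, smul_smul t⁻¹ t, inv_mul_cancel₀ ht0.ne', one_smul]
      rw [this, norm_smul, mul_pow, norm_inv, inv_pow, Real.norm_eq_abs, sq_abs]
    refine eLpNorm_two_le ?_ (by positivity) ?_
    · simp only [e1]
      exact hi.const_mul _
    · simp only [e1]
      rw [integral_const_mul, hsq 2 two_pos.le, inv_mul_le_iff₀ ht2]
      have := mul_nonneg ht2.le hP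
      have := mul_nonneg ht2.le hB
      linarith
  have b3 : eLpNorm (fun x => rho R t x ^ (γ / 2)) 2 volume ≤
      ENNReal.ofReal (Real.sqrt (γ * C) * τ) := by
    have e1 : ∀ x, ‖rho R t x ^ (γ / 2)‖ ^ 2 = rho R t x ^ γ := fun x => by
      rw [Real.norm_eq_abs, sq_abs, ← Real.rpow_mul_natCast (rho_nonneg R t x)]
      congr 1
      push_cast
      ring
    refine eLpNorm_two_le ?_ (by positivity) ?_
    · simp only [e1]
      exact reg.int_pow t
    · simp only [e1]
      rw [hsq γ hγ0.le]
      have h3 : t ^ 2 * potential γ R t ≤ t ^ 2 * (C * τ ^ 2) := by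
        have := mul_nonneg ht2.le hB
        linarith
      have h4 := le_of_mul_le_mul_left h3 ht2
      rw [potential, div_le_iff₀ hγ0] at h4
      linarith
  refine (add_le_add (add_le_add b1 b2) b3).trans (le_of_eq ?_)
  rw [← ENNReal.ofReal_add (by positivity) (by positivity),
    ← ENNReal.ofReal_add (by positivity) (by positivity),
    ← ENNReal.ofReal_mul (by rw [decayConst]; positivity), decayConst]
  congr 1
  ring

/-- Decay of finite energy weak solutions with finite variance and nonincreasing energy. -/
theorem exists_decay (hdγ : Admissible d γ) (M₁ K : ℝ≥0) (t₀ : ℝ) (ht₀ : 0 < t₀) : ∃ C : ℝ≥0,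
      ∀ (T : EReal) (ρ₀ : E d → ℝ) (J₀ : E d → E d)
        (R : ℝ → E d → ℝ) (G Λ : ℝ → E d → E d),
      0 < T → IsFiniteEnergyWeakSolution γ T ρ₀ J₀ R G Λ →
      energyNorm T R G Λ ≤ (M₁ : ℝ≥0∞) →
      EnergyNonincreasing γ T R G Λ →
      ∫⁻ x, ENNReal.ofReal (‖x‖ ^ 2 * ρ₀ x) ≤ (K : ℝ≥0∞) →
        ∀ᵐ t ∂(volume.restrict (timeInterval T)), t₀ ≤ t →
          eLpNorm (G t) 2 volume
              + eLpNorm (fun x => Λ t x - t⁻¹ • R t x • x) 2 volume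
              + eLpNorm (fun x => rho R t x ^ (γ / 2)) 2 volume
            ≤ (C : ℝ≥0∞) * ENNReal.ofReal (t ^ (-decayRate d γ)) := by
  obtain ⟨S, hS⟩ := exists_regularFields hdγ M₁
  refine ⟨Real.toNNReal (decayConst d γ S K t₀), fun T ρ₀ J₀ R G Λ hT sol hM hE hK => ?_⟩
  obtain ⟨R', G', Λ', reg, hR, hG, hΛ⟩ := hS T ρ₀ J₀ R G Λ sol hM
  have hγ := hdγ.one_lt
  have weq := sol.weakEquations hγ reg hR hG hΛ
  have hen : ∀ᵐ t ∂(volume.restrict (timeInterval T)),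
      energy γ R' G' Λ' t = energy γ R G Λ t := by
    filter_upwards [hR.slice, hG.slice, hΛ.slice] with t h1 h2 h3
    refine lintegral_congr_ae ?_
    filter_upwards [h1, h2, h3] with x e1 e2 e3
    rw [rho, rho, e1, e2, e3]
  -- Replacing the fields by representatives changes the energy only on a null set of times, which
  -- both quantifiers tolerate.
  have hE' : EnergyNonincreasing γ T R' G' Λ' := by
    filter_upwards [hE, hen] with s hs es
    filter_upwards [hs, hen] with t ht et hst
    rw [es, et]
    exact ht hst
  filter_upwards [weq.decay hT reg hγ sol.locInt_rho0 hK hE' ht₀, hR.slice, hG.slice,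
    hΛ.slice] with t h h1 h2 h3 ht
  have e2 : eLpNorm (G t) 2 volume = eLpNorm (G' t) 2 volume := eLpNorm_congr_ae h2
  have e3 : eLpNorm (fun x => Λ t x - t⁻¹ • R t x • x) 2 volume =
      eLpNorm (fun x => Λ' t x - t⁻¹ • R' t x • x) 2 volume := by
    refine eLpNorm_congr_ae ?_
    filter_upwards [h1, h3] with x k1 k3
    rw [k1, k3]
  have e4 : eLpNorm (fun x => rho R t x ^ (γ / 2)) 2 volume =
      eLpNorm (fun x => rho R' t x ^ (γ / 2)) 2 volume := by
    refine eLpNorm_congr_ae ?_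
    filter_upwards [h1] with x k1
    rw [rho, rho, k1]
  rw [e2, e3, e4]
  exact h ht

end Decay

end QHD

end

theorem theorem1p7 (d : ℕ) (γ : ℝ) (hdγ : QHD.Admissible d γ) :
    -- (i) the space-time bound, with a constant depending only on `d` and `γ`
    (∃ C : ℝ≥0, ∀ (T : EReal) (M₁ : ℝ≥0) (ρ₀ : QHD.E d → ℝ) (J₀ : QHD.E d → QHD.E d)
        (R : ℝ → QHD.E d → ℝ) (G Λ : ℝ → QHD.E d → QHD.E d),
      0 < T → QHD.IsFiniteEnergyWeakSolution γ T ρ₀ J₀ R G Λ →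
      QHD.energyNorm T R G Λ ≤ (M₁ : ℝ≥0∞) →
        (∀ᵐ t ∂(volume.restrict (QHD.timeInterval T)),
          Integrable (QHD.rho R t) ∧ Integrable (QHD.sqrtRhoP γ R t)) ∧
        QHD.spaceTimeSq T ((3 - (d : ℝ)) / 2) (QHD.rho R)
            + QHD.spaceTimeSq T ((1 - (d : ℝ)) / 2) (QHD.sqrtRhoP γ R)
          ≤ (C : ℝ≥0∞) * (M₁ : ℝ≥0∞) ^ 4) ∧
    -- (ii) decay for data of finite variance, away from `t = 0`
    (∀ (M₁ K : ℝ≥0) (t₀ : ℝ), 0 < t₀ → ∃ C : ℝ≥0,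
      ∀ (T : EReal) (ρ₀ : QHD.E d → ℝ) (J₀ : QHD.E d → QHD.E d)
        (R : ℝ → QHD.E d → ℝ) (G Λ : ℝ → QHD.E d → QHD.E d),
      0 < T → QHD.IsFiniteEnergyWeakSolution γ T ρ₀ J₀ R G Λ →
      QHD.energyNorm T R G Λ ≤ (M₁ : ℝ≥0∞) →
      QHD.EnergyNonincreasing γ T R G Λ →
      ∫⁻ x, ENNReal.ofReal (‖x‖ ^ 2 * ρ₀ x) ≤ (K : ℝ≥0∞) →
        ∀ᵐ t ∂(volume.restrict (QHD.timeInterval T)), t₀ ≤ t →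
          eLpNorm (G t) 2 volume
              + eLpNorm (fun x => Λ t x - t⁻¹ • R t x • x) 2 volume
              + eLpNorm (fun x => QHD.rho R t x ^ (γ / 2)) 2 volume
            ≤ (C : ℝ≥0∞) * ENNReal.ofReal (t ^ (-QHD.decayRate d γ))) := by
  exact ⟨QHD.exists_spaceTimeSq_le hdγ, fun M₁ K t₀ ht₀ => QHD.exists_decay hdγ M₁ K t₀ ht₀⟩
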